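/- Let $n,m\ge 0$ be integers and let $k$ be a complex number that is not rational. Put $p(i)=0$ for $1\le i\le n$ and $p(i)=1$ for $n<i\le n+m$. Let $V$ be the complex vector space with basis $\varepsilon_1,\dots,\varepsilon_{n+m}$ and symmetric bilinear form $(\varepsilon_i,\varepsilon_j)=\delta_{ij}k^{p(i)}$, let $\varepsilon_i^*$ be the dual basis, and let $S(V^*)$ be the algebra of polynomial functions on $V$. On rational functions of $x_1,\dots,x_{n+m}$ consider the operators $\partial_{\varepsilon_i}=k^{p(i)}x_i\frac{\partial}{\partial x_i}$ and the quantum Moser matrix $$L_{ii}=\partial_{\varepsilon_i}-\sum_{j\ne i}k^{1-p(j)}\frac{x_i}{x_i-x_j},\qquad L_{ij}=k^{1-p(j)}\frac{x_i}{x_i-x_j}\quad(i\ne j).$$ Let $\mathcal L_r=\sum_{i,j}k^{-p(i)}(L^r)_{ij}$ for $r\ge 1$, and let $\mathcal D_{n,m}$ be the unital algebra of differential operators generated by all $\mathcal L_r$, $r\ge1$. The Harish-Chandra homomorphism $\phi_{n,m}:\mathcal D_{n,m}\to S(V^*)$ is the restriction to $\mathcal D_{n,m}$ of the unique algebra homomorphism,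 defined on the algebra generated by the $\partial_{\varepsilon_i}$ and the $\frac{x_i}{x_i-x_j}$, such that $$\partial_{\varepsilon_i}\mapsto k^{p(i)}\varepsilon_i^*,\qquad \frac{x_i}{x_i-x_j}\mapsto 1\quad(i<j).$$ Let $$\rho=\frac12\sum_{i=1}^n\bigl(k(2i-n-1)-m\bigr)\varepsilon_i+\frac12\sum_{j=1}^m\bigl(k^{-1}(2j-m-1)+n\bigr)\varepsilon_{n+j}.$$ For a root $\alpha=\varepsilon_i-\varepsilon_j$ ($i\ne j$) let $s_\alpha(v)=v-\frac{2(v,\alpha)}{(\alpha,\alpha)}\alpha$ and $s_\alpha\circ v=s_\alpha(v+\rho)-\rho$. The root is even if $p(i)=p(j)$ and odd otherwise, and it is positive if $i<j$. For an odd positive root $\alpha$ let $l^{\pm}_\alpha(v)=(v+\rho,\alpha)\mp\frac12(\alpha,\alpha)$. Let $\Lambda^*_{n,m}\subset S(V^*)$ be the subalgebra of all polynomials $f$ such that $f(s_\alpha\circ v)=f(v)$ for every even root $\alpha$, and the polynomial $f(s_\alpha\circ v)-f(v)$ lies in the ideal $(l^-_\alpha l^+_\alpha)$ of $S(V^*)$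 for every odd positive root $\alpha$. Then $\phi_{n,m}$ is injective and its image is exactly $\Lambda^*_{n,m}$. -/

import Mathlib

noncomputable section

namespace DeformedCMS

open MvPolynomial

/-! ### The vector space `V`, its deformed form, roots and reflections -/

/-- The space `V` with basis `ε_1, …, ε_{n+m}`, a vector being given by its coordinates. -/
abbrev V (n m : ℕ) : Type := Fin (n + m) → ℂ

/-- The parity of an index: `0` for the first `n` indices, `1` for the last `m`. -/
def parity (n m : ℕ) (i : Fin (n + m)) : ℕ := if (i : ℕ) < n then 0 else 1

/-- The symmetric bilinear form with `(ε_i, ε_j) = δ_ij k ^ p(i)`. -/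
def form (n m : ℕ) (k : ℂ) (v w : V n m) : ℂ := ∑ i, k ^ parity n m i * v i * w i

/-- The root `ε_i - ε_j`. -/
def root (n m : ℕ) (i j : Fin (n + m)) : V n m := Pi.single i 1 - Pi.single j 1

/-- The set `R_0` of even roots. -/
def evenRoots (n m : ℕ) : Set (V n m) :=
  {α | ∃ i j, i ≠ j ∧ parity n m i = parity n m j ∧ α = root n m i j}

/-- The set of odd positive roots. -/
def oddPosRoots (n m : ℕ) : Set (V n m) :=
  {α | ∃ i j, i < j ∧ parity n m i ≠ parity n m j ∧ α = root n m i j}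

/-- The reflection `s_α v = v - (2 (v, α) / (α, α)) α`. -/
def reflection (n m : ℕ) (k : ℂ) (α v : V n m) : V n m :=
  v - (2 * form n m k v α / form n m k α α) • α

/-- The deformed Weyl vector; the index `i` stands for `i + 1` in one-based numbering. -/
def rho (n m : ℕ) (k : ℂ) : V n m := fun i =>
  if (i : ℕ) < n then (1 / 2) * (k * (2 * ((i : ℕ) + 1 : ℂ) - n - 1) - m)
  else (1 / 2) * (k⁻¹ * (2 * ((i : ℕ) + 1 - n : ℂ) - m - 1) + n)

/-- The affine action of the reflection `s_α`: `s_α ∘ v = s_α (v + ρ) - ρ`. -/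
def affineReflection (n m : ℕ) (k : ℂ) (α v : V n m) : V n m :=
  reflection n m k α (v + rho n m k) - rho n m k

/-! ### Polynomial functions on `V` and shifted quasi-invariants -/

/-- The algebra `S(V*)` of polynomial functions on `V`; the variable `X i` is the dual basis
vector `ε_i^*`, and the value of `f` at `v` is `eval v f`. -/
abbrev SVdual (n m : ℕ) : Type := MvPolynomial (Fin (n + m)) ℂ

/-- The polynomial function `v ↦ (v + ρ, α)`. -/
def shiftedPairing (n m : ℕ) (k : ℂ) (α : V n m) : SVdual n m :=
  ∑ i, C (k ^ parity n m i * α i) * (X i + C (rho n m k i))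

/-- The function `l_α^+ (v) = (v + ρ, α) - (α, α) / 2`. -/
def lPlus (n m : ℕ) (k : ℂ) (α : V n m) : SVdual n m :=
  shiftedPairing n m k α - C (form n m k α α / 2)

/-- The function `l_α^- (v) = (v + ρ, α) + (α, α) / 2`. -/
def lMinus (n m : ℕ) (k : ℂ) (α : V n m) : SVdual n m :=
  shiftedPairing n m k α + C (form n m k α α / 2)

/-- The map `f ↦ (v ↦ f (s_α ∘ v))` on polynomial functions (see `eval_affinePullback`). -/
def affinePullback (n m : ℕ) (k : ℂ) (α : V n m) : SVdual n m →ₐ[ℂ] SVdual n m :=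
  aeval fun i => X i - C (2 * α i / form n m k α α) * shiftedPairing n m k α

theorem eval_shiftedPairing (n m : ℕ) (k : ℂ) (α v : V n m) :
    eval v (shiftedPairing n m k α) = form n m k (v + rho n m k) α := by
  simp only [shiftedPairing, form, map_sum, map_mul, map_add, eval_C, eval_X, Pi.add_apply]
  exact Finset.sum_congr rfl fun i _ => by ring

theorem eval_affinePullback (n m : ℕ) (k : ℂ) (α v : V n m) (f : SVdual n m) :
    eval v (affinePullback n m k α f) = eval (affineReflection n m k α v) f := by
  have h : (eval v).comp (affinePullback n m k α : SVdual n m →+* SVdual n m) =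
      eval (affineReflection n m k α v) := by
    refine MvPolynomial.ringHom_ext (fun r => by simp [affinePullback]) fun i => ?_
    simp [affinePullback, affineReflection, reflection, eval_shiftedPairing]
    ring
  exact RingHom.congr_fun h f

/-- The algebra `Λ^*_{n,m}` of polynomials that are quasi-invariant with respect to the affine
action: invariant under the even reflections, and `f (s_α ∘ v) - f v` lies in the ideal
`(l_α^- l_α^+)` for each odd positive root `α`. -/
def shiftedQuasiInvariants (n m : ℕ) (k : ℂ) : Subalgebra ℂ (SVdual n m) where
  carrier := {f | (∀ α ∈ evenRoots n m, affinePullback n m k α f = f) ∧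
    ∀ α ∈ oddPosRoots n m,
      affinePullback n m k α f - f ∈ Ideal.span {lMinus n m k α * lPlus n m k α}}
  mul_mem' := by
    rintro f g ⟨hf, hf'⟩ ⟨hg, hg'⟩
    refine ⟨fun α h => by rw [map_mul, hf α h, hg α h], fun α h => ?_⟩
    have : affinePullback n m k α (f * g) - f * g =
        affinePullback n m k α f * (affinePullback n m k α g - g) +
          g * (affinePullback n m k α f - f) := by rw [map_mul]; ring
    rw [this]
    exact Ideal.add_mem _ (Ideal.mul_mem_left _ _ (hg' α h)) (Ideal.mul_mem_left _ _ (hf' α h))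
  add_mem' := by
    rintro f g ⟨hf, hf'⟩ ⟨hg, hg'⟩
    refine ⟨fun α h => by rw [map_add, hf α h, hg α h], fun α h => ?_⟩
    rw [map_add, add_sub_add_comm]
    exact Ideal.add_mem _ (hf' α h) (hg' α h)
  algebraMap_mem' := fun r => ⟨fun α _ => by simp, fun α _ => by simp⟩

/-! ### Differential operators with rational coefficients -/

/-- The field `ℂ(x_1, …, x_{n+m})` of rational functions. -/
abbrev RatFun (n m : ℕ) : Type := FractionRing (MvPolynomial (Fin (n + m)) ℂ)

/-- The coordinate function `x_i`. -/
def x (n m : ℕ) (i : Fin (n + m)) : RatFun n m :=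
  algebraMap (MvPolynomial (Fin (n + m)) ℂ) (RatFun n m) (X i)

/-- The partial derivative `∂ / ∂ x_i` on rational functions: the unique extension of the partial
derivative of polynomials (see `partialDer_algebraMap`). -/
def partialDer (n m : ℕ) (i : Fin (n + m)) : Derivation ℂ (RatFun n m) (RatFun n m) :=
  haveI := Algebra.FormallyEtale.of_isLocalization (Rₘ := RatFun n m)
    (nonZeroDivisors (MvPolynomial (Fin (n + m)) ℂ))
  ((LinearMap.liftBaseChange (RatFun n m)
      ((Algebra.linearMap (MvPolynomial (Fin (n + m)) ℂ) (RatFun n m)).compDer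
        (pderiv i)).liftKaehlerDifferential) ∘ₗ
    (KaehlerDifferential.tensorKaehlerEquivOfFormallyEtale ℂ (MvPolynomial (Fin (n + m)) ℂ)
      (RatFun n m)).symm.toLinearMap).compDer (KaehlerDifferential.D ℂ (RatFun n m))

theorem partialDer_algebraMap (n m : ℕ) (i : Fin (n + m)) (p : MvPolynomial (Fin (n + m)) ℂ) :
    partialDer n m i (algebraMap _ (RatFun n m) p) = algebraMap _ (RatFun n m) (pderiv i p) := by
  have := Algebra.FormallyEtale.of_isLocalization (Rₘ := RatFun n m)
    (nonZeroDivisors (MvPolynomial (Fin (n + m)) ℂ))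
  simp [partialDer, KaehlerDifferential.tensorKaehlerEquivOfFormallyEtale_symm_D_algebraMap]

/-- The operator `∂_{ε_i} = k ^ p(i) x_i ∂ / ∂ x_i`, determined by
`∂_{ε_i} x_j = (ε_i, ε_j) x_j`. -/
def del (n m : ℕ) (k : ℂ) (i : Fin (n + m)) : Module.End ℂ (RatFun n m) :=
  k ^ parity n m i • (LinearMap.mulLeft ℂ (x n m i) * (partialDer n m i : _ →ₗ[ℂ] _))

/-- The operator of multiplication by `x_i / (x_i - x_j)`. -/
def mulOp (n m : ℕ) (i j : Fin (n + m)) : Module.End ℂ (RatFun n m) :=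
  LinearMap.mulLeft ℂ (x n m i / (x n m i - x n m j))

/-- The quantum Moser matrix. -/
def moser (n m : ℕ) (k : ℂ) :
    Matrix (Fin (n + m)) (Fin (n + m)) (Module.End ℂ (RatFun n m)) :=
  Matrix.of fun i j =>
    if i = j then
      del n m k i - ∑ l ∈ Finset.univ.erase i, k ^ (1 - parity n m l) • mulOp n m i l
    else k ^ (1 - parity n m j) • mulOp n m i j

/-- The deformed CMS integral `ℒ_r = e^* L ^ r e`, where `e^*_i = k ^ (-p(i))` and `e_j = 1`. -/
def cmsIntegral (n m : ℕ) (k : ℂ) (r : ℕ) : Module.End ℂ (RatFun n m) :=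
  ∑ i, ∑ j, (k ^ parity n m i)⁻¹ • (moser n m k ^ r) i j

/-- The algebra `𝒟_{n,m}` generated by the integrals `ℒ_r`, `r ≥ 1`. -/
def integralAlgebra (n m : ℕ) (k : ℂ) : Subalgebra ℂ (Module.End ℂ (RatFun n m)) :=
  Algebra.adjoin ℂ {D | ∃ r : ℕ, 1 ≤ r ∧ D = cmsIntegral n m k r}

/-- The algebra of differential operators generated by the `∂_{ε_i}` and the multiplications by
`x_i / (x_i - x_j)`, `i < j` (so also by `x_j / (x_j - x_i) = 1 - x_i / (x_i - x_j)`). -/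
def operatorAlgebra (n m : ℕ) (k : ℂ) : Subalgebra ℂ (Module.End ℂ (RatFun n m)) :=
  Algebra.adjoin ℂ ({D | ∃ i, D = del n m k i} ∪ {D | ∃ i j, i < j ∧ D = mulOp n m i j})

theorem del_mem (n m : ℕ) (k : ℂ) (i : Fin (n + m)) : del n m k i ∈ operatorAlgebra n m k :=
  Algebra.subset_adjoin (Or.inl ⟨i, rfl⟩)

theorem mulOp_mem_of_lt (n m : ℕ) (k : ℂ) {i j : Fin (n + m)} (h : i < j) :
    mulOp n m i j ∈ operatorAlgebra n m k :=
  Algebra.subset_adjoin (Or.inr ⟨i, j, h, rfl⟩)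

theorem x_sub_ne_zero (n m : ℕ) {i j : Fin (n + m)} (h : i ≠ j) : x n m i - x n m j ≠ 0 := by
  rw [sub_ne_zero]
  intro e
  exact h (MvPolynomial.X_injective (IsFractionRing.injective _ (RatFun n m) e))

theorem mulOp_mem (n m : ℕ) (k : ℂ) {i j : Fin (n + m)} (h : i ≠ j) :
    mulOp n m i j ∈ operatorAlgebra n m k := by
  rcases lt_or_gt_of_ne h with h' | h'
  · exact mulOp_mem_of_lt n m k h'
  · have e : mulOp n m i j = 1 - mulOp n m j i := by
      ext1 f
      have h1 := x_sub_ne_zero n m h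
      have h2 := x_sub_ne_zero n m h.symm
      simp only [mulOp, LinearMap.mulLeft_apply, LinearMap.sub_apply, Module.End.one_apply]
      field_simp
      ring
    rw [e]
    exact sub_mem (one_mem _) (mulOp_mem_of_lt n m k h')

theorem moser_pow_mem (n m : ℕ) (k : ℂ) (r : ℕ) (i j : Fin (n + m)) :
    (moser n m k ^ r) i j ∈ operatorAlgebra n m k := by
  induction r generalizing i j with
  | zero =>
    rw [pow_zero, Matrix.one_apply]
    split_ifs
    · exact one_mem _
    · exact zero_mem _
  | succ r ih =>
    rw [pow_succ, Matrix.mul_apply]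
    refine sum_mem fun l _ => mul_mem (ih i l) ?_
    rw [moser, Matrix.of_apply]
    split_ifs with h
    · exact sub_mem (del_mem n m k l) (sum_mem fun s hs => Subalgebra.smul_mem _
        (mulOp_mem n m k (Finset.ne_of_mem_erase hs).symm) _)
    · exact Subalgebra.smul_mem _ (mulOp_mem n m k h) _

theorem integralAlgebra_le (n m : ℕ) (k : ℂ) :
    integralAlgebra n m k ≤ operatorAlgebra n m k := by
  refine Algebra.adjoin_le ?_
  rintro _ ⟨r, -, rfl⟩
  exact sum_mem fun i _ => sum_mem fun j _ =>
    Subalgebra.smul_mem _ (moser_pow_mem n m k r i j) _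

/-! ### The Harish-Chandra homomorphism

An operator has leading symbol `P` if, in the expansion region `|x_1| > |x_2| > …`, it maps `x ^ χ`
to `P χ • x ^ χ` up to lower terms, for all `χ`. This proves that the rules
`∂_{ε_i} ↦ k ^ p(i) ε_i^*`, `x_i / (x_i - x_j) ↦ 1` (`i < j`) do define a homomorphism. -/

/-- The lexicographic degree of a polynomial. -/
def lexDeg (n m : ℕ) (p : MvPolynomial (Fin (n + m)) ℂ) :
    WithBot (MonomialOrder.lex (σ := Fin (n + m))).syn :=
  MonomialOrder.lex.toWithBotSyn (MonomialOrder.lex.withBotDegree p)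

theorem lexDeg_mul (n m : ℕ) (p q : MvPolynomial (Fin (n + m)) ℂ) :
    lexDeg n m (p * q) = lexDeg n m p + lexDeg n m q := by
  rw [lexDeg, MonomialOrder.withBotDegree_mul, map_add]
  rfl

theorem lexDeg_add (n m : ℕ) (p q : MvPolynomial (Fin (n + m)) ℂ) :
    lexDeg n m (p + q) ≤ max (lexDeg n m p) (lexDeg n m q) :=
  MonomialOrder.withBotDegree_add_le p q

theorem lexDeg_neg (n m : ℕ) (p : MvPolynomial (Fin (n + m)) ℂ) :
    lexDeg n m (-p) = lexDeg n m p :=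
  le_antisymm
    (MonomialOrder.withBotDegree_le_withBotDegree_of_support_subset (by simp))
    (MonomialOrder.withBotDegree_le_withBotDegree_of_support_subset (by simp))

theorem lexDeg_sub (n m : ℕ) (p q : MvPolynomial (Fin (n + m)) ℂ) :
    lexDeg n m (p - q) ≤ max (lexDeg n m p) (lexDeg n m q) := by
  rw [sub_eq_add_neg, ← lexDeg_neg n m q]
  exact lexDeg_add n m _ _

theorem lexDeg_ne_bot (n m : ℕ) {p : MvPolynomial (Fin (n + m)) ℂ} (h : p ≠ 0) :
    lexDeg n m p ≠ ⊥ := by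
  rw [lexDeg, Ne, MonomialOrder.toWithBotSyn_apply_eq_bot_iff]
  exact fun e => h ((MonomialOrder.withBotDegree_eq_bot_iff p).1 e)

theorem lexDeg_zero (n m : ℕ) : lexDeg n m 0 = ⊥ := by
  rw [lexDeg, MonomialOrder.withBotDegree_zero]
  rfl

theorem lexDeg_euler (n m : ℕ) (i : Fin (n + m)) (p : MvPolynomial (Fin (n + m)) ℂ) :
    lexDeg n m (X i * pderiv i p) ≤ lexDeg n m p := by
  refine MonomialOrder.withBotDegree_le_withBotDegree_of_support_subset fun c hc => ?_
  rw [mem_support_iff] at hc ⊢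
  contrapose! hc
  have h : coeff c (X i * pderiv i p) = coeff c p * c i := by
    clear hc
    induction p using MvPolynomial.induction_on' with
    | monomial s a =>
      rw [X_mul_pderiv_monomial, coeff_smul, coeff_monomial]
      split_ifs with e
      · rw [e, nsmul_eq_mul, mul_comm]
      · simp
    | add p q hp hq => rw [map_add, mul_add, coeff_add, coeff_add, hp, hq, add_mul]
  rw [h, hc, zero_mul]

/-- A rational function with only lower terms: a quotient `p / q` with `deg p < deg q`. -/
def Small (n m : ℕ) (f : RatFun n m) : Prop :=
  ∃ p q : MvPolynomial (Fin (n + m)) ℂ, lexDeg n m p < lexDeg n m q ∧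
    f * algebraMap _ (RatFun n m) q = algebraMap _ (RatFun n m) p

theorem ne_zero_of_lexDeg_lt (n m : ℕ) {p q : MvPolynomial (Fin (n + m)) ℂ}
    (h : lexDeg n m p < lexDeg n m q) : q ≠ 0 := by
  rintro rfl
  rw [lexDeg_zero] at h
  exact not_lt_bot h

theorem not_small_one (n m : ℕ) : ¬ Small n m 1 := by
  rintro ⟨p, q, h, e⟩
  rw [one_mul] at e
  rw [IsFractionRing.injective _ (RatFun n m) e] at h
  exact lt_irrefl _ h

theorem Small.add {n m : ℕ} {f g : RatFun n m} (hf : Small n m f) (hg : Small n m g) :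
    Small n m (f + g) := by
  obtain ⟨p, q, h, e⟩ := hf
  obtain ⟨p', q', h', e'⟩ := hg
  refine ⟨p * q' + p' * q, q * q', ?_, ?_⟩
  · refine (lexDeg_add n m _ _).trans_lt (max_lt ?_ ?_)
    · rw [lexDeg_mul, lexDeg_mul]
      exact WithBot.add_lt_add_right (lexDeg_ne_bot n m (ne_zero_of_lexDeg_lt n m h')) h
    · rw [mul_comm q q', lexDeg_mul, lexDeg_mul]
      exact WithBot.add_lt_add_right (lexDeg_ne_bot n m (ne_zero_of_lexDeg_lt n m h)) h'
  · simp only [map_add, map_mul, ← e, ← e']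
    ring

theorem Small.mul {n m : ℕ} {f g : RatFun n m} (hf : Small n m f) (hg : Small n m g) :
    Small n m (f * g) := by
  obtain ⟨p, q, h, e⟩ := hf
  obtain ⟨p', q', h', e'⟩ := hg
  refine ⟨p * p', q * q', ?_, ?_⟩
  · rw [lexDeg_mul, lexDeg_mul]
    exact (add_le_add_right h'.le _).trans_lt
      (WithBot.add_lt_add_right (lexDeg_ne_bot n m (ne_zero_of_lexDeg_lt n m h')) h)
  · simp only [map_mul, ← e, ← e']
    ring

theorem small_zero (n m : ℕ) : Small n m 0 := by
  refine ⟨0, 1, ?_, by simp⟩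
  rw [lexDeg_zero, bot_lt_iff_ne_bot]
  exact lexDeg_ne_bot n m one_ne_zero

theorem Small.smul {n m : ℕ} {f : RatFun n m} (c : ℂ) (hf : Small n m f) :
    Small n m (c • f) := by
  obtain ⟨p, q, h, e⟩ := hf
  refine ⟨c • p, q, lt_of_le_of_lt ?_ h, ?_⟩
  · exact MonomialOrder.withBotDegree_le_withBotDegree_of_support_subset support_smul
  · rw [smul_mul_assoc, e, Algebra.smul_def, Algebra.smul_def, map_mul]
    rw [← IsScalarTower.algebraMap_apply]

theorem Small.euler {n m : ℕ} {f : RatFun n m} (i : Fin (n + m)) (hf : Small n m f) :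
    Small n m (x n m i * partialDer n m i f) := by
  obtain ⟨p, q, h, e⟩ := hf
  have hq := lexDeg_ne_bot n m (ne_zero_of_lexDeg_lt n m h)
  refine ⟨X i * pderiv i p * q - p * (X i * pderiv i q), q * q, ?_, ?_⟩
  · refine (lexDeg_sub n m _ _).trans_lt (max_lt ?_ ?_)
    · rw [lexDeg_mul n m (X i * pderiv i p) q, lexDeg_mul n m q q]
      exact WithBot.add_lt_add_right hq ((lexDeg_euler n m i p).trans_lt h)
    · rw [lexDeg_mul n m p, lexDeg_mul n m q q]
      exact (add_le_add_right (lexDeg_euler n m i q) _).trans_lt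
        (WithBot.add_lt_add_right hq h)
  · have h1 := congrArg (partialDer n m i) e
    rw [Derivation.leibniz, partialDer_algebraMap, partialDer_algebraMap] at h1
    simp only [map_sub, map_mul, ← e, ← h1, smul_eq_mul, x]
    ring

theorem small_ratio (n m : ℕ) {i j : Fin (n + m)} (h : i < j) :
    Small n m (x n m j / (x n m i - x n m j)) := by
  have hs := x_sub_ne_zero n m h.ne
  have hlt : lexDeg n m (X j) < lexDeg n m (X i) := by
    rw [lexDeg, lexDeg, (MonomialOrder.withBotDegree_eq_coe_degree_iff _).2 (X_ne_zero j),
      (MonomialOrder.withBotDegree_eq_coe_degree_iff _).2 (X_ne_zero i),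
      MonomialOrder.degree_X, MonomialOrder.degree_X]
    simp only [MonomialOrder.toWithBotSyn_apply_coe, WithBot.coe_lt_coe]
    rw [MonomialOrder.lex_lt_iff]
    exact Finsupp.Lex.single_lt_iff.2 h
  refine ⟨X j, X i - X j, ?_, ?_⟩
  · by_contra! hle
    have := lexDeg_add n m (X i - X j) (X j)
    rw [sub_add_cancel] at this
    exact absurd (this.trans (max_le hle le_rfl)) (not_le.2 hlt)
  · rw [map_sub]
    exact div_mul_cancel₀ _ hs

/-- The monomial `x ^ χ`. -/
def xPow (n m : ℕ) (χ : Fin (n + m) →₀ ℕ) : RatFun n m :=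
  algebraMap _ (RatFun n m) (monomial χ (1 : ℂ))

theorem xPow_ne_zero (n m : ℕ) (χ : Fin (n + m) →₀ ℕ) : xPow n m χ ≠ 0 := by
  rw [xPow, Ne, FaithfulSMul.algebraMap_eq_zero_iff, monomial_eq_zero]
  exact one_ne_zero

theorem euler_xPow (n m : ℕ) (i : Fin (n + m)) (χ : Fin (n + m) →₀ ℕ) :
    x n m i * partialDer n m i (xPow n m χ) = (χ i : ℂ) • xPow n m χ := by
  rw [xPow, partialDer_algebraMap, x, ← map_mul, X_mul_pderiv_monomial, Nat.cast_smul_eq_nsmul,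
    map_nsmul]

/-- The operator `D` has leading symbol `P`. -/
def HasSymbol (n m : ℕ) (D : Module.End ℂ (RatFun n m)) (P : SVdual n m) : Prop :=
  ∀ χ : Fin (n + m) →₀ ℕ,
    (∀ f, Small n m f → ∃ g, Small n m g ∧ D (xPow n m χ * f) = xPow n m χ * g) ∧
    ∃ g, Small n m g ∧
      D (xPow n m χ) = eval (fun i => (χ i : ℂ)) P • xPow n m χ + xPow n m χ * g

theorem HasSymbol.unique {n m : ℕ} {D : Module.End ℂ (RatFun n m)} {P Q : SVdual n m}
    (hP : HasSymbol n m D P) (hQ : HasSymbol n m D Q) : P = Q := by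
  refine funext_set (fun _ => Set.range ((↑) : ℕ → ℂ))
    (fun _ => Set.infinite_range_of_injective Nat.cast_injective) fun v hv => ?_
  choose c hc using fun i => hv i (Set.mem_univ i)
  obtain ⟨g, hg, e⟩ := (hP (Finsupp.equivFunOnFinite.symm c)).2
  obtain ⟨g', hg', e'⟩ := (hQ (Finsupp.equivFunOnFinite.symm c)).2
  have hv' : (fun i => ((Finsupp.equivFunOnFinite.symm c i : ℕ) : ℂ)) = v := by
    ext i
    exact hc i
  rw [hv'] at e e'
  rw [e, Algebra.smul_def, Algebra.smul_def] at e'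
  by_contra hne
  have h1 : (eval v P - eval v Q) • (1 : RatFun n m) = g' + (-1 : ℂ) • g := by
    refine mul_left_cancel₀ (xPow_ne_zero n m (Finsupp.equivFunOnFinite.symm c)) ?_
    rw [Algebra.smul_def, map_sub, neg_one_smul]
    linear_combination e'
  refine not_small_one n m ?_
  have h2 := (hg'.add (hg.smul (-1))).smul (eval v P - eval v Q)⁻¹
  rwa [← h1, smul_smul, inv_mul_cancel₀ (sub_ne_zero.2 hne), one_smul] at h2

theorem HasSymbol.add {n m : ℕ} {D E : Module.End ℂ (RatFun n m)} {P Q : SVdual n m}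
    (hP : HasSymbol n m D P) (hQ : HasSymbol n m E Q) : HasSymbol n m (D + E) (P + Q) := by
  intro χ
  refine ⟨fun f hf => ?_, ?_⟩
  · obtain ⟨g, hg, e⟩ := (hP χ).1 f hf
    obtain ⟨g', hg', e'⟩ := (hQ χ).1 f hf
    exact ⟨g + g', hg.add hg', by rw [LinearMap.add_apply, e, e', mul_add]⟩
  · obtain ⟨g, hg, e⟩ := (hP χ).2
    obtain ⟨g', hg', e'⟩ := (hQ χ).2
    exact ⟨g + g', hg.add hg', by rw [LinearMap.add_apply, e, e', map_add, add_smul]; ring⟩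

theorem HasSymbol.mul {n m : ℕ} {D E : Module.End ℂ (RatFun n m)} {P Q : SVdual n m}
    (hP : HasSymbol n m D P) (hQ : HasSymbol n m E Q) : HasSymbol n m (D * E) (P * Q) := by
  intro χ
  refine ⟨fun f hf => ?_, ?_⟩
  · obtain ⟨g, hg, e⟩ := (hQ χ).1 f hf
    obtain ⟨g', hg', e'⟩ := (hP χ).1 g hg
    exact ⟨g', hg', by rw [Module.End.mul_apply, e, e']⟩
  · obtain ⟨g, hg, e⟩ := (hP χ).2
    obtain ⟨g', hg', e'⟩ := (hQ χ).2
    obtain ⟨h, hh, e''⟩ := (hP χ).1 g' hg'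
    refine ⟨_, (hg.smul (eval (fun i => (χ i : ℂ)) Q)).add hh, ?_⟩
    rw [Module.End.mul_apply, e', map_add, map_smul, e, e'', map_mul, smul_add, smul_smul,
      mul_comm (eval _ P), mul_add, mul_smul_comm, add_assoc]

theorem hasSymbol_algebraMap (n m : ℕ) (c : ℂ) :
    HasSymbol n m (algebraMap ℂ _ c) (C c) := by
  intro χ
  refine ⟨fun f hf => ⟨c • f, hf.smul c, ?_⟩, 0, small_zero n m, ?_⟩
  · rw [Module.algebraMap_end_apply, mul_smul_comm]
  · rw [Module.algebraMap_end_apply, eval_C, mul_zero, add_zero]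

theorem hasSymbol_del (n m : ℕ) (k : ℂ) (i : Fin (n + m)) :
    HasSymbol n m (del n m k i) (C (k ^ parity n m i) * X i) := by
  intro χ
  refine ⟨fun f hf =>
    ⟨k ^ parity n m i • ((χ i : ℂ) • f + x n m i * partialDer n m i f),
      ((hf.smul _).add (hf.euler i)).smul _, ?_⟩, 0, small_zero n m, ?_⟩
  · have h := euler_xPow n m i χ
    simp only [del, LinearMap.smul_apply, Module.End.mul_apply, LinearMap.mulLeft_apply,
      Derivation.coeFn_coe, Derivation.leibniz, smul_eq_mul, mul_smul_comm]
    congr 1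
    rw [Algebra.smul_def] at h ⊢
    linear_combination f * h
  · simp only [del, LinearMap.smul_apply, Module.End.mul_apply, LinearMap.mulLeft_apply,
      Derivation.coeFn_coe, euler_xPow, smul_smul, map_mul, eval_C, eval_X, mul_zero, add_zero]

theorem hasSymbol_mulOp (n m : ℕ) {i j : Fin (n + m)} (h : i < j) :
    HasSymbol n m (mulOp n m i j) 1 := by
  have hs := x_sub_ne_zero n m h.ne
  have e : x n m i / (x n m i - x n m j) = 1 + x n m j / (x n m i - x n m j) := by
    field_simp
    ring
  intro χ
  refine ⟨fun f hf => ⟨f + f * (x n m j / (x n m i - x n m j)),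
    hf.add (hf.mul (small_ratio n m h)), ?_⟩, _, small_ratio n m h, ?_⟩
  · rw [mulOp, LinearMap.mulLeft_apply, e]
    ring
  · rw [mulOp, LinearMap.mulLeft_apply, e, map_one, one_smul]
    ring

theorem exists_hasSymbol (n m : ℕ) (k : ℂ) (D : operatorAlgebra n m k) :
    ∃ P, HasSymbol n m D P := by
  obtain ⟨D, hD⟩ := D
  induction hD using Algebra.adjoin_induction with
  | mem D h =>
    rcases h with ⟨i, rfl⟩ | ⟨i, j, h, rfl⟩
    · exact ⟨_, hasSymbol_del n m k i⟩
    · exact ⟨_, hasSymbol_mulOp n m h⟩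
  | algebraMap c => exact ⟨_, hasSymbol_algebraMap n m c⟩
  | add D E _ _ hD hE =>
    obtain ⟨P, hP⟩ := hD
    obtain ⟨Q, hQ⟩ := hE
    exact ⟨_, hP.add hQ⟩
  | mul D E _ _ hD hE =>
    obtain ⟨P, hP⟩ := hD
    obtain ⟨Q, hQ⟩ := hE
    exact ⟨_, hP.mul hQ⟩

/-- There is exactly one algebra homomorphism with `∂_{ε_i} ↦ k ^ p(i) ε_i^*` and
`x_i / (x_i - x_j) ↦ 1` for `i < j`. -/
theorem existsUnique_harishChandra (n m : ℕ) (k : ℂ) :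
    ∃! Φ : operatorAlgebra n m k →ₐ[ℂ] SVdual n m,
      (∀ i, Φ ⟨del n m k i, del_mem n m k i⟩ = C (k ^ parity n m i) * X i) ∧
      ∀ i j, ∀ h : i < j, Φ ⟨mulOp n m i j, mulOp_mem_of_lt n m k h⟩ = 1 := by
  choose s hs using exists_hasSymbol n m k
  refine ⟨{ toFun := s
            map_one' := (hs 1).unique (by simpa using hasSymbol_algebraMap n m 1)
            map_mul' := fun D E => (hs (D * E)).unique ((hs D).mul (hs E))
            map_zero' := (hs 0).unique (by simpa using hasSymbol_algebraMap n m 0)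
            map_add' := fun D E => (hs (D + E)).unique ((hs D).add (hs E))
            commutes' := fun c => (hs _).unique (hasSymbol_algebraMap n m c) },
    ⟨fun i => (hs _).unique (hasSymbol_del n m k i),
      fun i j h => (hs _).unique (hasSymbol_mulOp n m h)⟩, ?_⟩
  rintro Ψ ⟨h1, h2⟩
  refine AlgHom.ext fun D => ?_
  change Ψ D = s D
  have key : ∀ (D) (hD : D ∈ operatorAlgebra n m k) (P : SVdual n m),
      HasSymbol n m D P → P = s ⟨D, hD⟩ := fun D hD P h => h.unique (hs ⟨D, hD⟩)
  obtain ⟨D, hD⟩ := D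
  induction hD using Algebra.adjoin_induction with
  | mem D h =>
    rcases h with ⟨i, rfl⟩ | ⟨i, j, h, rfl⟩
    · exact (h1 i).trans (key _ _ _ (hasSymbol_del n m k i))
    · exact (h2 i j h).trans (key _ _ _ (hasSymbol_mulOp n m h))
  | algebraMap c =>
    exact (Ψ.commutes c).trans (key _ _ _ (hasSymbol_algebraMap n m c))
  | add D E hD hE ihD ihE =>
    have e : Ψ ⟨D + E, add_mem hD hE⟩ = Ψ ⟨D, hD⟩ + Ψ ⟨E, hE⟩ :=
      map_add Ψ ⟨D, hD⟩ ⟨E, hE⟩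
    rw [e, ihD, ihE]
    exact key _ _ _ ((hs ⟨D, hD⟩).add (hs ⟨E, hE⟩))
  | mul D E hD hE ihD ihE =>
    have e : Ψ ⟨D * E, mul_mem hD hE⟩ = Ψ ⟨D, hD⟩ * Ψ ⟨E, hE⟩ :=
      map_mul Ψ ⟨D, hD⟩ ⟨E, hE⟩
    rw [e, ihD, ihE]
    exact key _ _ _ ((hs ⟨D, hD⟩).mul (hs ⟨E, hE⟩))

/-- The homomorphism determined by `∂_{ε_i} ↦ k ^ p(i) ε_i^*` and `x_i / (x_i - x_j) ↦ 1` for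
`i < j`, on the algebra generated by these operators. -/
def harishChandraAmbient (n m : ℕ) (k : ℂ) : operatorAlgebra n m k →ₐ[ℂ] SVdual n m :=
  (existsUnique_harishChandra n m k).choose

/-- The Harish-Chandra homomorphism `φ_{n,m} : 𝒟_{n,m} → S(V*)`. -/
def harishChandra (n m : ℕ) (k : ℂ) : integralAlgebra n m k →ₐ[ℂ] SVdual n m :=
  (harishChandraAmbient n m k).comp (Subalgebra.inclusion (integralAlgebra_le n m k))

end DeformedCMS

end

/-!
The proof rests on a description of the operators by their leading symbols: `φ D = P` says that `D`
multiplies the leading monomial `x ^ χ` of a function by `P χ` (`hasSymbol_harishChandra`). On the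
symbol side the quantum Moser matrix becomes upper triangular (`symbolMatrix`), and the range of
`φ` is the algebra generated by the `cmsSymbol n m k r = φ (ℒ_r)` (`range_harishChandra`).

*The range is contained in `Λ*`* (`cmsSymbol_mem`). The generating function of the `φ (ℒ_r)` is a
product of linear fractions, one for each index (`moments_generating_function`). An even reflection
permutes the factors; on the hyperplanes `l_α^± = 0` an odd reflection leaves the product of two
factors unchanged, and `l_α^+`, `l_α^-` are coprime because `1 + k ≠ 0`.

*The range is all of `Λ*`* (`shiftedQuasiInvariants_le_adjoin`). The leading homogeneous term of an
element of `Λ*` is a deformed quasi-invariant: it is symmetric in each of the two groups of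
variables, and its derivatives in the directions of `a_i` and `b_j` are proportional where
`a_i = b_j` (`toBlocks_top_mem`). For `k` not rational, the deformed quasi-invariants are exactly
the polynomials in the deformed power sums (`powerSpan_eq`), which are the leading terms of the
polynomials in the `φ (ℒ_r)`; so induction on the degree applies. The equality `powerSpan_eq` is
proved by comparing dimensions: restriction to `a_n = 0` bounds the dimension of the
quasi-invariants by a number of partitions, and for many variables the power sums are independent
in a given degree, so that the bound is attained, and then it is attained in every smaller number
of variables too.

*Injectivity.* On polynomials in the deformed power sums the integrals are induced by operators on
abstract power sums that depend on `n` and `m` only through the scalar `q = n + m / k`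
(`cmsIntegral_powerEval`), and changing `q` does not change their joint eigenvectors
(`exists_eigenvalue_of_shift`). These operators are self-adjoint for a nondegenerate bilinear form
(`powerForm_universalIntegral`). For `m = 0` and `n` large they are triangular with respect to the
leading exponent, with eigenvalues the `φ (ℒ_r)`, which separate the exponents because
`Λ*_{n,0}` does (`eq_of_eval_cmsSymbol_eq`). A generic linear combination therefore has simple
spectrum, and by self-adjointness its eigenvectors are joint eigenvectors
(`IsLeadingEigenvector.of_selfAdjoint`, `exists_joint_eigenvectors`). Hence an operator of
`𝒟_{n,m}` with symbol zero annihilates all polynomials in the deformed power sums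
(`apply_powerEval_eq_zero`), and a differential operator that does so is zero (`IsDiffOp.eq_zero`),
because no nonzero derivation does (`derivation_eq_zero`).
-/

noncomputable section

namespace DeformedCMS

open MvPolynomial

/-! ### Power sums in infinitely many variables -/

/-- The weight of the variable `X t` of `MvPolynomial ℕ ℂ`, which stands for the power sum of
degree `t + 1`. -/
def powerWeight (t : ℕ) : ℕ := t + 1

/-- The polynomials of weight `d` in abstract power sums. -/
abbrev PowerPart (d : ℕ) : Submodule ℂ (MvPolynomial ℕ ℂ) :=
  weightedHomogeneousSubmodule ℂ powerWeight d

/-- The specialization of the abstract power sum `X t` at the deformed power sum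
`∑ i, κ i * x_i ^ (t + 1)`. -/
def powerSumMap {σ : Type*} [Fintype σ] (κ : σ → ℂ) :
    MvPolynomial ℕ ℂ →ₐ[ℂ] MvPolynomial σ ℂ :=
  aeval fun t => ∑ i, C (κ i) * X i ^ (t + 1)

theorem powerSumMap_X {σ : Type*} [Fintype σ] (κ : σ → ℂ) (t : ℕ) :
    powerSumMap κ (X t) = ∑ i, C (κ i) * X i ^ (t + 1) := aeval_X _ _

theorem le_weight_powerWeight (s : ℕ →₀ ℕ) {t : ℕ} (h : s t ≠ 0) :
    t + 1 ≤ Finsupp.weight powerWeight s :=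
  Finsupp.le_weight_of_ne_zero' powerWeight h

theorem pderiv_eq_zero_of_powerPart {d t : ℕ} {F : MvPolynomial ℕ ℂ} (hF : F ∈ PowerPart d)
    (h : d ≤ t) : pderiv t F = 0 := by
  refine pderiv_eq_zero_of_notMem_vars fun ht => ?_
  obtain ⟨s, hs, hst⟩ := (mem_vars_iff_mem_support t).1 ht
  have h1 := le_weight_powerWeight s (Finsupp.mem_support_iff.1 hst)
  rw [hF (mem_support_iff.1 hs)] at h1
  omega

theorem pderiv_mem_powerPart {d t e : ℕ} {F : MvPolynomial ℕ ℂ} (hF : F ∈ PowerPart d)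
    (h : e + (t + 1) = d) : pderiv t F ∈ PowerPart e :=
  IsWeightedHomogeneous.pderiv hF h

theorem pderiv_powerSum {σ : Type*} [Fintype σ] (κ : σ → ℂ) (i : σ) (t : ℕ) :
    pderiv i (∑ j, C (κ j) * X j ^ (t + 1) : MvPolynomial σ ℂ) =
      C (κ i * (t + 1)) * X i ^ t := by
  classical
  rw [map_sum, Finset.sum_eq_single i]
  · rw [pderiv_C_mul, pderiv_pow, pderiv_X_self]
    simp
    ring
  · intro j _ hj
    rw [pderiv_C_mul, pderiv_pow, pderiv_X_of_ne hj]
    simp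
  · simp

/-- The sum in the chain rule is finite because `F` involves finitely many power sums. -/
theorem exists_pderiv_powerSumMap {σ : Type*} [Fintype σ] (κ : σ → ℂ) (i : σ)
    (F : MvPolynomial ℕ ℂ) : ∃ K₀, ∀ K, K₀ ≤ K →
      pderiv i (powerSumMap κ F) =
        ∑ t ∈ Finset.range K, powerSumMap κ (pderiv t F) * (C (κ i * (t + 1)) * X i ^ t) := by
  induction F using MvPolynomial.induction_on with
  | C a => exact ⟨0, fun K _ => by simp [powerSumMap, MvPolynomial.algebraMap_eq]⟩
  | add p q hp hq =>
    obtain ⟨a, ha⟩ := hp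
    obtain ⟨b, hb⟩ := hq
    refine ⟨max a b, fun K hK => ?_⟩
    simp only [map_add, add_mul, Finset.sum_add_distrib]
    rw [ha K (by omega), hb K (by omega)]
  | mul_X p j hp =>
    obtain ⟨a, ha⟩ := hp
    refine ⟨max a (j + 1), fun K hK => ?_⟩
    have h1 : ∀ t, powerSumMap κ (pderiv t (p * X j)) * (C (κ i * (t + 1)) * X i ^ t) =
        powerSumMap κ (pderiv t p) * (C (κ i * (t + 1)) * X i ^ t) * powerSumMap κ (X j) +
          if t = j then powerSumMap κ p * (C (κ i * (t + 1)) * X i ^ t) else 0 := by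
      intro t
      rw [pderiv_mul, pderiv_X, Pi.single_apply, map_add, map_mul, map_mul]
      split_ifs with h2 h3 h3
      · rw [map_one]
        ring
      · exact absurd h2.symm h3
      · exact absurd h3.symm h2
      · rw [map_zero]
        ring
    rw [map_mul, pderiv_mul, ha K (by omega), Finset.sum_congr rfl fun t _ => h1 t,
      Finset.sum_add_distrib, Finset.sum_mul, Finset.sum_ite_eq', if_pos (by simp; omega),
      powerSumMap_X, pderiv_powerSum]

/-- The chain rule for a polynomial in the power sums. -/
theorem pderiv_powerSumMap {σ : Type*} [Fintype σ] (κ : σ → ℂ) (i : σ) {d K : ℕ}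
    {F : MvPolynomial ℕ ℂ} (hF : F ∈ PowerPart d) (hK : d ≤ K) :
    pderiv i (powerSumMap κ F) =
      ∑ t ∈ Finset.range K, powerSumMap κ (pderiv t F) * (C (κ i * (t + 1)) * X i ^ t) := by
  obtain ⟨K₀, h⟩ := exists_pderiv_powerSumMap κ i F
  rw [h (max K₀ K) (le_max_left _ _)]
  refine (Finset.sum_subset (Finset.range_mono (le_max_right _ _)) fun t _ ht => ?_).symm
  rw [pderiv_eq_zero_of_powerPart hF (by simpa using hK.trans (by simpa using ht)), map_zero,
    zero_mul]

/-- A polynomial of degree less than `N` with `N` distinct roots has zero coefficients. -/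
theorem eq_zero_of_sum_pow_eq_zero {K σ : Type*} [CommRing K] [IsDomain K] [Fintype σ]
    {N : ℕ} (hN : N ≤ Fintype.card σ) (z : σ → K) (hz : Function.Injective z) (y : ℕ → K)
    (h : ∀ i, ∑ t ∈ Finset.range N, y t * z i ^ t = 0) : ∀ t < N, y t = 0 := by
  obtain ⟨e⟩ : Nonempty (Fin N ↪ σ) :=
    Function.Embedding.nonempty_of_card_le (by simpa using hN)
  have := Matrix.eq_zero_of_forall_index_sum_mul_pow_eq_zero (f := fun a => z (e a))
    (v := fun t : Fin N => y t) (fun a b hab => e.injective (hz hab)) (fun j => by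
      rw [← h (e j), Finset.sum_range])
  intro t ht
  exact congrFun this ⟨t, ht⟩

/-- The deformed power sums satisfy no relation whose weight is at most the number of variables:
by the chain rule and Vandermonde's determinant the partial derivatives of a relation are relations
of smaller weight. -/
theorem eq_zero_of_powerSumMap_eq_zero {σ : Type*} [Fintype σ] (κ : σ → ℂ) (hκ : ∀ i, κ i ≠ 0)
    {d : ℕ} (hd : d ≤ Fintype.card σ) {F : MvPolynomial ℕ ℂ} (hF : F ∈ PowerPart d)
    (h : powerSumMap κ F = 0) : F = 0 := by
  induction d using Nat.strong_induction_on generalizing F with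
  | _ d ih =>
    have hp : ∀ t < d, pderiv t F = 0 := by
      have h1 := eq_zero_of_sum_pow_eq_zero hd (fun i : σ => (X i : MvPolynomial σ ℂ))
        MvPolynomial.X_injective (fun t => C ((t : ℂ) + 1) * powerSumMap κ (pderiv t F))
        (fun i => by
          have h2 := pderiv_powerSumMap κ i hF le_rfl
          rw [h, map_zero] at h2
          have h3 : (C (κ i) : MvPolynomial σ ℂ) ≠ 0 := by simpa using hκ i
          refine (mul_eq_zero.1 ?_).resolve_left h3
          rw [h2, Finset.mul_sum]
          refine Finset.sum_congr rfl fun t _ => ?_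
          rw [C_mul]
          ring)
      intro t ht
      refine ih (d - (t + 1)) (by omega) (by omega) (pderiv_mem_powerPart hF (by omega)) ?_
      refine (mul_eq_zero.1 (h1 t ht)).resolve_left ?_
      have : (t : ℂ) + 1 ≠ 0 := by exact_mod_cast t.succ_ne_zero
      exact fun e => this (C_eq_zero.1 e)
    ext s
    rw [coeff_zero]
    by_contra hs
    rcases eq_or_ne s 0 with rfl | h0
    · -- only the constant term is left, and the specialization does not change it
      have hC : F = C (coeff 0 F) := by
        ext a
        rw [coeff_C]
        split_ifs with ha
        · rw [ha]
        · by_contra hne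
          obtain ⟨t, ht⟩ := Finsupp.ne_iff.1 (Ne.symm ha)
          have h1 := le_weight_powerWeight a ht
          rw [hF hne] at h1
          have h2 := hF hs
          rw [map_zero] at h2
          omega
      rw [hC, powerSumMap, aeval_C, MvPolynomial.algebraMap_eq, C_eq_zero] at h
      exact hs h
    · obtain ⟨t, ht⟩ := Finsupp.ne_iff.1 h0
      have h1 := le_weight_powerWeight s ht
      rw [hF hs] at h1
      have h2 := congrArg (coeff (s - Finsupp.single t 1)) (hp t (by omega))
      have h4 : Finsupp.single t 1 ≤ s := by
        rw [Finsupp.single_le_iff]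
        exact Nat.one_le_iff_ne_zero.2 ht
      rw [coeff_pderiv, coeff_zero, tsub_add_cancel_of_le h4] at h2
      refine hs ((mul_eq_zero.1 h2).resolve_right ?_)
      exact Nat.cast_add_one_ne_zero _

theorem finite_weight_eq (d : ℕ) : {s : ℕ →₀ ℕ | Finsupp.weight powerWeight s = d}.Finite := by
  refine (Finset.finite_toSet ((Finset.range d).finsupp fun _ => Finset.range (d + 1))).subset
    fun s hs => ?_
  rw [Set.mem_ofPred_eq] at hs
  rw [Finset.mem_coe, Finset.mem_finsupp_iff]
  refine ⟨fun t ht => ?_, fun t _ => ?_⟩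
  · have := le_weight_powerWeight s (Finsupp.mem_support_iff.1 ht)
    simp
    omega
  · have := Finsupp.le_weight powerWeight (Nat.succ_ne_zero t) s
    simp
    omega

/-- The number of partitions of `d`, a partition having `s t` parts equal to `t + 1`. -/
def numPartitions (d : ℕ) : ℕ := {s : ℕ →₀ ℕ | Finsupp.weight powerWeight s = d}.ncard

/-- The monomials of weight `d` form a basis. -/
def powerPartBasis (d : ℕ) :
    Module.Basis {s : ℕ →₀ ℕ | Finsupp.weight powerWeight s = d} ℂ (PowerPart d) :=
  (basisRestrictSupport ℂ {s : ℕ →₀ ℕ | Finsupp.weight powerWeight s = d}).map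
    (LinearEquiv.ofEq _ _ (weightedHomogeneousSubmodule_eq_finsupp_supported ℂ powerWeight d).symm)

instance (d : ℕ) : FiniteDimensional ℂ (PowerPart d) :=
  have := (finite_weight_eq d).to_subtype
  Module.Finite.of_basis (powerPartBasis d)

theorem finrank_powerPart (d : ℕ) : Module.finrank ℂ (PowerPart d) = numPartitions d := by
  have := (finite_weight_eq d).fintype
  rw [Module.finrank_eq_card_basis (powerPartBasis d), numPartitions, Set.ncard_eq_toFinset_card',
    Set.toFinset_card]

/-! ### Counting partitions by the number of large parts -/

/-- The number of parts larger than `m`. -/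
def bigParts (m : ℕ) : (ℕ →₀ ℕ) →+ ℕ := Finsupp.weight fun t => if m ≤ t then 1 else 0

/-- The partitions of `d` with exactly `n` parts larger than `m`. -/
def hookPartitions (m n d : ℕ) : Set (ℕ →₀ ℕ) :=
  {s | Finsupp.weight powerWeight s = d ∧ bigParts m s = n}

/-- The number of partitions of `d` with exactly `n` parts larger than `m`. -/
def numHook (m n d : ℕ) : ℕ := (hookPartitions m n d).ncard

theorem finite_hookPartitions (m n d : ℕ) : (hookPartitions m n d).Finite :=
  (finite_weight_eq d).subset fun _ h => h.1

/-- The map that enlarges each part larger than `m` by one. -/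
def enlarge (m : ℕ) (s : ℕ →₀ ℕ) : ℕ →₀ ℕ :=
  s.mapDomain fun t => if m ≤ t then t + 1 else t

theorem enlarge_injective (m : ℕ) : Function.Injective (enlarge m) :=
  Finsupp.mapDomain_injective fun a b h => by
    split_ifs at h <;> omega

theorem weight_enlarge (m : ℕ) (s : ℕ →₀ ℕ) :
    Finsupp.weight powerWeight (enlarge m s) = Finsupp.weight powerWeight s + bigParts m s := by
  induction s using Finsupp.induction_linear with
  | zero => simp [enlarge]
  | add f g hf hg =>
    rw [enlarge, Finsupp.mapDomain_add, map_add, map_add, map_add]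
    rw [enlarge] at hf hg
    omega
  | single t a =>
    simp only [enlarge, Finsupp.mapDomain_single, bigParts, Finsupp.weight_single, powerWeight,
      smul_eq_mul]
    split_ifs <;> ring

theorem bigParts_enlarge (m : ℕ) (s : ℕ →₀ ℕ) : bigParts m (enlarge m s) = bigParts m s := by
  induction s using Finsupp.induction_linear with
  | zero => simp [enlarge]
  | add f g hf hg =>
    rw [enlarge, Finsupp.mapDomain_add, map_add, map_add]
    rw [enlarge] at hf hg
    omega
  | single t a =>
    simp only [enlarge, Finsupp.mapDomain_single, bigParts, Finsupp.weight_single]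
    by_cases h : m ≤ t
    · rw [if_pos h, if_pos h, if_pos (by omega)]
    · rw [if_neg h, if_neg h]

theorem enlarge_apply_self (m : ℕ) (s : ℕ →₀ ℕ) : enlarge m s m = 0 := by
  refine Finsupp.mapDomain_of_notMem_range _ _ ?_
  rintro ⟨t, ht⟩
  dsimp only at ht
  split_ifs at ht <;> omega

theorem enlarge_mem {m n e : ℕ} {s : ℕ →₀ ℕ} (h : s ∈ hookPartitions m n e) :
    enlarge m s ∈ hookPartitions m n (e + n) :=
  ⟨by rw [weight_enlarge, h.1, h.2], by rw [bigParts_enlarge, h.2]⟩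

theorem numHook_le_add (m n e : ℕ) : numHook m n e ≤ numHook m n (e + n) := by
  rw [numHook, ← Set.ncard_image_of_injective _ (enlarge_injective m)]
  exact Set.ncard_le_ncard (Set.image_subset_iff.2 fun s hs => enlarge_mem hs)
    (finite_hookPartitions _ _ _)

/-- Two sets with disjoint injective images in `S` have at most `|S|` elements together. -/
theorem ncard_add_le {α : Type*} {A B S : Set α} (f g : α → α) (hf : Function.Injective f)
    (hg : Function.Injective g) (hA : ∀ a ∈ A, f a ∈ S) (hB : ∀ b ∈ B, g b ∈ S)
    (hd : ∀ a ∈ A, ∀ b ∈ B, f a ≠ g b) (hS : S.Finite) : A.ncard + B.ncard ≤ S.ncard := by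
  have h1 : f '' A ⊆ S := Set.image_subset_iff.2 hA
  have h2 : g '' B ⊆ S := Set.image_subset_iff.2 hB
  rw [← Set.ncard_image_of_injective A hf, ← Set.ncard_image_of_injective B hg,
    ← Set.ncard_union_eq ?_ (hS.subset h1) (hS.subset h2)]
  · exact Set.ncard_le_ncard (Set.union_subset h1 h2) hS
  · rw [Set.disjoint_left]
    rintro _ ⟨a, ha, rfl⟩ ⟨b, hb, e⟩
    exact hd a ha b hb e.symm

/-- Partitions with `n + 1` parts larger than `m` either have no part equal to `m + 1`, or arise by
adding such a part. -/
theorem numHook_add_le (m n e f : ℕ) (h : f + (m + 1) = e + (n + 1)) :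
    numHook m (n + 1) e + numHook m n f ≤ numHook m (n + 1) (e + (n + 1)) := by
  refine ncard_add_le (enlarge m) (fun s => s + Finsupp.single m 1) (enlarge_injective m)
    (add_left_injective _) (fun s hs => enlarge_mem hs) (fun s hs => ⟨?_, ?_⟩)
    (fun a _ b _ e => ?_) (finite_hookPartitions _ _ _)
  · rw [map_add, hs.1, Finsupp.weight_single, powerWeight, ← h]
    simp
  · rw [map_add, hs.2, bigParts, Finsupp.weight_single]
    simp
  · have := DFunLike.congr_fun e m
    rw [enlarge_apply_self] at this
    simp at this

theorem bigParts_eq_zero_iff (m : ℕ) (s : ℕ →₀ ℕ) :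
    bigParts m s = 0 ↔ ∀ t, m ≤ t → s t = 0 := by
  rw [bigParts, Finsupp.weight_apply, Finsupp.sum, Finset.sum_eq_zero_iff]
  constructor
  · intro h t ht
    by_contra hne
    have := h t (Finsupp.mem_support_iff.2 hne)
    simp [ht] at this
    exact hne this
  · intro h t _
    by_cases ht : m ≤ t
    · simp [h t ht]
    · simp [ht]

theorem numHook_zero_le (m e : ℕ) : numHook m 0 e ≤ numHook (m + 1) 0 e :=
  Set.ncard_le_ncard (fun s hs => ⟨hs.1, (bigParts_eq_zero_iff _ _).2 fun t ht =>
    (bigParts_eq_zero_iff _ _).1 hs.2 t (by omega)⟩) (finite_hookPartitions _ _ _)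

/-- Partitions with parts at most `m + 1` either have no part equal to `m + 1`, or arise by adding
such a part. -/
theorem numHook_zero_add_le (m e f : ℕ) (h : f + (m + 1) = e) :
    numHook m 0 e + numHook (m + 1) 0 f ≤ numHook (m + 1) 0 e := by
  refine ncard_add_le id (fun s => s + Finsupp.single m 1) Function.injective_id
    (add_left_injective _) (fun s hs => ⟨hs.1, (bigParts_eq_zero_iff _ _).2 fun t ht =>
    (bigParts_eq_zero_iff _ _).1 hs.2 t (by omega)⟩) (fun s hs => ⟨?_, ?_⟩)
    (fun a ha b _ e => ?_) (finite_hookPartitions _ _ _)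
  · rw [map_add, hs.1, Finsupp.weight_single, powerWeight, ← h]
    simp
  · rw [map_add, hs.2, bigParts, Finsupp.weight_single]
    simp
  · have := DFunLike.congr_fun e m
    simp [(bigParts_eq_zero_iff _ _).1 ha.2 m le_rfl] at this

theorem sum_numHook_le (m N d : ℕ) :
    ∑ i ∈ Finset.range N, numHook m i d ≤ numPartitions d := by
  have := (finite_weight_eq d)
  calc ∑ i ∈ Finset.range N, numHook m i d
      = (⋃ i ∈ Finset.range N, hookPartitions m i d).ncard := by
        have h := Set.Finite.ncard_biUnion (Finset.range N).finite_toSet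
          (s := fun i => hookPartitions m i d) (fun i _ => finite_hookPartitions m i d)
          (fun i _ j _ hij => Set.disjoint_left.2 fun s hi hj => hij (hi.2.symm.trans hj.2))
        rw [finsum_mem_coe_finset] at h
        exact h.symm
    _ ≤ numPartitions d := Set.ncard_le_ncard (Set.iUnion₂_subset fun i _ s hs => hs.1) this

/-! ### Deformed quasi-invariants -/

/-- Substitution of `x_j` for `x_i`. -/
def identify {σ : Type*} [DecidableEq σ] (i j : σ) : MvPolynomial σ ℂ →ₐ[ℂ] MvPolynomial σ ℂ :=
  aeval fun l => if l = i then X j else X l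

/-- Substitution of `0` for `x_i`. -/
def killVar {σ : Type*} [DecidableEq σ] (i : σ) : MvPolynomial σ ℂ →ₐ[ℂ] MvPolynomial σ ℂ :=
  aeval fun l => if l = i then 0 else X l

/-- A polynomial is congruent to its image under a substitution modulo any ideal that contains the
differences of the variables and their images. -/
theorem sub_aeval_mem {σ : Type*} (I : Ideal (MvPolynomial σ ℂ)) (g : σ → MvPolynomial σ ℂ)
    (h : ∀ i, X i - g i ∈ I) (f : MvPolynomial σ ℂ) : f - aeval g f ∈ I := by
  have e : (Ideal.Quotient.mkₐ ℂ I).comp (aeval g) = Ideal.Quotient.mkₐ ℂ I := by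
    refine MvPolynomial.algHom_ext fun i => ?_
    rw [AlgHom.comp_apply, aeval_X]
    exact (Ideal.Quotient.eq.2 (h i)).symm
  exact Ideal.Quotient.eq.1 (AlgHom.congr_fun e f).symm

theorem X_dvd_of_killVar_eq_zero {σ : Type*} [DecidableEq σ] {i : σ} {f : MvPolynomial σ ℂ}
    (h : killVar i f = 0) : X i ∣ f := by
  have := sub_aeval_mem (Ideal.span {X i}) (fun l => if l = i then 0 else X l) (fun l => by
    split_ifs with hl
    · rw [hl, sub_zero]
      exact Ideal.mem_span_singleton_self _
    · rw [sub_self]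
      exact zero_mem _) f
  rw [show aeval _ f = (0 : MvPolynomial σ ℂ) from h, sub_zero] at this
  exact Ideal.mem_span_singleton.1 this

theorem prod_X_dvd {σ ι : Type*} [Fintype ι] (u : ι → σ) (hu : Function.Injective u)
    {f : MvPolynomial σ ℂ} (h : ∀ i, X (u i) ∣ f) : ∏ i, X (u i) ∣ f := by
  refine Finset.prod_dvd_of_isRelPrime (fun i _ j _ hij => ?_) fun i _ => h i
  refine (X_prime.irreducible.isRelPrime_iff_not_dvd).2 fun hd => ?_
  exact hij (hu (by simpa using hd))

theorem prod_X_eq_monomial {σ ι : Type*} [Fintype ι] (u : ι → σ) :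
    ∏ i, X (u i) = (monomial (∑ i, Finsupp.single (u i) 1) 1 : MvPolynomial σ ℂ) := by
  rw [monomial_sum_one]
  rfl

theorem prod_X_ne_zero {σ ι : Type*} [Fintype ι] (u : ι → σ) :
    (∏ i, X (u i) : MvPolynomial σ ℂ) ≠ 0 :=
  Finset.prod_ne_zero_iff.2 fun _ _ => X_ne_zero _

theorem isHomogeneous_of_prod_X_mul {σ ι : Type*} [Fintype ι] (u : ι → σ) {d e : ℕ}
    {g : MvPolynomial σ ℂ} (h : ((∏ i, X (u i)) * g).IsHomogeneous d)
    (hd : e + Fintype.card ι = d) : g.IsHomogeneous e := by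
  intro s hs
  rw [prod_X_eq_monomial] at h
  have := h (d := ∑ i, Finsupp.single (u i) 1 + s) (by
    rw [coeff_monomial_mul, one_mul]
    exact hs)
  rw [map_add, map_sum] at this
  simp [Finsupp.weight_single] at this
  omega

theorem card_le_of_prod_X_mul {σ ι : Type*} [Fintype ι] (u : ι → σ) {d : ℕ}
    {g : MvPolynomial σ ℂ} (h : ((∏ i, X (u i)) * g).IsHomogeneous d) (hg : g ≠ 0) :
    Fintype.card ι ≤ d := by
  obtain ⟨s, hs⟩ := MvPolynomial.ne_zero_iff.1 hg
  rw [prod_X_eq_monomial] at h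
  have := h (d := ∑ i, Finsupp.single (u i) 1 + s) (by
    rw [coeff_monomial_mul, one_mul]
    exact hs)
  rw [map_add, map_sum] at this
  simp [Finsupp.weight_single] at this
  omega

open Sum in
/-- The polynomials in `a_1, …, a_n` and `b_1, …, b_m` that are symmetric in the `a_i`, symmetric in
the `b_j`, and satisfy `a_i (∂ / ∂ a_i - k ∂ / ∂ b_j) f + c f = 0` on each hyperplane `a_i = b_j`.
For `c = 0` these are the deformed quasi-invariants; other values of `c` arise when products of
variables are split off. -/
structure IsTwisted (k c : ℂ) {n m : ℕ} (f : MvPolynomial (Fin n ⊕ Fin m) ℂ) : Prop where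
  symm_inl : ∀ i j : Fin n, rename (Equiv.swap (inl i) (inl j) : Fin n ⊕ Fin m → _) f = f
  symm_inr : ∀ i j : Fin m, rename (Equiv.swap (inr i) (inr j) : Fin n ⊕ Fin m → _) f = f
  cond : ∀ (i : Fin n) (j : Fin m), identify (inl i) (inr j)
    (X (inl i) * (pderiv (inl i) f - C k * pderiv (inr j) f) + C c * f) = 0

/-- The twisted quasi-invariants that are homogeneous of degree `d`. -/
def twisted (k c : ℂ) (n m d : ℕ) : Submodule ℂ (MvPolynomial (Fin n ⊕ Fin m) ℂ) where
  carrier := {f | f.IsHomogeneous d ∧ IsTwisted k c f}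
  add_mem' := by
    rintro f g ⟨hf, hf'⟩ ⟨hg, hg'⟩
    refine ⟨hf.add hg, ⟨fun i j => ?_, fun i j => ?_, fun i j => ?_⟩⟩
    · rw [map_add, hf'.symm_inl, hg'.symm_inl]
    · rw [map_add, hf'.symm_inr, hg'.symm_inr]
    · have h := congrArg₂ (· + ·) (hf'.cond i j) (hg'.cond i j)
      simp only [← map_add, add_zero] at h
      rw [← h]
      congr 1
      simp only [map_add]
      ring
  zero_mem' := ⟨isHomogeneous_zero _ _ _, ⟨by simp, by simp, by simp⟩⟩
  smul_mem' := by
    rintro a f ⟨hf, hf'⟩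
    refine ⟨?_, ⟨fun i j => ?_, fun i j => ?_, fun i j => ?_⟩⟩
    · exact Submodule.smul_mem (homogeneousSubmodule _ ℂ d) a hf
    · rw [map_smul, hf'.symm_inl]
    · rw [map_smul, hf'.symm_inr]
    · have h := congrArg (a • ·) (hf'.cond i j)
      simp only [← map_smul, smul_zero] at h
      rw [← h]
      congr 1
      simp only [smul_eq_C_mul, pderiv_C_mul]
      ring

instance (k c : ℂ) (n m d : ℕ) : FiniteDimensional ℂ (twisted k c n m d) := by
  have : FiniteDimensional ℂ (homogeneousSubmodule (Fin n ⊕ Fin m) ℂ d) :=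
    Module.Finite.iff_fg.2 (homogeneousSubmodule_fg _ _ d)
  exact Submodule.finiteDimensional_of_le (S₂ := homogeneousSubmodule (Fin n ⊕ Fin m) ℂ d)
    fun f hf => hf.1

open Sum in
/-- Division by an invariant polynomial `P` that is a solution of the equations with constant `-e`
changes the constant by `e`. -/
theorem IsTwisted.of_mul {k c e : ℂ} {n m : ℕ} {P g : MvPolynomial (Fin n ⊕ Fin m) ℂ}
    (h : IsTwisted k c (P * g)) (hP : P ≠ 0)
    (hP1 : ∀ i j : Fin n, rename (Equiv.swap (inl i) (inl j) : Fin n ⊕ Fin m → _) P = P)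
    (hP2 : ∀ i j : Fin m, rename (Equiv.swap (inr i) (inr j) : Fin n ⊕ Fin m → _) P = P)
    (hP3 : ∀ (i : Fin n) (j : Fin m), identify (inl i) (inr j)
      (X (inl i) * (pderiv (inl i) P - C k * pderiv (inr j) P)) =
        C e * identify (inl i) (inr j) P)
    (hP4 : ∀ (i : Fin n) (j : Fin m), identify (inl i) (inr j) P ≠ 0) :
    IsTwisted k (c + e) g := by
  refine ⟨fun i j => ?_, fun i j => ?_, fun i j => ?_⟩
  · have := h.symm_inl i j
    rw [map_mul, hP1] at this
    exact mul_left_cancel₀ hP this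
  · have := h.symm_inr i j
    rw [map_mul, hP2] at this
    exact mul_left_cancel₀ hP this
  · refine mul_left_cancel₀ (hP4 i j) ?_
    rw [mul_zero, ← h.cond i j, pderiv_mul, pderiv_mul]
    have h3 := hP3 i j
    simp only [map_add, map_mul, map_sub] at h3 ⊢
    have hC : ∀ a : ℂ, identify (inl i : Fin n ⊕ Fin m) (inr j) (C a) = C a := fun a =>
      (identify _ _).commutes a
    simp only [hC] at h3 ⊢
    linear_combination (-(identify (inl i) (inr j) g)) * h3

theorem X_mul_pderiv_prod {σ ι : Type*} [Fintype ι] (u : ι → σ) (hu : Function.Injective u)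
    (i : ι) : X (u i) * pderiv (u i) (∏ l, X (u l) : MvPolynomial σ ℂ) = ∏ l, X (u l) := by
  classical
  rw [prod_X_eq_monomial, X_mul_pderiv_monomial]
  have : (∑ l, Finsupp.single (u l) 1 : σ →₀ ℕ) (u i) = 1 := by
    rw [Finsupp.finsetSum_apply, Finset.sum_eq_single i]
    · simp
    · intro l _ hl
      rw [Finsupp.single_apply, if_neg (fun e => hl (hu e))]
    · simp
  rw [this, one_smul]

theorem pderiv_prod_X_of_ne {σ ι : Type*} [Fintype ι] (u : ι → σ) {x : σ} (hx : ∀ i, u i ≠ x) :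
    pderiv x (∏ l, X (u l) : MvPolynomial σ ℂ) = 0 := by
  classical
  have : (∑ l, Finsupp.single (u l) 1 : σ →₀ ℕ) x = 0 := by
    rw [Finsupp.finsetSum_apply]
    exact Finset.sum_eq_zero fun l _ => by rw [Finsupp.single_apply, if_neg (hx l)]
  rw [prod_X_eq_monomial, pderiv_monomial, this, Nat.cast_zero, mul_zero, map_zero]

section

open Sum

/-! ### Restriction to fewer variables -/

/-- The restriction of polynomials to the hyperplane where the last `a`-variable vanishes. -/
def restrictLast (n m : ℕ) :
    MvPolynomial (Fin (n + 1) ⊕ Fin m) ℂ →ₐ[ℂ] MvPolynomial (Fin n ⊕ Fin m) ℂ :=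
  aeval (Sum.elim (Fin.lastCases 0 fun i => X (inl i)) fun j => X (inr j))

@[simp] theorem restrictLast_last (n m : ℕ) :
    restrictLast n m (X (inl (Fin.last n))) = 0 := by
  simp [restrictLast]

@[simp] theorem restrictLast_inl (n m : ℕ) (i : Fin n) :
    restrictLast n m (X (inl i.castSucc)) = X (inl i) := by
  simp [restrictLast]

@[simp] theorem restrictLast_inr (n m : ℕ) (j : Fin m) :
    restrictLast n m (X (inr j)) = X (inr j) := by
  simp [restrictLast]

@[simp] theorem restrictLast_C (n m : ℕ) (a : ℂ) : restrictLast n m (C a) = C a :=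
  (restrictLast n m).commutes a

/-- Two algebra homomorphisms from the polynomials in the `a` and `b` agree if they agree on the
last `a`-variable, the other `a`-variables, and the `b`-variables. -/
theorem algHom_ext_last {n m : ℕ} {A : Type*} [CommSemiring A] [Algebra ℂ A]
    {φ ψ : MvPolynomial (Fin (n + 1) ⊕ Fin m) ℂ →ₐ[ℂ] A}
    (h0 : φ (X (inl (Fin.last n))) = ψ (X (inl (Fin.last n))))
    (h1 : ∀ i : Fin n, φ (X (inl i.castSucc)) = ψ (X (inl i.castSucc)))
    (h2 : ∀ j, φ (X (inr j)) = ψ (X (inr j))) : φ = ψ := by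
  refine MvPolynomial.algHom_ext fun l => ?_
  rcases l with l | l
  · induction l using Fin.lastCases with
    | last => exact h0
    | cast i => exact h1 i
  · exact h2 l

theorem restrictLast_pderiv_inl (n m : ℕ) (i : Fin n)
    (f : MvPolynomial (Fin (n + 1) ⊕ Fin m) ℂ) :
    restrictLast n m (pderiv (inl i.castSucc) f) = pderiv (inl i) (restrictLast n m f) := by
  classical
  induction f using MvPolynomial.induction_on with
  | C a => simp
  | add p q hp hq => simp only [map_add, hp, hq]
  | mul_X p l hp =>
    rw [pderiv_mul, map_add, map_mul, map_mul, map_mul, pderiv_mul, hp]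
    congr 2
    rcases l with l | l
    · induction l using Fin.lastCases with
      | last => simp [pderiv_X, Pi.single_apply, Fin.ext_iff]; omega
      | cast j => simp [pderiv_X, Pi.single_apply, apply_ite]
    · simp [pderiv_X]

theorem restrictLast_pderiv_inr (n m : ℕ) (i : Fin m)
    (f : MvPolynomial (Fin (n + 1) ⊕ Fin m) ℂ) :
    restrictLast n m (pderiv (inr i) f) = pderiv (inr i) (restrictLast n m f) := by
  classical
  induction f using MvPolynomial.induction_on with
  | C a => simp
  | add p q hp hq => simp only [map_add, hp, hq]
  | mul_X p l hp =>
    rw [pderiv_mul, map_add, map_mul, map_mul, map_mul, pderiv_mul, hp]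
    congr 2
    rcases l with l | l
    · induction l using Fin.lastCases with
      | last => simp [pderiv_X]
      | cast j => simp [pderiv_X]
    · simp [pderiv_X, Pi.single_apply, apply_ite]

theorem restrictLast_swap_inl (n m : ℕ) (i j : Fin n)
    (f : MvPolynomial (Fin (n + 1) ⊕ Fin m) ℂ) :
    restrictLast n m (rename (Equiv.swap (inl i.castSucc) (inl j.castSucc)) f) =
      rename (Equiv.swap (inl i) (inl j)) (restrictLast n m f) := by
  have e : (restrictLast n m).comp (rename (Equiv.swap (inl i.castSucc) (inl j.castSucc))) =
      (rename (Equiv.swap (inl i) (inl j))).comp (restrictLast n m) :=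
    algHom_ext_last ?_ (fun l => ?_) fun l => ?_
  · rw [← AlgHom.comp_apply, e, AlgHom.comp_apply]
  · rw [AlgHom.comp_apply, rename_X, Equiv.swap_apply_of_ne_of_ne] <;>
    simp [Fin.ext_iff] <;> omega
  · simp only [AlgHom.comp_apply, rename_X, restrictLast_inl, Equiv.swap_apply_def, inl.injEq,
      Fin.castSucc_inj]
    split_ifs <;> simp
  · simp [Equiv.swap_apply_def]

theorem restrictLast_swap_inr (n m : ℕ) (i j : Fin m)
    (f : MvPolynomial (Fin (n + 1) ⊕ Fin m) ℂ) :
    restrictLast n m (rename (Equiv.swap (inr i) (inr j)) f) =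
      rename (Equiv.swap (inr i) (inr j)) (restrictLast n m f) := by
  have e : (restrictLast n m).comp (rename (Equiv.swap (inr i) (inr j))) =
      (rename (Equiv.swap (inr i) (inr j))).comp (restrictLast n m) :=
    algHom_ext_last ?_ (fun l => ?_) fun l => ?_
  · rw [← AlgHom.comp_apply, e, AlgHom.comp_apply]
  · simp [Equiv.swap_apply_def]
  · simp [Equiv.swap_apply_def]
  · simp only [AlgHom.comp_apply, rename_X, restrictLast_inr, Equiv.swap_apply_def, inr.injEq]
    split_ifs <;> simp

theorem restrictLast_identify (n m : ℕ) (i : Fin n) (j : Fin m)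
    (f : MvPolynomial (Fin (n + 1) ⊕ Fin m) ℂ) :
    restrictLast n m (identify (inl i.castSucc) (inr j) f) =
      identify (inl i) (inr j) (restrictLast n m f) := by
  refine AlgHom.congr_fun (φ₁ := (restrictLast n m).comp (identify (inl i.castSucc) (inr j)))
    (φ₂ := (identify (inl i) (inr j)).comp (restrictLast n m))
    (algHom_ext_last ?_ (fun l => ?_) fun l => ?_) f
  · simp [identify, Fin.ext_iff]
    rw [if_neg (by omega), restrictLast_last]
  · simp [identify, apply_ite]
  · simp [identify]

theorem IsTwisted.restrictLast {k c : ℂ} {n m : ℕ} {f : MvPolynomial (Fin (n + 1) ⊕ Fin m) ℂ}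
    (h : IsTwisted k c f) : IsTwisted k c (restrictLast n m f) := by
  refine ⟨fun i j => ?_, fun i j => ?_, fun i j => ?_⟩
  · rw [← restrictLast_swap_inl, h.symm_inl]
  · rw [← restrictLast_swap_inr, h.symm_inr]
  · have := congrArg (DeformedCMS.restrictLast n m) (h.cond i.castSucc j)
    rw [restrictLast_identify] at this
    simpa only [map_add, map_sub, map_mul, restrictLast_pderiv_inl, restrictLast_pderiv_inr,
      restrictLast_inl, restrictLast_C, map_zero] using this

theorem isHomogeneous_restrictLast {n m d : ℕ} {f : MvPolynomial (Fin (n + 1) ⊕ Fin m) ℂ}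
    (h : f.IsHomogeneous d) : (restrictLast n m f).IsHomogeneous d := by
  have := h.aeval (R := ℂ) (Sum.elim (Fin.lastCases 0 fun i => X (inl i)) fun j => X (inr j) :
    Fin (n + 1) ⊕ Fin m → MvPolynomial (Fin n ⊕ Fin m) ℂ) (n := 1) (fun l => by
    rcases l with l | l
    · induction l using Fin.lastCases with
      | last => simpa using isHomogeneous_zero _ _ _
      | cast i => simpa using isHomogeneous_X _ _
    · exact isHomogeneous_X _ _)
  rwa [one_mul] at this

/-- A symmetric polynomial that vanishes with the last variable is divisible by the product of all
the variables. -/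
theorem IsTwisted.exists_eq_prod_mul {k c : ℂ} {n m : ℕ}
    {f : MvPolynomial (Fin (n + 1) ⊕ Fin m) ℂ} (h : IsTwisted k c f)
    (h0 : DeformedCMS.restrictLast n m f = 0) :
    ∃ g, IsTwisted k (c + 1) g ∧ f = (∏ i, X (inl i)) * g := by
  have h1 : X (inl (Fin.last n)) ∣ f := by
    refine X_dvd_of_killVar_eq_zero ?_
    have e : killVar (inl (Fin.last n)) = (rename (Sum.map Fin.castSucc id)).comp
        (DeformedCMS.restrictLast n m) := by
      refine algHom_ext_last ?_ (fun i => ?_) fun j => ?_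
      · simp [killVar]
      · simp [killVar, Fin.ext_iff]
        omega
      · simp [killVar]
    rw [e, AlgHom.comp_apply, h0, map_zero]
  have h2 : ∀ i : Fin (n + 1), X (inl i) ∣ f := fun i => by
    have := map_dvd (rename (Equiv.swap (inl (Fin.last n)) (inl i))) h1
    rwa [rename_X, Equiv.swap_apply_left, h.symm_inl] at this
  obtain ⟨g, rfl⟩ := prod_X_dvd (fun i : Fin (n + 1) => (inl i : Fin (n + 1) ⊕ Fin m))
    inl_injective h2
  refine ⟨g, ?_, rfl⟩
  refine h.of_mul (prod_X_ne_zero _) (fun i j => ?_) (fun i j => ?_) (fun i j => ?_)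
    fun i j => ?_
  · rw [map_prod]
    simp only [rename_X]
    refine Fintype.prod_equiv (Equiv.swap i j) _ _ fun l => ?_
    congr 1
    simp only [Equiv.swap_apply_def, inl.injEq]
    split_ifs <;> rfl
  · rw [map_prod]
    simp [Equiv.swap_apply_def]
  · rw [pderiv_prod_X_of_ne (fun i : Fin (n + 1) => (inl i : Fin (n + 1) ⊕ Fin m)) (x := inr j)
      (by simp), mul_zero, sub_zero, X_mul_pderiv_prod _ inl_injective i, C_1, one_mul]
  · rw [map_prod]
    refine Finset.prod_ne_zero_iff.2 fun l _ => ?_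
    rw [identify, aeval_X]
    split_ifs <;> exact X_ne_zero _

/-- If `c ≠ 0`, the equation on `a_i = b_j` forces the vanishing at `a_i = b_j = 0`, so that the
restriction is divisible by all the `b_j`. -/
theorem IsTwisted.exists_restrictLast_eq {k c : ℂ} (hc : c ≠ 0) {n m : ℕ}
    {f : MvPolynomial (Fin (n + 1) ⊕ Fin m) ℂ} (h : IsTwisted k c f) :
    ∃ g, IsTwisted k (c - k) g ∧
      DeformedCMS.restrictLast n m f = (∏ j, X (inr j)) * g := by
  have h2 : ∀ j : Fin m, X (inr j) ∣ DeformedCMS.restrictLast n m f := fun j => by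
    refine X_dvd_of_killVar_eq_zero ?_
    set ψ := (killVar (inr j)).comp (DeformedCMS.restrictLast n m) with hψ
    have e : ψ.comp (identify (inl (Fin.last n)) (inr j)) = ψ := by
      refine algHom_ext_last ?_ (fun i => ?_) fun l => ?_
      · simp [hψ, killVar, identify]
      · simp [hψ, killVar, identify, Fin.ext_iff]
        rw [if_neg (by omega)]
        simp
      · simp [hψ, killVar, identify]
    have h3 := congrArg ψ (h.cond (Fin.last n) j)
    rw [← AlgHom.comp_apply, e, map_zero, map_add, map_mul, map_mul] at h3
    have h4 : ψ (X (inl (Fin.last n))) = 0 := by simp [hψ]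
    have h5 : ψ (C c) = C c := ψ.commutes c
    rw [h4, zero_mul, zero_add, h5] at h3
    exact (mul_eq_zero.1 h3).resolve_left (by simpa using hc)
  obtain ⟨g, hg⟩ := prod_X_dvd (fun j : Fin m => (inr j : Fin n ⊕ Fin m)) inr_injective h2
  refine ⟨g, ?_, hg⟩
  have h' := h.restrictLast
  rw [hg] at h'
  rw [sub_eq_add_neg]
  refine h'.of_mul (prod_X_ne_zero _) (fun i j => ?_) (fun i j => ?_) (fun i j => ?_)
    fun i j => ?_
  · rw [map_prod]
    simp [Equiv.swap_apply_def]
  · rw [map_prod]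
    simp only [rename_X]
    refine Fintype.prod_equiv (Equiv.swap i j) _ _ fun l => ?_
    congr 1
    simp only [Equiv.swap_apply_def, inr.injEq]
    split_ifs <;> rfl
  · -- on `a_i = b_j` the factor `a_i` may be replaced by `b_j`
    have h3 : identify (inl i) (inr j) (X (inl i)) =
        identify (inl i : Fin n ⊕ Fin m) (inr j) (X (inr j)) := by
      simp [identify]
    have h4 := congrArg (identify (inl i : Fin n ⊕ Fin m) (inr j))
      (X_mul_pderiv_prod (fun j : Fin m => (inr j : Fin n ⊕ Fin m)) inr_injective j)
    have h5 : identify (inl i : Fin n ⊕ Fin m) (inr j) (C k) = C k :=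
      (identify _ _).commutes k
    rw [pderiv_prod_X_of_ne (fun j : Fin m => (inr j : Fin n ⊕ Fin m)) (x := inl i) (by simp)]
    rw [map_mul] at h4
    rw [map_mul, h3, map_sub, map_zero, map_mul, h5, C_neg]
    linear_combination (-C k) * h4
  · rw [map_prod]
    refine Finset.prod_ne_zero_iff.2 fun l _ => ?_
    rw [identify, aeval_X]
    split_ifs <;> exact X_ne_zero _

/-! ### The deformed quasi-invariants are generated by power sums -/

/-- Rank and nullity for the restriction of a linear map to a subspace. -/
theorem finrank_map_add_finrank_inf_ker {E E' : Type*} [AddCommGroup E] [Module ℂ E]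
    [AddCommGroup E'] [Module ℂ E'] (f : E →ₗ[ℂ] E') (W : Submodule ℂ E) [FiniteDimensional ℂ W] :
    Module.finrank ℂ (W.map f) + Module.finrank ℂ (W ⊓ LinearMap.ker f : Submodule ℂ E) =
      Module.finrank ℂ W := by
  rw [← LinearMap.finrank_range_add_finrank_ker (f.domRestrict W), LinearMap.range_domRestrict,
    LinearMap.ker_domRestrict, ← Submodule.map_comap_subtype, Submodule.finrank_map_subtype_eq]

/-- The kernel of the restriction of twisted quasi-invariants consists of multiples of the product
of the `a`-variables. -/
theorem finrank_twisted_inf_ker_le {k c : ℂ} {n m d h : ℕ}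
    (h1 : ∀ e, e + (n + 1) = d → Module.finrank ℂ (twisted k (c + 1) (n + 1) m e) ≤ h) :
    Module.finrank ℂ (twisted k c (n + 1) m d ⊓
      LinearMap.ker (restrictLast n m).toLinearMap : Submodule ℂ _) ≤ h := by
  by_cases hd : n + 1 ≤ d
  · obtain ⟨e, rfl⟩ := Nat.exists_eq_add_of_le' hd
    refine le_trans ?_ (h1 e rfl)
    refine le_trans (Submodule.finrank_mono (t := (twisted k (c + 1) (n + 1) m e).map
      (LinearMap.mulLeft ℂ (∏ i, X (inl i)))) ?_) (Submodule.finrank_map_le _ _)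
    rintro f ⟨⟨hf, hf'⟩, h0⟩
    obtain ⟨g, hg, rfl⟩ := hf'.exists_eq_prod_mul h0
    exact ⟨g, ⟨isHomogeneous_of_prod_X_mul _ hf (by simp), hg⟩, rfl⟩
  · have : (twisted k c (n + 1) m d ⊓ LinearMap.ker (restrictLast n m).toLinearMap) = ⊥ := by
      rw [eq_bot_iff]
      rintro f ⟨⟨hf, hf'⟩, h0⟩
      obtain ⟨g, hg, rfl⟩ := hf'.exists_eq_prod_mul h0
      by_cases hg0 : g = 0
      · simp [hg0]
      · have := card_le_of_prod_X_mul _ hf hg0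
        simp at this
        omega
    rw [this, finrank_bot]
    exact Nat.zero_le _

/-- For `c ≠ 0` the restrictions of twisted quasi-invariants are multiples of the product of the
`b`-variables. -/
theorem finrank_map_twisted_le {k c : ℂ} (hc : c ≠ 0) {n m d h : ℕ}
    (h2 : ∀ e, e + m = d → Module.finrank ℂ (twisted k (c - k) n m e) ≤ h) :
    Module.finrank ℂ ((twisted k c (n + 1) m d).map (restrictLast n m).toLinearMap) ≤ h := by
  by_cases hd : m ≤ d
  · obtain ⟨e, rfl⟩ := Nat.exists_eq_add_of_le' hd
    refine le_trans ?_ (h2 e rfl)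
    refine le_trans (Submodule.finrank_mono (t := (twisted k (c - k) n m e).map
      (LinearMap.mulLeft ℂ (∏ i, X (inr i)))) ?_) (Submodule.finrank_map_le _ _)
    rintro _ ⟨f, ⟨hf, hf'⟩, rfl⟩
    obtain ⟨g, hg, h0⟩ := hf'.exists_restrictLast_eq hc
    have := isHomogeneous_restrictLast hf
    rw [h0] at this
    exact ⟨g, ⟨isHomogeneous_of_prod_X_mul _ this (by simp), hg⟩, h0.symm⟩
  · have : (twisted k c (n + 1) m d).map (restrictLast n m).toLinearMap = ⊥ := by
      rw [eq_bot_iff]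
      rintro _ ⟨f, ⟨hf, hf'⟩, rfl⟩
      obtain ⟨g, hg, h0⟩ := hf'.exists_restrictLast_eq hc
      have := isHomogeneous_restrictLast hf
      rw [h0] at this
      by_cases hg0 : g = 0
      · simp [h0, hg0]
      · have := card_le_of_prod_X_mul _ this hg0
        simp at this
        omega
    rw [this, finrank_bot]
    exact Nat.zero_le _

/-- The constants that are reached from `c = 1` by the steps `c ↦ c + 1` and `c ↦ c - k`. -/
def Reachable (k c : ℂ) : Prop := ∃ r s : ℕ, c = 1 + r - k * s

/-- The equations that occur never degenerate to `c = 0`; this is where `k` must not be rational. -/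
theorem Reachable.ne_zero {k c : ℂ} (hk : ∀ q : ℚ, k ≠ q) (h : Reachable k c) : c ≠ 0 := by
  rintro rfl
  obtain ⟨r, s, h⟩ := h
  rcases Nat.eq_zero_or_pos s with rfl | hs
  · have : ((1 + r : ℕ) : ℂ) = 0 := by
      push_cast
      linear_combination -h
    rw [Nat.cast_eq_zero] at this
    omega
  · refine hk ((1 + r : ℚ) / s) ?_
    have : (s : ℂ) ≠ 0 := by exact_mod_cast hs.ne'
    push_cast
    field_simp
    linear_combination h

theorem Reachable.add_one {k c : ℂ} (h : Reachable k c) : Reachable k (c + 1) := by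
  obtain ⟨r, s, rfl⟩ := h
  exact ⟨r + 1, s, by push_cast; ring⟩

theorem Reachable.sub {k c : ℂ} (h : Reachable k c) : Reachable k (c - k) := by
  obtain ⟨r, s, rfl⟩ := h
  exact ⟨r, s + 1, by push_cast; ring⟩

theorem reachable_one (k : ℂ) : Reachable k 1 := ⟨0, 0, by simp⟩

/-- Without `b`-variables, twisted quasi-invariants are symmetric polynomials, and restriction to
`a_n = 0` counts them by partitions with parts at most `n`. -/
theorem finrank_twisted_zero_right_le {k c : ℂ} (hk : ∀ q : ℚ, k ≠ q) (hc : Reachable k c)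
    (n d : ℕ) : Module.finrank ℂ (twisted k c n 0 d) ≤ numHook n 0 d := by
  induction n generalizing c d with
  | zero =>
    rcases Nat.eq_zero_or_pos d with rfl | hd
    · have h1 : twisted k c 0 0 0 ≤ ℂ ∙ (1 : MvPolynomial (Fin 0 ⊕ Fin 0) ℂ) := by
        intro f _
        rw [Submodule.mem_span_singleton]
        exact ⟨coeff 0 f, by rw [← C_mul', mul_one]; exact (eq_C_of_isEmpty f).symm⟩
      have h2 : 0 < numHook 0 0 0 :=
        (Set.ncard_pos (finite_hookPartitions _ _ _)).2 ⟨0, by simp, by simp⟩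
      exact ((Submodule.finrank_mono h1).trans ((finrank_span_le_card _).trans (by simp))).trans h2
    · have : twisted k c 0 0 d = ⊥ := by
        rw [eq_bot_iff]
        rintro f ⟨hf, -⟩
        by_contra h0
        have := hf.inj_right (isHomogeneous_of_isEmpty _ _ f) h0
        omega
      rw [this, finrank_bot]
      exact Nat.zero_le _
  | succ n ih =>
    induction d using Nat.strong_induction_on generalizing c with
    | _ d ihd =>
      rw [← finrank_map_add_finrank_inf_ker (restrictLast n 0).toLinearMap]
      have h1 := finrank_map_twisted_le (hc.ne_zero hk) (n := n) (m := 0) (d := d)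
        (h := numHook n 0 d) (fun e he => by
          obtain rfl : e = d := by omega
          exact ih hc.sub e)
      by_cases hd : n + 1 ≤ d
      · obtain ⟨e, rfl⟩ := Nat.exists_eq_add_of_le' hd
        have h2 := finrank_twisted_inf_ker_le (k := k) (c := c) (n := n) (m := 0)
          (d := e + (n + 1)) (h := numHook (n + 1) 0 e) (fun e' he => by
            obtain rfl : e' = e := by omega
            exact ihd e' (by omega) hc.add_one)
        exact (add_le_add h1 h2).trans (numHook_zero_add_le n _ e rfl)
      · have h2 := finrank_twisted_inf_ker_le (k := k) (c := c) (n := n) (m := 0)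
          (d := d) (h := 0) (fun e' he => by omega)
        exact (add_le_add h1 h2).trans (numHook_zero_le n d)

/-- Without `a`-variables, the roles of the two groups of variables are exchanged. -/
theorem finrank_twisted_zero_left_le {k c : ℂ} (hk : ∀ q : ℚ, k ≠ q) (m d : ℕ) :
    Module.finrank ℂ (twisted k c 0 m d) ≤ numHook m 0 d := by
  refine le_trans ?_ (finrank_twisted_zero_right_le hk (reachable_one k) m d)
  refine le_trans (Submodule.finrank_mono (t := (twisted k 1 m 0 d).map
      (rename Sum.swap : MvPolynomial (Fin m ⊕ Fin 0) ℂ →ₐ[ℂ] _).toLinearMap) ?_)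
      (Submodule.finrank_map_le _ _)
  rintro f ⟨hf, hf'⟩
  refine ⟨rename Sum.swap f, ⟨hf.rename_isHomogeneous, ⟨fun i j => ?_, fun i => i.elim0,
    fun i j => j.elim0⟩⟩, ?_⟩
  · have h := hf'.symm_inr i j
    conv_rhs => rw [← h]
    rw [rename_rename, rename_rename]
    congr 2
    funext l
    rcases l with l | l
    · exact l.elim0
    · simp only [Function.comp_apply, Sum.swap_inr, Equiv.swap_apply_def, inl.injEq, inr.injEq]
      split_ifs <;> rfl
  · rw [AlgHom.toLinearMap_apply, rename_rename, Sum.swap_swap_eq, rename_id_apply]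

/-- The dimension of the twisted quasi-invariants is at most the number of partitions
`μ_1 ≥ … ≥ μ_n > m ≥ …` of the degree shifted by `n`. -/
theorem finrank_twisted_le {k c : ℂ} (hk : ∀ q : ℚ, k ≠ q) (hc : Reachable k c)
    (n m d : ℕ) : Module.finrank ℂ (twisted k c n m d) ≤ numHook m n (d + n) := by
  induction n generalizing c d with
  | zero => exact finrank_twisted_zero_left_le hk m d
  | succ n ih =>
    induction d using Nat.strong_induction_on generalizing c with
    | _ d ihd =>
      rw [← finrank_map_add_finrank_inf_ker (restrictLast n m).toLinearMap]
      have h2 := finrank_twisted_inf_ker_le (k := k) (c := c) (n := n) (m := m)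
        (d := d) (h := numHook m (n + 1) d) (fun e he => by
          rw [← he]
          exact ihd e (by omega) hc.add_one)
      by_cases hd : m ≤ d
      · obtain ⟨e, rfl⟩ := Nat.exists_eq_add_of_le' hd
        have h1 := finrank_map_twisted_le (hc.ne_zero hk) (n := n) (m := m) (d := e + m)
          (h := numHook m n (e + n)) (fun e' he => by
            obtain rfl : e' = e := by omega
            exact ih hc.sub e')
        rw [add_comm]
        exact (add_le_add h2 h1).trans (numHook_add_le m n (e + m) (e + n) (by omega))
      · have h1 := finrank_map_twisted_le (k := k) (hc.ne_zero hk) (n := n) (m := m) (d := d)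
          (h := 0) (fun e he => by omega)
        rw [add_comm]
        exact (add_le_add h2 h1).trans (numHook_le_add m (n + 1) d)

/-- The coefficients of the deformed power sums `∑ a_i ^ r + k⁻¹ ∑ b_j ^ r`. -/
def powerCoeff (k : ℂ) (n m : ℕ) : Fin n ⊕ Fin m → ℂ := Sum.elim (fun _ => 1) fun _ => k⁻¹

/-- The polynomials of degree `d` in the deformed power sums. -/
def powerSpan (k : ℂ) (n m d : ℕ) : Submodule ℂ (MvPolynomial (Fin n ⊕ Fin m) ℂ) :=
  (PowerPart d).map (powerSumMap (powerCoeff k n m)).toLinearMap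

theorem isHomogeneous_powerSumMap {σ : Type*} [Fintype σ] (κ : σ → ℂ) {d : ℕ}
    {F : MvPolynomial ℕ ℂ} (hF : F ∈ PowerPart d) : (powerSumMap κ F).IsHomogeneous d := by
  rw [F.as_sum, map_sum]
  refine IsHomogeneous.sum _ _ _ fun s hs => ?_
  rw [powerSumMap, aeval_monomial, MvPolynomial.algebraMap_eq, ← hF (mem_support_iff.1 hs)]
  refine IsHomogeneous.C_mul ?_ _
  rw [Finsupp.weight_apply]
  refine IsHomogeneous.prod _ _ _ fun t _ => ?_
  have h : (∑ i, C (κ i) * X i ^ (t + 1) : MvPolynomial σ ℂ).IsHomogeneous (t + 1) :=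
    IsHomogeneous.sum _ _ _ fun i _ => isHomogeneous_C_mul_X_pow _ _ _
  simpa only [smul_eq_mul, mul_comm, powerWeight] using h.pow (s t)

theorem IsTwisted.mul {k : ℂ} {n m : ℕ} {f g : MvPolynomial (Fin n ⊕ Fin m) ℂ}
    (hf : IsTwisted k 0 f) (hg : IsTwisted k 0 g) : IsTwisted k 0 (f * g) := by
  refine ⟨fun i j => ?_, fun i j => ?_, fun i j => ?_⟩
  · rw [map_mul, hf.symm_inl, hg.symm_inl]
  · rw [map_mul, hf.symm_inr, hg.symm_inr]
  · have h1 := hf.cond i j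
    have h2 := hg.cond i j
    simp only [C_0, zero_mul, add_zero, pderiv_mul, map_mul, map_add, map_sub] at h1 h2 ⊢
    linear_combination identify (inl i) (inr j) g * h1 + identify (inl i) (inr j) f * h2

theorem IsTwisted.add {k : ℂ} {n m : ℕ} {f g : MvPolynomial (Fin n ⊕ Fin m) ℂ}
    (hf : IsTwisted k 0 f) (hg : IsTwisted k 0 g) : IsTwisted k 0 (f + g) := by
  refine ⟨fun i j => ?_, fun i j => ?_, fun i j => ?_⟩
  · rw [map_add, hf.symm_inl, hg.symm_inl]
  · rw [map_add, hf.symm_inr, hg.symm_inr]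
  · have h1 := hf.cond i j
    have h2 := hg.cond i j
    simp only [C_0, zero_mul, add_zero, map_mul, map_add, map_sub] at h1 h2 ⊢
    linear_combination h1 + h2

theorem isTwisted_powerSumMap {k : ℂ} (hk : k ≠ 0) (n m : ℕ) (F : MvPolynomial ℕ ℂ) :
    IsTwisted k 0 (powerSumMap (powerCoeff k n m) F) := by
  induction F using MvPolynomial.induction_on with
  | C a =>
    rw [powerSumMap, aeval_C, MvPolynomial.algebraMap_eq]
    exact ⟨by simp, by simp, by simp⟩
  | add p q hp hq =>
    rw [map_add]
    exact hp.add hq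
  | mul_X p t hp =>
    rw [map_mul]
    refine hp.mul ⟨fun i j => ?_, fun i j => ?_, fun i j => ?_⟩
    · rw [powerSumMap_X, map_sum]
      refine Fintype.sum_equiv (Equiv.swap (inl i) (inl j)) _ _ fun l => ?_
      rw [map_mul, map_pow, rename_C, rename_X]
      congr 2
      rcases l with l | l
      · rw [Equiv.swap_apply_def]
        split_ifs <;> rfl
      · rw [Equiv.swap_apply_of_ne_of_ne (by simp) (by simp)]
    · rw [powerSumMap_X, map_sum]
      refine Fintype.sum_equiv (Equiv.swap (inr i) (inr j)) _ _ fun l => ?_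
      rw [map_mul, map_pow, rename_C, rename_X]
      congr 2
      rcases l with l | l
      · rw [Equiv.swap_apply_of_ne_of_ne (by simp) (by simp)]
      · rw [Equiv.swap_apply_def]
        split_ifs <;> rfl
    · rw [powerSumMap_X, pderiv_powerSum, pderiv_powerSum]
      have h : ∀ a : ℂ, identify (inl i : Fin n ⊕ Fin m) (inr j) (C a) = C a :=
        (identify _ _).commutes
      have h' : k * (k⁻¹ * ((t : ℂ) + 1)) = 1 * (t + 1) := by
        field_simp
      simp only [C_0, zero_mul, add_zero, map_mul, map_sub, map_pow, h, powerCoeff,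
        Sum.elim_inl, Sum.elim_inr]
      simp only [identify, aeval_X, if_true, reduceCtorEq, if_false, ← mul_assoc, ← C_mul] at h' ⊢
      rw [h', sub_self, mul_zero]

theorem powerSpan_le {k : ℂ} (hk : k ≠ 0) (n m d : ℕ) : powerSpan k n m d ≤ twisted k 0 n m d := by
  rintro _ ⟨F, hF, rfl⟩
  exact ⟨isHomogeneous_powerSumMap _ hF, isTwisted_powerSumMap hk n m F⟩

theorem map_restrictLast_powerSpan (k : ℂ) (n m d : ℕ) :
    (powerSpan k (n + 1) m d).map (restrictLast n m).toLinearMap = powerSpan k n m d := by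
  rw [powerSpan, powerSpan, ← Submodule.map_comp]
  congr 1
  have : (restrictLast n m).comp (powerSumMap (powerCoeff k (n + 1) m)) =
      powerSumMap (powerCoeff k n m) := by
    refine MvPolynomial.algHom_ext fun t => ?_
    rw [AlgHom.comp_apply, powerSumMap_X, powerSumMap_X, map_sum, Fintype.sum_sum_type,
      Fintype.sum_sum_type, Fin.sum_univ_castSucc]
    simp [powerCoeff]
  rw [← this]
  rfl

/-- The kernel of the restriction to one variable less has at most the dimension of the twisted
quasi-invariants with constant `c = 1`. -/
theorem finrank_twisted_succ_le {k : ℂ} (hk : ∀ q : ℚ, k ≠ q) (n m d : ℕ)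
    {W : Submodule ℂ (MvPolynomial (Fin (n + 1) ⊕ Fin m) ℂ)} (hW : W ≤ twisted k 0 (n + 1) m d) :
    Module.finrank ℂ W ≤ Module.finrank ℂ (W.map (restrictLast n m).toLinearMap) +
      numHook m (n + 1) d := by
  have : FiniteDimensional ℂ W := Submodule.finiteDimensional_of_le hW
  rw [← finrank_map_add_finrank_inf_ker (restrictLast n m).toLinearMap W]
  refine Nat.add_le_add_left ((Submodule.finrank_mono (inf_le_inf_right _ hW)).trans ?_) _
  refine finrank_twisted_inf_ker_le fun e he => ?_
  rw [← he]
  refine finrank_twisted_le hk ?_ _ _ _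
  rw [zero_add]
  exact reachable_one k

/-- If `k` is not rational, the deformed quasi-invariants are generated by the deformed power sums.
The restrictions in the number of `a`-variables give upper bounds for both sides, which add up to
the number of all partitions; the power sums attain their bound when there are many variables, so
all bounds are attained. -/
theorem powerSpan_eq {k : ℂ} (hk : ∀ q : ℚ, k ≠ q) (n m d : ℕ) :
    powerSpan k n m d = twisted k 0 n m d := by
  have hk0 : k ≠ 0 := by simpa using hk 0
  have h1 : ∀ n, Module.finrank ℂ (twisted k 0 n m d) ≤
      ∑ i ∈ Finset.range (n + 1), numHook m i d := by
    intro n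
    induction n with
    | zero => simpa using finrank_twisted_zero_left_le hk m d
    | succ n ih =>
      rw [Finset.sum_range_succ]
      refine (finrank_twisted_succ_le hk n m d le_rfl).trans (Nat.add_le_add_right ?_ _)
      refine (Submodule.finrank_mono ?_).trans ih
      rintro _ ⟨f, hf, rfl⟩
      exact ⟨isHomogeneous_restrictLast hf.1, hf.2.restrictLast⟩
  have h2 : ∀ N, Module.finrank ℂ (powerSpan k (n + N) m d) +
      ∑ i ∈ Finset.range (n + 1), numHook m i d ≤
        Module.finrank ℂ (powerSpan k n m d) +
        ∑ i ∈ Finset.range (n + N + 1), numHook m i d := by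
    intro N
    induction N with
    | zero => exact le_rfl
    | succ N ih =>
      have h := finrank_twisted_succ_le hk (n + N) m d (powerSpan_le hk0 (n + N + 1) m d)
      rw [map_restrictLast_powerSpan] at h
      rw [← add_assoc n N 1, Finset.sum_range_succ _ (n + N + 1)]
      omega
  -- in `n + d + m` variables the power sums are independent in degree `d`
  have h3 : Module.finrank ℂ (powerSpan k (n + d) m d) = numPartitions d := by
    rw [← finrank_powerPart, powerSpan]
    rw [← finrank_map_add_finrank_inf_ker (powerSumMap (powerCoeff k (n + d) m)).toLinearMap
      (PowerPart d), (eq_bot_iff.2 ?_ : PowerPart d ⊓ _ = ⊥), finrank_bot, add_zero]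
    rintro F ⟨hF, hF'⟩
    refine (Submodule.mem_bot ℂ).2 (eq_zero_of_powerSumMap_eq_zero _ (fun i => ?_) ?_ hF hF')
    · rcases i with i | i
      · exact one_ne_zero
      · exact inv_ne_zero hk0
    · simp
      omega
  have h4 := sum_numHook_le m (n + d + 1) d
  refine Submodule.eq_of_le_of_finrank_le (powerSpan_le hk0 n m d) ?_
  have := h1 n
  have := h2 d
  omega

end

/-! ### The symbols of the integrals -/

section Symbols

variable {n m : ℕ} {D E : Module.End ℂ (RatFun n m)} {P Q : SVdual n m}

theorem hasSymbol_one (n m : ℕ) : HasSymbol n m 1 1 := by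
  simpa using hasSymbol_algebraMap n m 1

theorem hasSymbol_zero (n m : ℕ) : HasSymbol n m 0 0 := by
  simpa using hasSymbol_algebraMap n m 0

theorem HasSymbol.smul (c : ℂ) (hP : HasSymbol n m D P) : HasSymbol n m (c • D) (C c * P) := by
  rw [Algebra.smul_def]
  exact (hasSymbol_algebraMap n m c).mul hP

theorem HasSymbol.sub (hP : HasSymbol n m D P) (hQ : HasSymbol n m E Q) :
    HasSymbol n m (D - E) (P - Q) := by
  have h := hP.add (hQ.smul (-1))
  have e : D + (-1 : ℂ) • E = D - E := by
    ext f
    simp [sub_eq_add_neg]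
  rwa [C_neg, C_1, neg_one_mul, ← sub_eq_add_neg, e] at h

theorem HasSymbol.sum {ι : Type*} (s : Finset ι) {D : ι → Module.End ℂ (RatFun n m)}
    {P : ι → SVdual n m} (h : ∀ i ∈ s, HasSymbol n m (D i) (P i)) :
    HasSymbol n m (∑ i ∈ s, D i) (∑ i ∈ s, P i) := by
  classical
  induction s using Finset.induction_on with
  | empty => exact hasSymbol_zero n m
  | insert a s ha ih =>
    rw [Finset.sum_insert ha, Finset.sum_insert ha]
    exact (h a (Finset.mem_insert_self a s)).add
      (ih fun i hi => h i (Finset.mem_insert_of_mem hi))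

theorem hasSymbol_mulOp_of_gt {i j : Fin (n + m)} (h : j < i) :
    HasSymbol n m (mulOp n m i j) 0 := by
  have e : mulOp n m i j = 1 - mulOp n m j i := by
    ext1 f
    have h1 := x_sub_ne_zero n m h.ne
    have h2 := x_sub_ne_zero n m h.ne'
    simp only [mulOp, LinearMap.mulLeft_apply, LinearMap.sub_apply, Module.End.one_apply]
    field_simp
    ring
  rw [e, ← sub_self 1]
  exact (hasSymbol_one n m).sub (hasSymbol_mulOp n m h)

end Symbols

/-- A homomorphism with the prescribed values on the generators assigns to each operator its leading
symbol. -/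
theorem hasSymbol_of_algHom (n m : ℕ) (k : ℂ) (Φ : operatorAlgebra n m k →ₐ[ℂ] SVdual n m)
    (h1 : ∀ i, Φ ⟨del n m k i, del_mem n m k i⟩ = C (k ^ parity n m i) * X i)
    (h2 : ∀ i j, ∀ h : i < j, Φ ⟨mulOp n m i j, mulOp_mem_of_lt n m k h⟩ = 1)
    (D : operatorAlgebra n m k) : HasSymbol n m D (Φ D) := by
  obtain ⟨D, hD⟩ := D
  induction hD using Algebra.adjoin_induction with
  | mem D h =>
    rcases h with ⟨i, rfl⟩ | ⟨i, j, h, rfl⟩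
    · exact (h1 i).symm ▸ hasSymbol_del n m k i
    · exact (h2 i j h).symm ▸ hasSymbol_mulOp n m h
  | algebraMap c =>
    have e : Φ ⟨algebraMap ℂ _ c, Subalgebra.algebraMap_mem _ c⟩ = C c := Φ.commutes c
    exact e.symm ▸ hasSymbol_algebraMap n m c
  | add D E hD hE ihD ihE =>
    have e : Φ ⟨D + E, add_mem hD hE⟩ = Φ ⟨D, hD⟩ + Φ ⟨E, hE⟩ := map_add Φ ⟨D, hD⟩ ⟨E, hE⟩
    exact e.symm ▸ ihD.add ihE
  | mul D E hD hE ihD ihE =>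
    have e : Φ ⟨D * E, mul_mem hD hE⟩ = Φ ⟨D, hD⟩ * Φ ⟨E, hE⟩ := map_mul Φ ⟨D, hD⟩ ⟨E, hE⟩
    exact e.symm ▸ ihD.mul ihE

theorem harishChandraAmbient_spec (n m : ℕ) (k : ℂ) :
    (∀ i, harishChandraAmbient n m k ⟨del n m k i, del_mem n m k i⟩ =
      C (k ^ parity n m i) * X i) ∧
    ∀ i j, ∀ h : i < j,
      harishChandraAmbient n m k ⟨mulOp n m i j, mulOp_mem_of_lt n m k h⟩ = 1 :=
  (existsUnique_harishChandra n m k).choose_spec.1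

theorem harishChandra_apply (n m : ℕ) (k : ℂ) (D : integralAlgebra n m k) :
    harishChandra n m k D =
      harishChandraAmbient n m k (Subalgebra.inclusion (integralAlgebra_le n m k) D) := by
  rw [harishChandra, AlgHom.comp_apply]

theorem hasSymbol_harishChandra (n m : ℕ) (k : ℂ) (D : integralAlgebra n m k) :
    HasSymbol n m D (harishChandra n m k D) := by
  rw [harishChandra_apply]
  have h := hasSymbol_of_algHom n m k (harishChandraAmbient n m k)
    (harishChandraAmbient_spec n m k).1 (harishChandraAmbient_spec n m k).2
    (Subalgebra.inclusion (integralAlgebra_le n m k) D)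
  rwa [Subalgebra.coe_inclusion] at h

/-- The image of the quantum Moser matrix under the Harish-Chandra homomorphism. -/
def symbolMatrix (n m : ℕ) (k : ℂ) : Matrix (Fin (n + m)) (Fin (n + m)) (SVdual n m) :=
  Matrix.of fun i j =>
    if i = j then
      C (k ^ parity n m i) * X i - ∑ l ∈ Finset.univ.filter (i < ·), C (k ^ (1 - parity n m l))
    else if i < j then C (k ^ (1 - parity n m j)) else 0

theorem hasSymbol_moser (n m : ℕ) (k : ℂ) (i j : Fin (n + m)) :
    HasSymbol n m (moser n m k i j) (symbolMatrix n m k i j) := by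
  have h1 : ∀ l, l ≠ i → HasSymbol n m (k ^ (1 - parity n m l) • mulOp n m i l)
      (if i < l then C (k ^ (1 - parity n m l)) else 0) := by
    intro l hl
    split_ifs with h
    · simpa using (hasSymbol_mulOp n m h).smul (k ^ (1 - parity n m l))
    · simpa using (hasSymbol_mulOp_of_gt (lt_of_le_of_ne (not_lt.1 h) hl)).smul
        (k ^ (1 - parity n m l))
  rw [moser, symbolMatrix, Matrix.of_apply, Matrix.of_apply]
  split_ifs with h h'
  · refine (hasSymbol_del n m k i).sub ?_
    have := HasSymbol.sum (Finset.univ.erase i) fun l hl => h1 l (Finset.ne_of_mem_erase hl)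
    rwa [Finset.sum_erase (f := fun l => if i < l then C (k ^ (1 - parity n m l)) else 0) _
      (by simp), ← Finset.sum_filter] at this
  · simpa [h'] using h1 j (Ne.symm h)
  · simpa [h'] using h1 j (Ne.symm h)

theorem hasSymbol_moser_pow (n m : ℕ) (k : ℂ) (r : ℕ) (i j : Fin (n + m)) :
    HasSymbol n m ((moser n m k ^ r) i j) ((symbolMatrix n m k ^ r) i j) := by
  induction r generalizing i j with
  | zero =>
    rw [pow_zero, pow_zero, Matrix.one_apply, Matrix.one_apply]
    split_ifs
    · exact hasSymbol_one n m
    · exact hasSymbol_zero n m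
  | succ r ih =>
    rw [pow_succ, pow_succ, Matrix.mul_apply, Matrix.mul_apply]
    exact HasSymbol.sum _ fun l _ => (ih i l).mul (hasSymbol_moser n m k l j)

/-- The image of `ℒ_r` under the Harish-Chandra homomorphism. -/
def cmsSymbol (n m : ℕ) (k : ℂ) (r : ℕ) : SVdual n m :=
  ∑ i, ∑ j, C (k ^ parity n m i)⁻¹ * (symbolMatrix n m k ^ r) i j

theorem hasSymbol_cmsIntegral (n m : ℕ) (k : ℂ) (r : ℕ) :
    HasSymbol n m (cmsIntegral n m k r) (cmsSymbol n m k r) :=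
  HasSymbol.sum _ fun i _ => HasSymbol.sum _ fun j _ => (hasSymbol_moser_pow n m k r i j).smul _

theorem range_harishChandra (n m : ℕ) (k : ℂ) :
    (harishChandra n m k).range = Algebra.adjoin ℂ {P | ∃ r, 1 ≤ r ∧ P = cmsSymbol n m k r} := by
  refine le_antisymm ?_ (Algebra.adjoin_le ?_)
  · rintro _ ⟨⟨D, hD⟩, rfl⟩
    suffices h : ∃ P ∈ Algebra.adjoin ℂ {P | ∃ r, 1 ≤ r ∧ P = cmsSymbol n m k r},
        HasSymbol n m D P by
      obtain ⟨P, hP, h⟩ := h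
      have := (hasSymbol_harishChandra n m k ⟨D, hD⟩).unique h
      change harishChandra n m k ⟨D, hD⟩ ∈ _
      rwa [this]
    induction hD using Algebra.adjoin_induction with
    | mem D h =>
      obtain ⟨r, hr, rfl⟩ := h
      exact ⟨_, Algebra.subset_adjoin ⟨r, hr, rfl⟩, hasSymbol_cmsIntegral n m k r⟩
    | algebraMap c => exact ⟨_, Subalgebra.algebraMap_mem _ c, hasSymbol_algebraMap n m c⟩
    | add D E hD hE ihD ihE =>
      obtain ⟨P, hP, h⟩ := ihD
      obtain ⟨Q, hQ, h'⟩ := ihE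
      exact ⟨_, add_mem hP hQ, h.add h'⟩
    | mul D E hD hE ihD ihE =>
      obtain ⟨P, hP, h⟩ := ihD
      obtain ⟨Q, hQ, h'⟩ := ihE
      exact ⟨_, mul_mem hP hQ, h.mul h'⟩
  · rintro _ ⟨r, hr, rfl⟩
    refine ⟨⟨cmsIntegral n m k r, Algebra.subset_adjoin ⟨r, hr, rfl⟩⟩, ?_⟩
    exact (hasSymbol_harishChandra n m k _).unique (hasSymbol_cmsIntegral n m k r)

/-! ### The symbols are shifted quasi-invariants -/

/-- The generating function of the moments `∑ c_i (U ^ r)_{ij}` of an upper triangular matrix whose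
entries `U_{ij}`, `i < j`, depend only on the column is a product over the diagonal. -/
theorem moments_generating_function {N : ℕ} (c u : Fin N → ℂ) (U : Matrix (Fin N) (Fin N) ℂ)
    (hU : ∀ i j, U i j = if i = j then u i else if i < j then c j else 0) :
    (1 + PowerSeries.X * PowerSeries.mk fun r => ∑ i, ∑ j, c i * (U ^ r) i j) *
      ∏ i, (1 - PowerSeries.X * PowerSeries.C (u i)) =
      ∏ i, (1 - PowerSeries.X * PowerSeries.C (u i - c i)) := by
  set y : Fin N → PowerSeries ℂ := fun i => PowerSeries.mk fun r => ∑ j, (U ^ r) i j with hy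
  have h1 : ∀ i, y i = 1 + PowerSeries.X * ∑ j, PowerSeries.C (U i j) * y j := by
    intro i
    ext r
    rcases r with _ | r
    · simp [hy, Matrix.one_apply]
    · rw [map_add, PowerSeries.coeff_succ_X_mul, map_sum, PowerSeries.coeff_one,
        if_neg (Nat.succ_ne_zero r), zero_add]
      simp only [hy, PowerSeries.coeff_C_mul, PowerSeries.coeff_mk]
      simp only [pow_succ', Matrix.mul_apply, Finset.mul_sum]
      rw [Finset.sum_comm]
  -- `U` is triangular, so `y i` is determined by the `y j` with `i < j`
  have h2 : ∀ i, y i * (1 - PowerSeries.X * PowerSeries.C (u i)) =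
      1 + PowerSeries.X * ∑ j ∈ Finset.univ.filter (i < ·), PowerSeries.C (c j) * y j := by
    intro i
    have h3 : ∑ j, PowerSeries.C (U i j) * y j = PowerSeries.C (u i) * y i +
        ∑ j ∈ Finset.univ.filter (i < ·), PowerSeries.C (c j) * y j := by
      rw [Finset.sum_filter, ← Finset.add_sum_erase _ _ (Finset.mem_univ i), hU, if_pos rfl]
      congr 1
      rw [← Finset.sum_erase (a := i) Finset.univ (by simp)]
      refine Finset.sum_congr rfl fun j hj => ?_
      rw [hU, if_neg (Finset.ne_of_mem_erase hj).symm]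
      split_ifs <;> simp
    have h4 := h1 i
    rw [h3] at h4
    linear_combination h4
  -- hence `S_i = 1 + X * ∑_{j ≥ i} c_j y_j` has `S_i (1 - X u_i) = S_{i+1} (1 - X (u_i - c_i))`
  have h5 : ∀ l ≤ N, (1 + PowerSeries.X *
      ∑ j ∈ Finset.univ.filter (fun j : Fin N => N - l ≤ j), PowerSeries.C (c j) * y j) *
      ∏ j ∈ Finset.univ.filter (fun j : Fin N => N - l ≤ j),
        (1 - PowerSeries.X * PowerSeries.C (u j)) =
      ∏ j ∈ Finset.univ.filter (fun j : Fin N => N - l ≤ j),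
        (1 - PowerSeries.X * PowerSeries.C (u j - c j)) := by
    intro l hl
    induction l with
    | zero =>
      have : Finset.univ.filter (fun j : Fin N => N - 0 ≤ (j : ℕ)) = ∅ :=
        Finset.filter_eq_empty_iff.2 fun j _ => by omega
      rw [this]
      simp
    | succ l ih =>
      set i : Fin N := ⟨N - (l + 1), by omega⟩ with hi
      have hset : Finset.univ.filter (fun j : Fin N => N - (l + 1) ≤ (j : ℕ)) =
          insert i (Finset.univ.filter (fun j : Fin N => N - l ≤ (j : ℕ))) := by
        ext j
        simp only [Finset.mem_filter_univ, Finset.mem_insert, hi, Fin.ext_iff]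
        omega
      have hset' : Finset.univ.filter (i < ·) =
          Finset.univ.filter (fun j : Fin N => N - l ≤ (j : ℕ)) := by
        ext j
        simp only [Finset.mem_filter_univ, hi, Fin.lt_def]
        omega
      have hni : i ∉ Finset.univ.filter (fun j : Fin N => N - l ≤ (j : ℕ)) := by
        simp only [Finset.mem_filter_univ, hi]
        omega
      have h6 := h2 i
      rw [hset'] at h6
      have h7 := ih (by omega)
      rw [hset, Finset.sum_insert hni, Finset.prod_insert hni, Finset.prod_insert hni, ← h7,
        map_sub]
      linear_combination (PowerSeries.X * PowerSeries.C (c i) *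
        ∏ j ∈ Finset.univ.filter (fun j : Fin N => N - l ≤ (j : ℕ)),
          (1 - PowerSeries.X * PowerSeries.C (u j))) * h6
  have h8 := h5 N le_rfl
  simp only [Nat.sub_self, Nat.zero_le, Finset.filter_true] at h8
  rw [← h8]
  congr 3
  ext r
  rw [PowerSeries.coeff_mk, map_sum]
  refine Finset.sum_congr rfl fun i _ => ?_
  rw [PowerSeries.coeff_C_mul, hy, PowerSeries.coeff_mk, Finset.mul_sum]

/-! ### The action of the reflections on the symbols -/

theorem parity_eq_zero_or_one (n m : ℕ) (i : Fin (n + m)) :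
    parity n m i = 0 ∨ parity n m i = 1 := by
  rw [parity]
  split_ifs <;> simp

theorem parity_castAdd (n m : ℕ) (i : Fin n) : parity n m (Fin.castAdd m i) = 0 := by
  simp [parity]

theorem parity_natAdd (n m : ℕ) (j : Fin m) : parity n m (Fin.natAdd n j) = 1 := by
  simp [parity]

theorem parity_of_lt {n m : ℕ} {i j : Fin (n + m)} (h : i < j)
    (hp : parity n m i ≠ parity n m j) : parity n m i = 0 ∧ parity n m j = 1 := by
  rw [parity, parity] at *
  rw [Fin.lt_def] at h
  split_ifs at * <;> omega

/-- The diagonal entry `u_i` of the symbol of the Moser matrix at the point `v`. -/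
def symbolDiag (n m : ℕ) (k : ℂ) (v : V n m) (i : Fin (n + m)) : ℂ :=
  k ^ parity n m i * v i - ∑ l ∈ Finset.univ.filter (i < ·), k ^ (1 - parity n m l)

theorem sum_filter_lt (n m : ℕ) (k : ℂ) (i : Fin (n + m)) :
    ∑ l ∈ Finset.univ.filter (i < ·), k ^ (1 - parity n m l) =
      if (i : ℕ) < n then k * (n - 1 - i) + m else (n + m - 1 - i : ℂ) := by
  rw [Finset.sum_filter, Fin.sum_univ_add]
  simp only [parity_castAdd, parity_natAdd, Nat.sub_zero, pow_one, Nat.sub_self, pow_zero]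
  simp only [Fin.lt_def, Fin.val_castAdd, Fin.val_natAdd]
  rw [Finset.sum_ite, Finset.sum_ite, Finset.sum_const_zero, Finset.sum_const_zero, add_zero,
    add_zero, Finset.sum_const, Finset.sum_const]
  split_ifs with h
  · have h1 : Finset.univ.filter (fun l : Fin n => (i : ℕ) < l) = Finset.Ioi ⟨i, h⟩ := by
      ext l
      simp [Fin.lt_def]
    have h2 : Finset.univ.filter (fun l : Fin m => (i : ℕ) < n + l) = Finset.univ :=
      Finset.filter_true_of_mem fun l _ => by omega
    rw [h1, h2, Fin.card_Ioi, Finset.card_univ, Fintype.card_fin, nsmul_eq_mul, nsmul_eq_mul,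
      Nat.sub_sub, Nat.cast_sub (by simp; omega)]
    push_cast
    ring
  · have h1 : Finset.univ.filter (fun l : Fin n => (i : ℕ) < l) = ∅ :=
      Finset.filter_false_of_mem fun l _ => by omega
    have h2 : Finset.univ.filter (fun l : Fin m => (i : ℕ) < n + l) =
        Finset.Ioi ⟨i - n, by omega⟩ := by
      ext l
      simp [Fin.lt_def]
      omega
    rw [h1, h2, Fin.card_Ioi, Finset.card_empty, zero_smul, zero_add, nsmul_eq_mul, mul_one,
      Nat.cast_sub (by simp; omega), Nat.cast_sub (by omega), Nat.cast_sub (by omega)]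
    push_cast
    ring

/-- In the coordinates shifted by `ρ`, the diagonal entries differ from the coordinates by constants
that depend only on the parity. -/
theorem symbolDiag_eq (n m : ℕ) {k : ℂ} (hk : k ≠ 0) (v : V n m) (i : Fin (n + m)) :
    symbolDiag n m k v i = k ^ parity n m i * (v + rho n m k) i + k ^ (1 - parity n m i) / 2 -
      (k * n + m) / 2 := by
  rw [symbolDiag, sum_filter_lt, Pi.add_apply, rho, parity]
  split_ifs with h
  · simp only [pow_zero, Nat.sub_zero, pow_one]
    ring
  · simp only [pow_one, Nat.sub_self, pow_zero]
    field_simp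
    ring

theorem pow_parity_ne_zero (n m : ℕ) {k : ℂ} (hk : k ≠ 0) (i : Fin (n + m)) :
    k ^ parity n m i ≠ 0 := pow_ne_zero _ hk

theorem inv_pow_parity (n m : ℕ) {k : ℂ} (hk : k ≠ 0) (i : Fin (n + m)) :
    (k ^ parity n m i)⁻¹ = k⁻¹ * k ^ (1 - parity n m i) := by
  rcases parity_eq_zero_or_one n m i with h | h <;> rw [h] <;> simp [hk]

theorem eval_symbolMatrix (n m : ℕ) (k : ℂ) (v : V n m) (i j : Fin (n + m)) :
    (symbolMatrix n m k).map (eval v) i j =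
      if i = j then symbolDiag n m k v i else if i < j then k ^ (1 - parity n m j) else 0 := by
  rw [Matrix.map_apply, symbolMatrix, Matrix.of_apply]
  split_ifs with h h'
  · simp [symbolDiag]
  · rw [eval_C]
  · rw [map_zero]

theorem eval_cmsSymbol (n m : ℕ) {k : ℂ} (hk : k ≠ 0) (v : V n m) (r : ℕ) :
    eval v (cmsSymbol n m k r) = k⁻¹ * ∑ i, ∑ j, k ^ (1 - parity n m i) *
      (((symbolMatrix n m k).map (eval v)) ^ r) i j := by
  have h : ((symbolMatrix n m k).map (eval v)) ^ r = ((symbolMatrix n m k) ^ r).map (eval v) :=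
    (map_pow (eval v).mapMatrix (symbolMatrix n m k) r).symm
  rw [h, cmsSymbol, map_sum, Finset.mul_sum]
  refine Finset.sum_congr rfl fun i _ => ?_
  rw [map_sum, Finset.mul_sum]
  refine Finset.sum_congr rfl fun j _ => ?_
  rw [map_mul, eval_C, inv_pow_parity n m hk, Matrix.map_apply, mul_assoc]

theorem eq_of_mul_mul_eq {R : Type*} [CommRing R] [IsDomain R] {a b p q : R} (hp : p ≠ 0)
    (hq : q ≠ 0) (h : a * p * q = b * q * p) : a = b :=
  mul_right_cancel₀ (mul_ne_zero hp hq) (by linear_combination h)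

/-- The symbols of the integrals agree at two points if the products that represent their generating
function do. -/
theorem eval_cmsSymbol_eq (n m : ℕ) {k : ℂ} (hk : k ≠ 0) {v v' : V n m}
    (h : (∏ i, (1 - PowerSeries.X *
        PowerSeries.C (symbolDiag n m k v i - k ^ (1 - parity n m i)))) *
      ∏ i, (1 - PowerSeries.X * PowerSeries.C (symbolDiag n m k v' i)) =
      (∏ i, (1 - PowerSeries.X *
        PowerSeries.C (symbolDiag n m k v' i - k ^ (1 - parity n m i)))) *
      ∏ i, (1 - PowerSeries.X * PowerSeries.C (symbolDiag n m k v i))) (r : ℕ) :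
    eval v (cmsSymbol n m k r) = eval v' (cmsSymbol n m k r) := by
  have h0 : ∀ v : V n m, (∏ i, (1 - PowerSeries.X *
      PowerSeries.C (symbolDiag n m k v i)) : PowerSeries ℂ) ≠ 0 := fun v =>
    Finset.prod_ne_zero_iff.2 fun i _ e => by
      have := congrArg (PowerSeries.constantCoeff) e
      simp at this
  have hv := moments_generating_function (fun i => k ^ (1 - parity n m i)) (symbolDiag n m k v) _
    (eval_symbolMatrix n m k v)
  have hv' := moments_generating_function (fun i => k ^ (1 - parity n m i))
    (symbolDiag n m k v') _ (eval_symbolMatrix n m k v')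
  rw [← hv, ← hv'] at h
  have h1 := eq_of_mul_mul_eq (h0 v) (h0 v') h
  have h2 := congrArg (PowerSeries.coeff (r + 1)) h1
  rw [map_add, map_add, PowerSeries.coeff_succ_X_mul, PowerSeries.coeff_succ_X_mul,
    PowerSeries.coeff_mk, PowerSeries.coeff_mk, add_right_inj] at h2
  rw [eval_cmsSymbol n m hk, eval_cmsSymbol n m hk, h2]

theorem form_root (n m : ℕ) (k : ℂ) (v : V n m) (i j : Fin (n + m)) :
    form n m k v (root n m i j) = k ^ parity n m i * v i - k ^ parity n m j * v j := by
  simp only [form, root, Pi.sub_apply, mul_sub, Finset.sum_sub_distrib, Pi.single_apply,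
    mul_ite, mul_one, mul_zero, Finset.sum_ite_eq', Finset.mem_univ, if_true]

theorem form_root_root (n m : ℕ) (k : ℂ) {i j : Fin (n + m)} (h : i ≠ j) :
    form n m k (root n m i j) (root n m i j) = k ^ parity n m i + k ^ parity n m j := by
  rw [form_root]
  simp [root, h, h.symm]

theorem affineReflection_add_rho (n m : ℕ) (k : ℂ) (α v : V n m) :
    affineReflection n m k α v + rho n m k = reflection n m k α (v + rho n m k) :=
  sub_add_cancel _ _

/-- An even reflection exchanges two coordinates. -/
theorem reflection_even (n m : ℕ) {k : ℂ} (hk : k ≠ 0) {i j : Fin (n + m)} (h : i ≠ j)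
    (hp : parity n m i = parity n m j) (w : V n m) :
    reflection n m k (root n m i j) w = w ∘ Equiv.swap i j := by
  have h0 := pow_parity_ne_zero n m hk j
  have h2 : 2 * form n m k w (root n m i j) / form n m k (root n m i j) (root n m i j) =
      w i - w j := by
    rw [form_root, form_root_root n m k h, hp]
    field_simp
    ring
  rw [reflection, h2]
  funext l
  rw [Function.comp_apply, Equiv.swap_apply_def]
  split_ifs with h3 h4
  · simp [h3, root, h]
  · simp [h4, root, h.symm]
  · simp [root, h3, h4]

/-- Two products that agree outside two factors. -/
theorem prod_mul_prod_eq {ι R : Type*} [Fintype ι] [DecidableEq ι] [CommRing R]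
    {f g f' g' : ι → R} {i j : ι} (hij : i ≠ j) (h : ∀ l, l ≠ i → l ≠ j → f l * g' l = f' l * g l)
    (h2 : (f i * f j) * (g' i * g' j) = (f' i * f' j) * (g i * g j)) :
    (∏ l, f l) * ∏ l, g' l = (∏ l, f' l) * ∏ l, g l := by
  rw [← Finset.prod_mul_distrib, ← Finset.prod_mul_distrib,
    ← Finset.mul_prod_erase _ _ (Finset.mem_univ i),
    ← Finset.mul_prod_erase _ _ (Finset.mem_univ i),
    ← Finset.mul_prod_erase _ _ (Finset.mem_erase.2 ⟨hij.symm, Finset.mem_univ j⟩),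
    ← Finset.mul_prod_erase _ _ (Finset.mem_erase.2 ⟨hij.symm, Finset.mem_univ j⟩),
    Finset.prod_congr rfl fun l hl => h l (Finset.ne_of_mem_erase (Finset.mem_of_mem_erase hl))
      (Finset.ne_of_mem_erase hl)]
  linear_combination (∏ l ∈ (Finset.univ.erase i).erase j, f' l * g l) * h2

/-- An even reflection permutes the factors of the generating function. -/
theorem eval_cmsSymbol_even (n m : ℕ) {k : ℂ} (hk : k ≠ 0) {i j : Fin (n + m)} (h : i ≠ j)
    (hp : parity n m i = parity n m j) (v : V n m) (r : ℕ) :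
    eval (affineReflection n m k (root n m i j) v) (cmsSymbol n m k r) =
      eval v (cmsSymbol n m k r) := by
  refine eval_cmsSymbol_eq n m hk ?_ r
  have hpar : ∀ l, parity n m (Equiv.swap i j l) = parity n m l := fun l => by
    rw [Equiv.swap_apply_def]
    split_ifs with h1 h2
    · rw [h1, hp]
    · rw [h2, hp]
    · rfl
  have hd : ∀ l, symbolDiag n m k (affineReflection n m k (root n m i j) v) l =
      symbolDiag n m k v (Equiv.swap i j l) := fun l => by
    rw [symbolDiag_eq n m hk, symbolDiag_eq n m hk, affineReflection_add_rho,
      reflection_even n m hk h hp, hpar, Function.comp_apply]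
  congr 1
  · refine Fintype.prod_equiv (Equiv.swap i j) _ _ fun l => ?_
    rw [hd, hpar]
  · refine (Fintype.prod_equiv (Equiv.swap i j) _ _ fun l => ?_).symm
    rw [hd]

/-- On the hyperplane `l_α^- = 0` the factors of the generating function with indices `i` and `j`
cancel in the same way before and after the translation by `α`. -/
theorem eval_cmsSymbol_add_root (n m : ℕ) {k : ℂ} (hk : k ≠ 0) {i j : Fin (n + m)}
    (h : i < j) (hp : parity n m i ≠ parity n m j) (v : V n m)
    (hv : form n m k (v + rho n m k) (root n m i j) = -((1 + k) / 2)) (r : ℕ) :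
    eval (v + root n m i j) (cmsSymbol n m k r) = eval v (cmsSymbol n m k r) := by
  obtain ⟨hi, hj⟩ := parity_of_lt h hp
  rw [form_root, hi, hj, pow_zero, pow_one, one_mul, Pi.add_apply, Pi.add_apply] at hv
  have hd : ∀ l, symbolDiag n m k (v + root n m i j) l =
      symbolDiag n m k v l + k ^ parity n m l * root n m i j l := fun l => by
    rw [symbolDiag, symbolDiag, Pi.add_apply]
    ring
  refine eval_cmsSymbol_eq n m hk (prod_mul_prod_eq h.ne (fun l h1 h2 => ?_) ?_) r
  · rw [hd]
    simp [root, h1, h2]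
  · have hri : root n m i j i = 1 := by simp [root, h.ne]
    have hrj : root n m i j j = -1 := by simp [root, h.ne']
    have hu : symbolDiag n m k v i = symbolDiag n m k v j - 1 := by
      rw [symbolDiag_eq n m hk, symbolDiag_eq n m hk, hi, hj, Pi.add_apply, Pi.add_apply]
      simp only [pow_zero, pow_one, Nat.sub_zero, Nat.sub_self]
      linear_combination hv
    rw [hd, hd, hi, hj, hri, hrj, hu]
    simp only [pow_zero, pow_one, Nat.sub_zero, Nat.sub_self, map_sub, map_add, map_mul, map_neg,
      map_one]
    ring

/-- A polynomial that vanishes on the zero set of `ℓ` is divisible by `ℓ`, if `ℓ` is linear in the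
variable `x_i` with coefficient one. -/
theorem dvd_of_forall_eval_eq_zero {σ : Type*} [DecidableEq σ] {i : σ} {ℓ f : MvPolynomial σ ℂ}
    (hℓ : ∀ v a, eval (Function.update v i (v i + a)) ℓ = eval v ℓ + a)
    (hf : ∀ v, eval v ℓ = 0 → eval v f = 0) : ℓ ∣ f := by
  set g : σ → MvPolynomial σ ℂ := fun l => if l = i then X i - ℓ else X l with hg
  have h := sub_aeval_mem (Ideal.span {ℓ}) g (fun l => by
    by_cases hl : l = i
    · rw [hg, hl]
      simp only [if_true, sub_sub_cancel]
      exact Ideal.mem_span_singleton_self _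
    · simp [hg, hl]) f
  have h0 : aeval g f = 0 := by
    refine MvPolynomial.funext fun v => ?_
    have e : (aeval v).comp (aeval g) =
        (aeval (Function.update v i (v i + -eval v ℓ)) : MvPolynomial σ ℂ →ₐ[ℂ] ℂ) := by
      refine MvPolynomial.algHom_ext fun l => ?_
      rw [AlgHom.comp_apply, aeval_X, aeval_X]
      by_cases hl : l = i
      · subst hl
        simp [hg, sub_eq_add_neg, MvPolynomial.aeval_eq_eval]
      · simp [hg, hl]
    have e' := AlgHom.congr_fun e f
    rw [AlgHom.comp_apply] at e'
    simp only [MvPolynomial.aeval_eq_eval] at e'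
    rw [map_zero, ← hf (Function.update v i (v i + -eval v ℓ)) (by rw [hℓ, add_neg_cancel])]
    exact e'
  rw [h0, sub_zero] at h
  exact Ideal.mem_span_singleton.1 h

theorem eval_lPlus (n m : ℕ) (k : ℂ) (α v : V n m) :
    eval v (lPlus n m k α) = form n m k (v + rho n m k) α - form n m k α α / 2 := by
  rw [lPlus, map_sub, eval_shiftedPairing, eval_C]

theorem eval_lMinus (n m : ℕ) (k : ℂ) (α v : V n m) :
    eval v (lMinus n m k α) = form n m k (v + rho n m k) α + form n m k α α / 2 := by
  rw [lMinus, map_add, eval_shiftedPairing, eval_C]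

theorem form_root_root_odd (n m : ℕ) (k : ℂ) {i j : Fin (n + m)} (h : i < j)
    (hp : parity n m i ≠ parity n m j) :
    form n m k (root n m i j) (root n m i j) = 1 + k := by
  obtain ⟨hi, hj⟩ := parity_of_lt h hp
  rw [form_root_root n m k h.ne, hi, hj, pow_zero, pow_one]

theorem form_root_update (n m : ℕ) (k : ℂ) {i j : Fin (n + m)} (h : i < j)
    (hp : parity n m i ≠ parity n m j) (v : V n m) (a : ℂ) :
    form n m k (Function.update v i (v i + a) + rho n m k) (root n m i j) =
      form n m k (v + rho n m k) (root n m i j) + a := by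
  obtain ⟨hi, hj⟩ := parity_of_lt h hp
  rw [form_root, form_root, hi, hj]
  simp only [Pi.add_apply, Function.update_self, Function.update_of_ne h.ne']
  ring

/-- On the hyperplane `(v + ρ, α) = e (α, α) / 2` the reflection is the translation by `-e α`. -/
theorem affineReflection_eq_sub (n m : ℕ) {k : ℂ} {α v : V n m} (hα : form n m k α α ≠ 0) (e : ℂ)
    (h : form n m k (v + rho n m k) α = e * (form n m k α α / 2)) :
    affineReflection n m k α v = v - e • α := by
  have : 2 * form n m k (v + rho n m k) α / form n m k α α = e := by
    rw [h]
    field_simp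
  rw [affineReflection, reflection, this]
  abel

/-- The vanishing of `f (s_α ∘ v) - f v` on the hyperplanes `l_α^± = 0` gives divisibility by each
of the coprime factors `l_α^-` and `l_α^+`. -/
theorem cmsSymbol_mem (n m : ℕ) {k : ℂ} (hk : k ≠ 0) (hk1 : 1 + k ≠ 0) (r : ℕ) :
    cmsSymbol n m k r ∈ shiftedQuasiInvariants n m k := by
  constructor
  · rintro _ ⟨i, j, h, hp, rfl⟩
    refine MvPolynomial.funext fun v => ?_
    rw [eval_affinePullback, eval_cmsSymbol_even n m hk h hp]
  · rintro _ ⟨i, j, h, hp, rfl⟩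
    have hα := form_root_root_odd n m k h hp
    rw [Ideal.mem_span_singleton]
    refine IsCoprime.mul_dvd ?_ ?_ ?_
    · refine ⟨C (1 + k)⁻¹, -C (1 + k)⁻¹, ?_⟩
      rw [lMinus, lPlus, hα]
      have : (C (1 + k)⁻¹ * (C ((1 + k) / 2) + C ((1 + k) / 2)) : SVdual n m) = 1 := by
        rw [← C_add, ← C_mul, add_halves, inv_mul_cancel₀ hk1, C_1]
      linear_combination this
    · refine dvd_of_forall_eval_eq_zero (i := i) (fun v a => ?_) fun v hv => ?_
      · rw [eval_lMinus, eval_lMinus, form_root_update n m k h hp]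
        ring
      · rw [eval_lMinus, hα] at hv
        have h1 : form n m k (v + rho n m k) (root n m i j) = -((1 + k) / 2) := by
          linear_combination hv
        rw [map_sub, eval_affinePullback, affineReflection_eq_sub n m (by rwa [hα]) (-1)
          (by rw [h1, hα]; ring), neg_one_smul, sub_neg_eq_add,
          eval_cmsSymbol_add_root n m hk h hp v h1, sub_self]
    · refine dvd_of_forall_eval_eq_zero (i := i) (fun v a => ?_) fun v hv => ?_
      · rw [eval_lPlus, eval_lPlus, form_root_update n m k h hp]
        ring
      · rw [eval_lPlus, hα] at hv
        have h1 : form n m k (v + rho n m k) (root n m i j) = (1 + k) / 2 := by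
          linear_combination hv
        have h2 := eval_cmsSymbol_add_root n m hk h hp (v - root n m i j) (by
          rw [form_root] at h1 hα ⊢
          simp only [Pi.add_apply, Pi.sub_apply] at h1 ⊢
          linear_combination h1 - hα) r
        rw [sub_add_cancel] at h2
        rw [map_sub, eval_affinePullback, affineReflection_eq_sub n m (by rwa [hα]) 1
          (by rw [h1, hα]; ring), one_smul, h2, sub_self]

/-! ### Leading terms along lines -/

/-- The restriction of a polynomial to the line `t ↦ t v + u`. -/
def lineMap {σ : Type*} (v u : σ → ℂ) : MvPolynomial σ ℂ →ₐ[ℂ] Polynomial ℂ :=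
  aeval fun i => Polynomial.C (v i) * Polynomial.X + Polynomial.C (u i)

theorem eval_lineMap {σ : Type*} (v u : σ → ℂ) (f : MvPolynomial σ ℂ) (t : ℂ) :
    (lineMap v u f).eval t = eval (fun i => t * v i + u i) f := by
  have e : ((Polynomial.aeval t).comp (lineMap v u) : MvPolynomial σ ℂ →ₐ[ℂ] ℂ) =
      aeval (fun i => t * v i + u i) := by
    refine MvPolynomial.algHom_ext fun i => ?_
    simp [lineMap]
    ring
  have := AlgHom.congr_fun e f
  rw [AlgHom.comp_apply, Polynomial.coe_aeval_eq_eval] at this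
  simpa only [MvPolynomial.aeval_eq_eval] using this

/-- The two highest coefficients of the restriction of a monomial to a line. -/
theorem lineMap_monomial {σ : Type*} [Fintype σ] (v u : σ → ℂ) (e : ℕ) (s : σ →₀ ℕ)
    (hs : s.degree = e) :
    (lineMap v u (monomial s 1)).natDegree ≤ e ∧
      (lineMap v u (monomial s 1)).coeff e = eval v (monomial s 1) ∧
      ∀ e', e' + 1 = e → (lineMap v u (monomial s 1)).coeff e' =
        ∑ l, u l * eval v (pderiv l (monomial s 1)) := by
  classical
  induction e generalizing s with
  | zero =>
    rw [Finsupp.degree_eq_zero_iff] at hs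
    subst hs
    have : lineMap v u (monomial 0 1) = 1 := map_one _
    rw [this]
    exact ⟨by simp, by simp, by simp⟩
  | succ e ih =>
    obtain ⟨i, hi⟩ : ∃ i, s i ≠ 0 := by
      by_contra! h
      have : s = 0 := Finsupp.ext h
      rw [this] at hs
      simp at hs
    obtain ⟨s', rfl⟩ : ∃ s', s = s' + Finsupp.single i 1 :=
      ⟨s - Finsupp.single i 1, (tsub_add_cancel_of_le (by
        rw [Finsupp.single_le_iff]
        exact Nat.one_le_iff_ne_zero.2 hi)).symm⟩
    rw [map_add, Finsupp.degree_single, Nat.add_right_cancel_iff] at hs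
    obtain ⟨h1, h2, h3⟩ := ih s' hs
    have hm : (monomial (s' + Finsupp.single i 1) 1 : MvPolynomial σ ℂ) = monomial s' 1 * X i := by
      rw [X, monomial_mul, mul_one]
    have hX : lineMap v u (X i) = Polynomial.C (v i) * Polynomial.X + Polynomial.C (u i) :=
      aeval_X _ _
    have hd : (Polynomial.C (v i) * Polynomial.X + Polynomial.C (u i)).natDegree ≤ 1 :=
      Polynomial.natDegree_linear_le
    rw [hm, map_mul, hX]
    refine ⟨Polynomial.natDegree_mul_le_of_le h1 hd, ?_, fun e' he' => ?_⟩
    · rw [Polynomial.coeff_mul_add_eq_of_natDegree_le h1 hd, h2, map_mul, eval_X]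
      simp
    · obtain rfl : e' = e := by omega
      have hp : ∀ l, u l * eval v (pderiv l (monomial s' 1 * X i)) =
          (u l * eval v (pderiv l (monomial s' 1))) * v i +
            if l = i then u l * eval v (monomial s' 1) else 0 := fun l => by
        rw [pderiv_mul, map_add, map_mul, map_mul, eval_X]
        by_cases hl : l = i
        · rw [if_pos hl, hl, pderiv_X_self, RingHom.map_one]
          ring
        · rw [if_neg hl, pderiv_X_of_ne (Ne.symm hl), RingHom.map_zero]
          ring
      simp only [hp]
      rw [Finset.sum_add_distrib, ← Finset.sum_mul, Finset.sum_ite_eq', if_pos (Finset.mem_univ _),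
        ← h2, mul_add, Polynomial.coeff_add, Polynomial.coeff_mul_C, mul_comm _ (u i)]
      congr 1
      rw [← mul_assoc, mul_comm _ (Polynomial.C (v i)), mul_assoc, Polynomial.coeff_C_mul,
        mul_comm]
      congr 1
      rcases e' with _ | e'
      · rw [Polynomial.coeff_mul_X_zero]
        rw [Finsupp.degree_eq_zero_iff] at hs
        subst hs
        simp
      · rw [Polynomial.coeff_mul_X, h3 e' rfl]

/-- The two highest coefficients of the restriction of a homogeneous polynomial to a line are its
value at the direction `v` and its derivative there along the base point `u`. -/
theorem lineMap_homogeneous {σ : Type*} [Fintype σ] (v u : σ → ℂ) {e : ℕ} {f : MvPolynomial σ ℂ}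
    (hf : f.IsHomogeneous e) :
    (lineMap v u f).natDegree ≤ e ∧ (lineMap v u f).coeff e = eval v f ∧
      ∀ e', e' + 1 = e → (lineMap v u f).coeff e' = ∑ l, u l * eval v (pderiv l f) := by
  have h : ∀ s ∈ f.support, monomial s (coeff s f) = coeff s f • monomial s (1 : ℂ) := fun s _ => by
    rw [smul_monomial, smul_eq_mul, mul_one]
  have hs : ∀ s ∈ f.support, s.degree = e := fun s hs => by
    rw [Finsupp.degree_eq_weight_one]
    exact hf (mem_support_iff.1 hs)
  rw [f.as_sum, Finset.sum_congr rfl h]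
  refine ⟨?_, ?_, fun e' he' => ?_⟩
  · rw [map_sum]
    refine Polynomial.natDegree_sum_le_of_forall_le _ _ fun s hs' => ?_
    rw [map_smul]
    exact (Polynomial.natDegree_smul_le _ _).trans (lineMap_monomial v u e s (hs s hs')).1
  · rw [map_sum, map_sum, Polynomial.finsetSum_coeff]
    refine Finset.sum_congr rfl fun s hs' => ?_
    rw [map_smul, Polynomial.coeff_smul, (lineMap_monomial v u e s (hs s hs')).2.1, smul_eval,
      smul_eq_mul]
  · rw [map_sum, Polynomial.finsetSum_coeff]
    simp only [map_sum, Finset.mul_sum]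
    rw [Finset.sum_comm]
    refine Finset.sum_congr rfl fun s hs' => ?_
    rw [map_smul, Polynomial.coeff_smul, (lineMap_monomial v u e s (hs s hs')).2.2 e' he',
      smul_eq_mul, Finset.mul_sum]
    refine Finset.sum_congr rfl fun l _ => ?_
    rw [Derivation.map_smul, smul_eval]
    ring

theorem sum_homogeneousComponent_of_le {σ : Type*} {d : ℕ} {f : MvPolynomial σ ℂ}
    (h : f.totalDegree ≤ d) : ∑ e ∈ Finset.range (d + 1), homogeneousComponent e f = f := by
  conv_rhs => rw [← sum_homogeneousComponent f]
  refine (Finset.sum_subset (Finset.range_mono (by omega)) fun e _ he => ?_).symm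
  refine homogeneousComponent_eq_zero _ _ ?_
  simp at he
  omega

theorem natDegree_lineMap_le {σ : Type*} [Fintype σ] (v u : σ → ℂ) {d : ℕ} {f : MvPolynomial σ ℂ}
    (hf : f.totalDegree ≤ d) : (lineMap v u f).natDegree ≤ d := by
  rw [← sum_homogeneousComponent_of_le hf, map_sum]
  refine Polynomial.natDegree_sum_le_of_forall_le _ _ fun e he => ?_
  have := (lineMap_homogeneous v u (homogeneousComponent_isHomogeneous e f)).1
  have := Finset.mem_range.1 he
  omega

theorem coeff_lineMap_top {σ : Type*} [Fintype σ] (v u : σ → ℂ) {d : ℕ} {f : MvPolynomial σ ℂ}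
    (hf : f.totalDegree ≤ d) : (lineMap v u f).coeff d = eval v (homogeneousComponent d f) := by
  conv_lhs => rw [← sum_homogeneousComponent_of_le hf]
  rw [map_sum, Polynomial.finsetSum_coeff, Finset.sum_range_succ, Finset.sum_eq_zero, zero_add,
    (lineMap_homogeneous v u (homogeneousComponent_isHomogeneous d f)).2.1]
  intro e he
  refine Polynomial.coeff_eq_zero_of_natDegree_lt ?_
  have := (lineMap_homogeneous v u (homogeneousComponent_isHomogeneous e f)).1
  have := Finset.mem_range.1 he
  omega

theorem coeff_lineMap_subtop {σ : Type*} [Fintype σ] (v u : σ → ℂ) {d : ℕ} {f : MvPolynomial σ ℂ}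
    (hf : f.totalDegree ≤ d + 1) : (lineMap v u f).coeff d =
      eval v (homogeneousComponent d f) +
        ∑ l, u l * eval v (pderiv l (homogeneousComponent (d + 1) f)) := by
  conv_lhs => rw [← sum_homogeneousComponent_of_le hf]
  rw [map_sum, Polynomial.finsetSum_coeff, Finset.sum_range_succ, Finset.sum_range_succ,
    Finset.sum_eq_zero, zero_add,
    (lineMap_homogeneous v u (homogeneousComponent_isHomogeneous d f)).2.1,
    (lineMap_homogeneous v u (homogeneousComponent_isHomogeneous (d + 1) f)).2.2 d rfl]
  intro e he
  refine Polynomial.coeff_eq_zero_of_natDegree_lt ?_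
  have := (lineMap_homogeneous v u (homogeneousComponent_isHomogeneous e f)).1
  have := Finset.mem_range.1 he
  omega

theorem totalDegree_le_of_lineMap {σ : Type*} [Fintype σ] {d : ℕ} {f : MvPolynomial σ ℂ}
    (h : ∀ v, (lineMap v 0 f).natDegree ≤ d) : f.totalDegree ≤ d := by
  by_contra! hd
  have h0 : homogeneousComponent f.totalDegree f = 0 := by
    refine MvPolynomial.funext fun v => ?_
    rw [← coeff_lineMap_top v 0 le_rfl, map_zero]
    exact Polynomial.coeff_eq_zero_of_natDegree_lt ((h v).trans_lt hd)
  have h1 := sum_homogeneousComponent f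
  rw [Finset.sum_range_succ, h0, add_zero] at h1
  have h2 : f.totalDegree ≤ f.totalDegree - 1 := by
    conv_lhs => rw [← h1]
    refine totalDegree_finsetSum_le fun e he => ?_
    have := (homogeneousComponent_isHomogeneous e f).totalDegree_le
    have := Finset.mem_range.1 he
    omega
  omega

/-! ### The leading term of a shifted quasi-invariant -/

/-- The leading term of a polynomial that is invariant under the affine action of the even
reflections is invariant under the linear action. -/
theorem eval_top_swap {n m : ℕ} {k : ℂ} (hk : k ≠ 0) {f : SVdual n m}
    (hf : f ∈ shiftedQuasiInvariants n m k) {d : ℕ} (hd : f.totalDegree ≤ d) {i j : Fin (n + m)}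
    (hp : parity n m i = parity n m j) (w : V n m) :
    eval (w ∘ Equiv.swap i j) (homogeneousComponent d f) =
      eval w (homogeneousComponent d f) := by
  rcases eq_or_ne i j with rfl | h
  · simp
  rw [← coeff_lineMap_top w 0 hd,
    ← coeff_lineMap_top (w ∘ Equiv.swap i j) (rho n m k ∘ Equiv.swap i j - rho n m k) hd]
  have h0 : affinePullback n m k (root n m i j) f = f := hf.1 _ ⟨i, j, h, hp, rfl⟩
  have e : lineMap (w ∘ Equiv.swap i j) (rho n m k ∘ Equiv.swap i j - rho n m k) f =
      lineMap w 0 f := by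
    refine Polynomial.funext fun t => ?_
    rw [eval_lineMap, eval_lineMap]
    conv_rhs => rw [← h0, eval_affinePullback]
    refine congrArg (fun v => eval v f) ?_
    rw [affineReflection, reflection_even n m hk h hp]
    funext l
    simp only [Function.comp_apply, Pi.sub_apply, Pi.add_apply, Pi.zero_apply]
    ring
  rw [e]

/-- The leading term of a shifted quasi-invariant has equal derivatives in the directions `ε_i` and
`ε_j` on the hyperplane orthogonal to an odd root `ε_i - ε_j`. -/
theorem eval_pderiv_top {n m : ℕ} {k : ℂ} (hk1 : 1 + k ≠ 0) {f : SVdual n m}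
    (hf : f ∈ shiftedQuasiInvariants n m k) {d : ℕ} (hd : f.totalDegree ≤ d) {i j : Fin (n + m)}
    (h : i < j) (hp : parity n m i ≠ parity n m j) (w : V n m)
    (hw : form n m k w (root n m i j) = 0) :
    eval w (pderiv i (homogeneousComponent d f)) =
      eval w (pderiv j (homogeneousComponent d f)) := by
  rcases d with _ | d
  · rw [homogeneousComponent_zero, pderiv_C, pderiv_C]
  set α := root n m i j with hα
  have hαα : form n m k α α = 1 + k := form_root_root_odd n m k h hp
  -- a line on which `l_α^+` vanishes, so that the reflection is the translation by `-α`
  set u : V n m := (1 / 2 : ℂ) • α - rho n m k with hu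
  have h1 : lineMap w (u - α) f = lineMap w u f := by
    refine Polynomial.funext fun t => ?_
    rw [eval_lineMap, eval_lineMap]
    have hform : form n m k ((fun l => t * w l + u l) + rho n m k) α = 1 * ((1 + k) / 2) := by
      rw [hα, form_root] at hw hαα ⊢
      simp only [Pi.add_apply, hu, Pi.sub_apply, Pi.smul_apply, smul_eq_mul]
      linear_combination t * hw + (1 / 2) * hαα
    obtain ⟨q, hq⟩ := Ideal.mem_span_singleton.1 (hf.2 α ⟨i, j, h, hp, rfl⟩)
    have h2 := congrArg (eval fun l => t * w l + u l) hq
    rw [map_mul, map_mul, eval_lPlus, hform, hαα, one_mul, sub_self, mul_zero, zero_mul, map_sub,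
      eval_affinePullback, affineReflection_eq_sub n m (by rwa [hαα]) 1 (by rw [hform, hαα]),
      one_smul, sub_eq_zero] at h2
    rw [← h2]
    congr 2
    funext l
    simp [add_sub_assoc]
  have h2 := congrArg (Polynomial.coeff · d) h1
  simp only [coeff_lineMap_subtop w _ hd, add_right_inj] at h2
  have h3 : ∑ l, α l * eval w (pderiv l (homogeneousComponent (d + 1) f)) = 0 := by
    rw [← sub_eq_zero.2 h2.symm, ← Finset.sum_sub_distrib]
    refine Finset.sum_congr rfl fun l _ => ?_
    rw [Pi.sub_apply]
    ring
  simp only [hα, root, Pi.sub_apply, sub_mul, Finset.sum_sub_distrib, Pi.single_apply, ite_mul,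
    one_mul, zero_mul, Finset.sum_ite_eq', Finset.mem_univ, if_true] at h3
  exact sub_eq_zero.1 h3

/-- The coordinates on `V` in terms of `a_i = ε_i^*` and `b_j = k ε_{n+j}^*`. -/
def unscale (n m : ℕ) (k : ℂ) (v : Fin n ⊕ Fin m → ℂ) : V n m := fun i =>
  Sum.elim (fun a => v (Sum.inl a)) (fun b => k⁻¹ * v (Sum.inr b)) (finSumFinEquiv.symm i)

/-- The change of coordinates `a_i = ε_i^*`, `b_j = k ε_{n+j}^*`. -/
def toBlocks (n m : ℕ) (k : ℂ) : SVdual n m →ₐ[ℂ] MvPolynomial (Fin n ⊕ Fin m) ℂ :=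
  aeval fun i => Sum.elim (fun a => X (Sum.inl a)) (fun b => C k⁻¹ * X (Sum.inr b))
    (finSumFinEquiv.symm i)

theorem eval_toBlocks (n m : ℕ) (k : ℂ) (v : Fin n ⊕ Fin m → ℂ) (f : SVdual n m) :
    eval v (toBlocks n m k f) = eval (unscale n m k v) f := by
  have e : ((aeval v).comp (toBlocks n m k) : SVdual n m →ₐ[ℂ] ℂ) = aeval (unscale n m k v) := by
    refine MvPolynomial.algHom_ext fun i => ?_
    rw [AlgHom.comp_apply, toBlocks, aeval_X, aeval_X, unscale]
    rcases finSumFinEquiv.symm i with a | b <;> simp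
  have := AlgHom.congr_fun e f
  rw [AlgHom.comp_apply] at this
  simpa only [MvPolynomial.aeval_eq_eval] using this

@[simp] theorem toBlocks_castAdd (n m : ℕ) (k : ℂ) (a : Fin n) :
    toBlocks n m k (X (Fin.castAdd m a)) = X (Sum.inl a) := by
  simp [toBlocks]

@[simp] theorem toBlocks_natAdd (n m : ℕ) (k : ℂ) (b : Fin m) :
    toBlocks n m k (X (Fin.natAdd n b)) = C k⁻¹ * X (Sum.inr b) := by
  simp [toBlocks]

theorem pderiv_toBlocks_inl (n m : ℕ) (k : ℂ) (a : Fin n) (f : SVdual n m) :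
    pderiv (Sum.inl a) (toBlocks n m k f) = toBlocks n m k (pderiv (Fin.castAdd m a) f) := by
  classical
  induction f using MvPolynomial.induction_on with
  | C a => simp [toBlocks, MvPolynomial.algebraMap_eq]
  | add p q hp hq => simp only [map_add, hp, hq]
  | mul_X p l hp =>
    rw [map_mul (toBlocks n m k) p, pderiv_mul, pderiv_mul, map_add,
      map_mul (toBlocks n m k), map_mul (toBlocks n m k), hp]
    congr 2
    refine Fin.addCases (fun l => ?_) (fun l => ?_) l
    · by_cases h : l = a
      · subst h
        simp
      · rw [toBlocks_castAdd, pderiv_X_of_ne (by simpa using h),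
          pderiv_X_of_ne (by simpa using h), map_zero]
    · rw [toBlocks_natAdd, pderiv_C_mul, pderiv_X_of_ne (by simp), pderiv_X_of_ne
        (by simp [Fin.ext_iff]; omega), mul_zero, map_zero]

theorem pderiv_toBlocks_inr (n m : ℕ) (k : ℂ) (b : Fin m) (f : SVdual n m) :
    pderiv (Sum.inr b) (toBlocks n m k f) =
      C k⁻¹ * toBlocks n m k (pderiv (Fin.natAdd n b) f) := by
  classical
  induction f using MvPolynomial.induction_on with
  | C a => simp [toBlocks, MvPolynomial.algebraMap_eq]
  | add p q hp hq => simp only [map_add, hp, hq, mul_add]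
  | mul_X p l hp =>
    rw [map_mul (toBlocks n m k) p, pderiv_mul, pderiv_mul, map_add,
      map_mul (toBlocks n m k), map_mul (toBlocks n m k), hp, mul_add, mul_assoc]
    congr 1
    rw [mul_left_comm]
    congr 1
    refine Fin.addCases (fun l => ?_) (fun l => ?_) l
    · rw [toBlocks_castAdd, pderiv_X_of_ne (by simp), pderiv_X_of_ne
        (by simp [Fin.ext_iff]; omega), map_zero, mul_zero]
    · by_cases h : l = b
      · subst h
        simp
      · rw [toBlocks_natAdd, pderiv_C_mul, pderiv_X_of_ne (by simpa using h),
          pderiv_X_of_ne (by simpa using h), map_zero]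

theorem unscale_swap_inl (n m : ℕ) (k : ℂ) (i j : Fin n) (v : Fin n ⊕ Fin m → ℂ) :
    unscale n m k (v ∘ Equiv.swap (Sum.inl i) (Sum.inl j)) =
      unscale n m k v ∘ Equiv.swap (Fin.castAdd m i) (Fin.castAdd m j) := by
  funext l
  refine Fin.addCases (fun l => ?_) (fun l => ?_) l
  · simp only [unscale, Function.comp_apply, finSumFinEquiv_symm_apply_castAdd, Sum.elim_inl,
      Equiv.swap_apply_def, Sum.inl.injEq, Fin.castAdd_inj]
    split_ifs <;> simp
  · rw [Function.comp_apply, Equiv.swap_apply_of_ne_of_ne] <;>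
    simp [unscale, Fin.ext_iff, Equiv.swap_apply_of_ne_of_ne] <;> omega

theorem unscale_swap_inr (n m : ℕ) (k : ℂ) (i j : Fin m) (v : Fin n ⊕ Fin m → ℂ) :
    unscale n m k (v ∘ Equiv.swap (Sum.inr i) (Sum.inr j)) =
      unscale n m k v ∘ Equiv.swap (Fin.natAdd n i) (Fin.natAdd n j) := by
  funext l
  refine Fin.addCases (fun l => ?_) (fun l => ?_) l
  · rw [Function.comp_apply, Equiv.swap_apply_of_ne_of_ne] <;>
    simp [unscale, Fin.ext_iff, Equiv.swap_apply_of_ne_of_ne] <;> omega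
  · simp only [unscale, Function.comp_apply, finSumFinEquiv_symm_apply_natAdd, Sum.elim_inr,
      Equiv.swap_apply_def, Sum.inr.injEq, Fin.natAdd_inj]
    split_ifs <;> simp

/-- The leading term of a shifted quasi-invariant is a deformed quasi-invariant. -/
theorem toBlocks_top_mem {n m : ℕ} {k : ℂ} (hk : k ≠ 0) (hk1 : 1 + k ≠ 0) {f : SVdual n m}
    (hf : f ∈ shiftedQuasiInvariants n m k) {d : ℕ} (hd : f.totalDegree ≤ d) :
    toBlocks n m k (homogeneousComponent d f) ∈ twisted k 0 n m d := by
  refine ⟨?_, ⟨fun i j => ?_, fun i j => ?_, fun i j => ?_⟩⟩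
  · have := (homogeneousComponent_isHomogeneous d f).aeval (R := ℂ) (n := 1)
      (fun i => Sum.elim (fun a => X (Sum.inl a)) (fun b => C k⁻¹ * X (Sum.inr b))
        (finSumFinEquiv.symm i) : Fin (n + m) → MvPolynomial (Fin n ⊕ Fin m) ℂ) (fun i => by
        rcases finSumFinEquiv.symm i with a | b
        · exact isHomogeneous_X _ _
        · exact isHomogeneous_C_mul_X _ _)
    rwa [one_mul] at this
  · refine MvPolynomial.funext fun v => ?_
    rw [eval_rename, eval_toBlocks, eval_toBlocks, unscale_swap_inl]
    exact eval_top_swap hk hf hd (by rw [parity_castAdd, parity_castAdd]) _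
  · refine MvPolynomial.funext fun v => ?_
    rw [eval_rename, eval_toBlocks, eval_toBlocks, unscale_swap_inr]
    exact eval_top_swap hk hf hd (by rw [parity_natAdd, parity_natAdd]) _
  · refine MvPolynomial.funext fun v => ?_
    have e : ((aeval v).comp (identify (Sum.inl i) (Sum.inr j)) :
        MvPolynomial (Fin n ⊕ Fin m) ℂ →ₐ[ℂ] ℂ) =
        aeval (Function.update v (Sum.inl i) (v (Sum.inr j))) := by
      refine MvPolynomial.algHom_ext fun l => ?_
      rw [AlgHom.comp_apply, identify, aeval_X, aeval_X, Function.update_apply]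
      split_ifs <;> simp
    set v' := Function.update v (Sum.inl i) (v (Sum.inr j)) with hv'
    have h1 := AlgHom.congr_fun e (X (Sum.inl i) * (pderiv (Sum.inl i)
      (toBlocks n m k (homogeneousComponent d f)) - C k * pderiv (Sum.inr j)
      (toBlocks n m k (homogeneousComponent d f))) + C 0 *
      toBlocks n m k (homogeneousComponent d f))
    rw [AlgHom.comp_apply] at h1
    simp only [MvPolynomial.aeval_eq_eval] at h1
    refine h1.trans ?_
    have h2 := eval_pderiv_top hk1 hf hd (i := Fin.castAdd m i) (j := Fin.natAdd n j)
      (by rw [Fin.lt_def]; simp; omega) (by rw [parity_castAdd, parity_natAdd]; simp)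
      (unscale n m k v') (by
        rw [form_root, parity_castAdd, parity_natAdd]
        simp [unscale, hv', hk])
    rw [pderiv_toBlocks_inl, pderiv_toBlocks_inr, ← mul_assoc (C k), ← C_mul, mul_inv_cancel₀ hk,
      C_1, one_mul, C_0, zero_mul, add_zero]
    simp only [map_mul, map_sub, map_zero]
    rw [eval_toBlocks, eval_toBlocks, h2, sub_self, mul_zero]

/-! ### The shifted quasi-invariants are generated by the symbols of the integrals -/

/-- The polynomial `p` has degree at most `d`, and `c` is its coefficient of degree `d`. -/
def HasTop (p : Polynomial ℂ) (d : ℕ) (c : ℂ) : Prop := p.natDegree ≤ d ∧ p.coeff d = c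

theorem HasTop.mul {p q : Polynomial ℂ} {d e : ℕ} {a b : ℂ} (hp : HasTop p d a)
    (hq : HasTop q e b) : HasTop (p * q) (d + e) (a * b) :=
  ⟨Polynomial.natDegree_mul_le.trans (add_le_add hp.1 hq.1), by
    rw [Polynomial.coeff_mul_add_eq_of_natDegree_le hp.1 hq.1, hp.2, hq.2]⟩

theorem HasTop.sum {ι : Type*} (s : Finset ι) {p : ι → Polynomial ℂ} {d : ℕ} {c : ι → ℂ}
    (h : ∀ i ∈ s, HasTop (p i) d (c i)) : HasTop (∑ i ∈ s, p i) d (∑ i ∈ s, c i) :=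
  ⟨Polynomial.natDegree_sum_le_of_forall_le _ _ fun i hi => (h i hi).1, by
    rw [Polynomial.finsetSum_coeff]
    exact Finset.sum_congr rfl fun i hi => (h i hi).2⟩

theorem HasTop.sub {p q : Polynomial ℂ} {d : ℕ} {a b : ℂ} (hp : HasTop p d a)
    (hq : HasTop q d b) : HasTop (p - q) d (a - b) :=
  ⟨(Polynomial.natDegree_sub_le _ _).trans (max_le hp.1 hq.1), by
    rw [Polynomial.coeff_sub, hp.2, hq.2]⟩

theorem hasTop_C (c : ℂ) : HasTop (Polynomial.C c) 0 c :=
  ⟨(Polynomial.natDegree_C c).le, Polynomial.coeff_C_zero⟩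

theorem hasTop_C_one (c : ℂ) : HasTop (Polynomial.C c) 1 0 :=
  ⟨(Polynomial.natDegree_C c).le.trans zero_le_one, Polynomial.coeff_C_of_ne_zero one_ne_zero⟩

theorem HasTop.pow {p : Polynomial ℂ} {d : ℕ} {a : ℂ} (hp : HasTop p d a) (r : ℕ) :
    HasTop (p ^ r) (r * d) (a ^ r) := by
  induction r with
  | zero => simpa using hasTop_C 1
  | succ r ih =>
    rw [pow_succ, pow_succ, Nat.succ_mul]
    exact ih.mul hp

theorem HasTop.prod {ι : Type*} (s : Finset ι) {p : ι → Polynomial ℂ} {d : ι → ℕ} {c : ι → ℂ}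
    (h : ∀ i ∈ s, HasTop (p i) (d i) (c i)) :
    HasTop (∏ i ∈ s, p i) (∑ i ∈ s, d i) (∏ i ∈ s, c i) := by
  classical
  induction s using Finset.induction_on with
  | empty => simpa using hasTop_C 1
  | insert i s hi ih =>
    rw [Finset.prod_insert hi, Finset.prod_insert hi, Finset.sum_insert hi]
    exact (h i (Finset.mem_insert_self i s)).mul
      (ih fun j hj => h j (Finset.mem_insert_of_mem hj))

/-- The leading term of the symbol of the Moser matrix is diagonal. -/
theorem hasTop_symbolMatrix (n m : ℕ) (k : ℂ) (v : V n m) (i j : Fin (n + m)) :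
    HasTop (lineMap v 0 (symbolMatrix n m k i j)) 1
      (if i = j then k ^ parity n m i * v i else 0) := by
  rw [symbolMatrix, Matrix.of_apply]
  have hC : ∀ c : ℂ, HasTop (lineMap v 0 (C c)) 1 0 := fun c => by
    rw [lineMap, aeval_C]
    exact hasTop_C_one c
  split_ifs with h h'
  · rw [map_sub, map_sum, ← sub_zero (k ^ parity n m i * v i)]
    refine HasTop.sub ?_ ?_
    · rw [map_mul, lineMap, aeval_C, aeval_X]
      refine (zero_add 1).symm ▸ (hasTop_C _).mul ⟨Polynomial.natDegree_linear_le, ?_⟩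
      simp
    · simpa using HasTop.sum (Finset.univ.filter (i < ·)) fun l _ => hC (k ^ (1 - parity n m l))
  · exact hC _
  · simpa using hC 0

theorem hasTop_symbolMatrix_pow (n m : ℕ) (k : ℂ) (v : V n m) (r : ℕ) (i j : Fin (n + m)) :
    HasTop (lineMap v 0 ((symbolMatrix n m k ^ r) i j)) r
      (if i = j then (k ^ parity n m i * v i) ^ r else 0) := by
  induction r generalizing j with
  | zero =>
    rw [pow_zero, Matrix.one_apply]
    split_ifs
    · simpa using hasTop_C 1
    · simpa using hasTop_C 0
  | succ r ih =>
    rw [pow_succ, Matrix.mul_apply, map_sum]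
    have h := HasTop.sum Finset.univ fun l _ =>
      (ih l).mul (hasTop_symbolMatrix n m k v l j)
    simp only [← map_mul] at h
    convert h using 1
    rw [Finset.sum_eq_single i]
    · by_cases hij : i = j <;> simp [hij, pow_succ]
    · intro l _ hl
      rw [if_neg (Ne.symm hl), zero_mul]
    · simp

theorem hasTop_cmsSymbol (n m : ℕ) (k : ℂ) (v : V n m) (r : ℕ) :
    HasTop (lineMap v 0 (cmsSymbol n m k r)) r
      (∑ i, (k ^ parity n m i)⁻¹ * (k ^ parity n m i * v i) ^ r) := by
  rw [cmsSymbol, map_sum]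
  refine HasTop.sum _ fun i _ => ?_
  rw [map_sum]
  have h := HasTop.sum Finset.univ fun j _ =>
    (hasTop_C (k ^ parity n m i)⁻¹).mul (hasTop_symbolMatrix_pow n m k v r i j)
  simp only [zero_add, mul_ite, mul_zero, Finset.sum_ite_eq, Finset.mem_univ, if_true] at h
  convert h using 3 with j
  rw [map_mul, lineMap, aeval_C]
  rfl

/-- The leading term of `φ (ℒ_r)` is a deformed power sum in the coordinates `toBlocks`, hence that
of a polynomial in the `φ (ℒ_r)` is the same polynomial in the deformed power sums. -/
theorem hasTop_aeval_cmsSymbol (n m : ℕ) (k : ℂ) (v : Fin n ⊕ Fin m → ℂ) {d : ℕ}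
    {F : MvPolynomial ℕ ℂ} (hF : F ∈ PowerPart d) (hk : k ≠ 0) :
    HasTop (lineMap (unscale n m k v) 0 (aeval (fun t => cmsSymbol n m k (t + 1)) F)) d
      (eval v (powerSumMap (powerCoeff k n m) F)) := by
  have hc : ∀ t, HasTop (lineMap (unscale n m k v) 0 (cmsSymbol n m k (t + 1))) (t + 1)
      (eval v (powerSumMap (powerCoeff k n m) (X t))) := by
    intro t
    convert hasTop_cmsSymbol n m k (unscale n m k v) (t + 1) using 1
    rw [powerSumMap_X, map_sum, Fintype.sum_sum_type, Fin.sum_univ_add]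
    simp [parity_castAdd, parity_natAdd, powerCoeff, unscale, hk]
  rw [F.as_sum]
  simp only [map_sum]
  refine HasTop.sum _ fun s hs => ?_
  rw [← mul_one (coeff s F), ← C_mul_monomial, map_mul, map_mul, map_mul, map_mul, ← zero_add d]
  refine HasTop.mul ?_ ?_
  · rw [aeval_C, MvPolynomial.algebraMap_eq, lineMap, aeval_C, powerSumMap, aeval_C,
      MvPolynomial.algebraMap_eq, eval_C]
    exact hasTop_C _
  · rw [← hF (mem_support_iff.1 hs), monomial_eq, C_1, one_mul, Finsupp.weight_apply]
    simp only [Finsupp.prod, Finsupp.sum, map_prod, map_pow, aeval_X, smul_eq_mul]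
    exact HasTop.prod _ fun t _ => (hc t).pow (s t)

/-- Subtracting a polynomial in the symbols `φ(ℒ_r)` removes the leading term of a shifted
quasi-invariant, since that term is a polynomial in the deformed power sums. -/
theorem shiftedQuasiInvariants_le_adjoin (n m : ℕ) {k : ℂ} (hk : ∀ q : ℚ, k ≠ q) :
    shiftedQuasiInvariants n m k ≤
      Algebra.adjoin ℂ {P | ∃ r, 1 ≤ r ∧ P = cmsSymbol n m k r} := by
  have hk0 : k ≠ 0 := by simpa using hk 0
  have hk1 : 1 + k ≠ 0 := fun h => hk (-1) (by push_cast; linear_combination h)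
  have main : ∀ d : ℕ, ∀ f ∈ shiftedQuasiInvariants n m k, (∀ v, (lineMap v 0 f).degree < d) →
      f ∈ Algebra.adjoin ℂ {P | ∃ r, 1 ≤ r ∧ P = cmsSymbol n m k r} := by
    intro d
    induction d with
    | zero =>
      intro f _ hf
      have : f = 0 := by
        refine MvPolynomial.funext fun v => ?_
        have h1 := congrArg (Polynomial.eval 1) (by simpa using hf v : lineMap v 0 f = 0)
        rw [eval_lineMap] at h1
        simpa using h1
      rw [this]
      exact zero_mem _
    | succ d ih =>
      intro f hf hd
      have hd' : f.totalDegree ≤ d := totalDegree_le_of_lineMap fun v => by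
        rcases eq_or_ne (lineMap v 0 f) 0 with h | h
        · simp [h]
        · exact Nat.lt_succ_iff.1 ((Polynomial.natDegree_lt_iff_degree_lt h).2 (hd v))
      have h1 := toBlocks_top_mem hk0 hk1 hf hd'
      rw [← powerSpan_eq hk] at h1
      obtain ⟨F, hF, hF'⟩ := h1
      set G := aeval (fun t => cmsSymbol n m k (t + 1)) F with hG
      have hGa : G ∈ Algebra.adjoin ℂ {P | ∃ r, 1 ≤ r ∧ P = cmsSymbol n m k r} := by
        have h2 : G ∈ (aeval (R := ℂ) fun t => cmsSymbol n m k (t + 1)).range := ⟨F, rfl⟩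
        rw [← Algebra.adjoin_range_eq_range_aeval] at h2
        refine Algebra.adjoin_mono ?_ h2
        rintro _ ⟨t, rfl⟩
        exact ⟨t + 1, by omega, rfl⟩
      have hGs : G ∈ shiftedQuasiInvariants n m k := by
        refine (Algebra.adjoin_le ?_ : _ ≤ shiftedQuasiInvariants n m k) hGa
        rintro _ ⟨r, -, rfl⟩
        exact cmsSymbol_mem n m hk0 hk1 r
      rw [← sub_add_cancel f G]
      refine add_mem (ih (f - G) (sub_mem hf hGs) fun v => ?_) hGa
      obtain ⟨w, rfl⟩ : ∃ w, unscale n m k w = v := by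
        refine ⟨Sum.elim (fun a => v (Fin.castAdd m a)) (fun b => k * v (Fin.natAdd n b)), ?_⟩
        funext i
        refine Fin.addCases (fun a => ?_) (fun b => ?_) i <;> simp [unscale, hk0]
      have h2 : HasTop (lineMap (unscale n m k w) 0 f) d
          (eval (unscale n m k w) (homogeneousComponent d f)) :=
        ⟨natDegree_lineMap_le _ _ hd', coeff_lineMap_top _ _ hd'⟩
      have h3 := h2.sub (hasTop_aeval_cmsSymbol n m k w hF hk0)
      rw [← hG, ← map_sub, ← eval_toBlocks, ← hF'] at h3
      have h4 : (lineMap (unscale n m k w) 0 (f - G)).coeff d = 0 := h3.2.trans (sub_self _)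
      rw [Polynomial.degree_lt_iff_coeff_zero]
      intro e he
      rcases he.eq_or_lt with rfl | he
      · exact h4
      · exact Polynomial.coeff_eq_zero_of_natDegree_lt (h3.1.trans_lt he)
  intro f hf
  refine main (f.totalDegree + 1) f hf fun v => ?_
  refine Polynomial.degree_le_natDegree.trans_lt ?_
  exact_mod_cast Nat.lt_succ_of_le (natDegree_lineMap_le v 0 le_rfl)

theorem adjoin_cmsSymbol (n m : ℕ) {k : ℂ} (hk : ∀ q : ℚ, k ≠ q) :
    Algebra.adjoin ℂ {P | ∃ r, 1 ≤ r ∧ P = cmsSymbol n m k r} = shiftedQuasiInvariants n m k := by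
  refine le_antisymm (Algebra.adjoin_le ?_) (shiftedQuasiInvariants_le_adjoin n m hk)
  rintro _ ⟨r, -, rfl⟩
  refine cmsSymbol_mem n m ?_ ?_ r
  · simpa using hk 0
  · exact fun h => hk (-1) (by push_cast; linear_combination h)

/-! ### The integrals as operators on abstract power sums -/

/-- The operators `T j s` on polynomials in abstract power sums `X t`, of which the matrix `T` is
the form taken by the quantum Moser matrix in the basis `x_i ^ (s + 1)`; the scalar `q` stands for
the deformed power sum of degree zero. -/
def universalEntry (k q : ℂ) (j s : ℕ) : Module.End ℂ (MvPolynomial ℕ ℂ) :=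
  if s < j then ((j - s : ℕ) : ℂ) • (pderiv (j - s - 1)).toLinearMap
  else if j < s then (-k) • LinearMap.mulLeft ℂ (X (s - j - 1))
  else ((1 + k) * (j + 1) - k * q) • 1

/-- The operator with matrix `universalEntry`, on vectors of length `M`. -/
def universalMoser (k q : ℂ) (M : ℕ) : Module.End ℂ (Fin M → MvPolynomial ℕ ℂ) :=
  LinearMap.pi fun j => ∑ s : Fin M, universalEntry k q j s ∘ₗ LinearMap.proj s

/-- The vector of the `(s + 1) ∂ F / ∂ X s`. -/
def powerGrad (M : ℕ) : MvPolynomial ℕ ℂ →ₗ[ℂ] (Fin M → MvPolynomial ℕ ℂ) :=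
  LinearMap.pi fun s => ((s : ℂ) + 1) • (pderiv (s : ℕ)).toLinearMap

/-- The contraction `G ↦ ∑ s, X s * G s`. -/
def powerContract (M : ℕ) : (Fin M → MvPolynomial ℕ ℂ) →ₗ[ℂ] MvPolynomial ℕ ℂ :=
  ∑ s : Fin M, LinearMap.mulLeft ℂ (X (s : ℕ)) ∘ₗ LinearMap.proj s

/-- The operator on abstract power sums that induces the integral `ℒ_{r+1}`. -/
def universalIntegral (k q : ℂ) (M r : ℕ) : Module.End ℂ (MvPolynomial ℕ ℂ) :=
  powerContract M ∘ₗ (universalMoser k q M ^ r) ∘ₗ powerGrad M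

theorem universalMoser_apply (k q : ℂ) (M : ℕ) (G : Fin M → MvPolynomial ℕ ℂ) (j : Fin M) :
    universalMoser k q M G j = ∑ s : Fin M, universalEntry k q j s (G s) := by
  simp [universalMoser]

theorem powerGrad_apply (M : ℕ) (F : MvPolynomial ℕ ℂ) (s : Fin M) :
    powerGrad M F s = ((s : ℂ) + 1) • pderiv (s : ℕ) F := rfl

theorem powerContract_apply (M : ℕ) (G : Fin M → MvPolynomial ℕ ℂ) :
    powerContract M G = ∑ s : Fin M, X (s : ℕ) * G s := by
  simp [powerContract]

/-- A change of `q` adds a scalar to the matrix of operators. -/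
theorem universalMoser_eq_add (k q q' : ℂ) (M : ℕ) :
    universalMoser k q M = universalMoser k q' M + (k * (q' - q)) • 1 := by
  refine LinearMap.ext fun G => funext fun j => ?_
  rw [LinearMap.add_apply, Pi.add_apply, universalMoser_apply, universalMoser_apply,
    ← sub_eq_iff_eq_add', ← Finset.sum_sub_distrib, Finset.sum_eq_single j]
  · simp only [universalEntry, lt_irrefl, if_false, LinearMap.smul_apply, Module.End.one_apply,
      Pi.smul_apply, ← sub_smul]
    congr 1
    ring
  · intro s _ hs
    have : (s : ℕ) ≠ j := fun h => hs (Fin.ext h)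
    rcases lt_or_gt_of_ne this with h | h
    · simp [universalEntry, h]
    · simp [universalEntry, h, h.not_gt]
  · simp

/-- The polynomials whose monomials all have weight `d - s`. -/
def weightPart (d s : ℕ) : Submodule ℂ (MvPolynomial ℕ ℂ) where
  carrier := {F | ∀ a, coeff a F ≠ 0 → Finsupp.weight powerWeight a + s = d}
  add_mem' := by
    intro F G hF hG a ha
    by_cases h : coeff a F = 0
    · refine hG a fun h' => ha ?_
      rw [coeff_add, h, h', add_zero]
    · exact hF a h
  zero_mem' := fun a ha => absurd (coeff_zero a) ha
  smul_mem' := by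
    intro c F hF a ha
    refine hF a fun h => ha ?_
    rw [coeff_smul, h, smul_zero]

theorem mem_weightPart_zero {d : ℕ} {F : MvPolynomial ℕ ℂ} :
    F ∈ weightPart d 0 ↔ F ∈ PowerPart d := Iff.rfl

theorem mul_X_mem_weightPart {d s t : ℕ} {F : MvPolynomial ℕ ℂ}
    (hF : F ∈ weightPart d (s + (t + 1))) : X t * F ∈ weightPart d s := by
  intro a ha
  rw [coeff_X_mul'] at ha
  split_ifs at ha with h
  · have h1 := hF _ ha
    have h2 : a = a - Finsupp.single t 1 + Finsupp.single t 1 := by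
      rw [tsub_add_cancel_of_le]
      rw [Finsupp.single_le_iff]
      exact Nat.one_le_iff_ne_zero.2 (Finsupp.mem_support_iff.1 h)
    rw [h2, map_add, Finsupp.weight_single]
    simp only [powerWeight, smul_eq_mul, one_mul]
    omega
  · exact absurd rfl ha

theorem pderiv_mem_weightPart {d s t : ℕ} {F : MvPolynomial ℕ ℂ} (hF : F ∈ weightPart d s) :
    pderiv t F ∈ weightPart d (s + (t + 1)) := by
  intro a ha
  rw [coeff_pderiv] at ha
  have h1 := hF _ (left_ne_zero_of_mul ha)
  rw [map_add, Finsupp.weight_single] at h1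
  simp only [powerWeight, smul_eq_mul, one_mul] at h1
  omega

theorem powerGrad_mem {d M : ℕ} {F : MvPolynomial ℕ ℂ} (hF : F ∈ PowerPart d) (s : Fin M) :
    powerGrad M F s ∈ weightPart d (s + 1) := by
  rw [powerGrad_apply]
  have := pderiv_mem_weightPart (t := s) (mem_weightPart_zero.2 hF)
  rw [zero_add] at this
  exact Submodule.smul_mem _ _ this

theorem universalEntry_mem {k q : ℂ} {d j s : ℕ} {F : MvPolynomial ℕ ℂ}
    (hF : F ∈ weightPart d (s + 1)) : universalEntry k q j s F ∈ weightPart d (j + 1) := by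
  rw [universalEntry]
  split_ifs with h h'
  · refine Submodule.smul_mem _ _ ?_
    have := pderiv_mem_weightPart (t := j - s - 1) hF
    rwa [show s + 1 + (j - s - 1 + 1) = j + 1 by omega] at this
  · refine Submodule.smul_mem _ _ (mul_X_mem_weightPart ?_)
    rwa [show j + 1 + (s - j - 1 + 1) = s + 1 by omega]
  · obtain rfl : s = j := by omega
    exact Submodule.smul_mem _ _ hF

theorem universalMoser_mem {k q : ℂ} {d M : ℕ} {G : Fin M → MvPolynomial ℕ ℂ}
    (hG : ∀ s : Fin M, G s ∈ weightPart d (s + 1)) (j : Fin M) :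
    universalMoser k q M G j ∈ weightPart d (j + 1) := by
  rw [universalMoser_apply]
  exact Submodule.sum_mem _ fun s _ => universalEntry_mem (hG s)

theorem universalMoser_pow_mem {k q : ℂ} {d M : ℕ} {G : Fin M → MvPolynomial ℕ ℂ}
    (hG : ∀ s : Fin M, G s ∈ weightPart d (s + 1)) (r : ℕ) (j : Fin M) :
    (universalMoser k q M ^ r) G j ∈ weightPart d (j + 1) := by
  induction r generalizing j with
  | zero => exact hG j
  | succ r ih =>
    rw [pow_succ', Module.End.mul_apply]
    exact universalMoser_mem ih j

theorem universalIntegral_mem {k q : ℂ} {d M : ℕ} {F : MvPolynomial ℕ ℂ} (hF : F ∈ PowerPart d)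
    (r : ℕ) : universalIntegral k q M r F ∈ PowerPart d := by
  rw [universalIntegral, LinearMap.comp_apply, powerContract_apply]
  refine Submodule.sum_mem _ fun s _ => ?_
  refine mem_weightPart_zero.1 (mul_X_mem_weightPart ?_)
  rw [zero_add]
  exact universalMoser_pow_mem (powerGrad_mem hF) r s

/-! ### The invariant bilinear form -/

/-- The value of the form on the monomial with exponent `a` paired with itself,
`∏ t, (a t)! * (-(t + 1) / k) ^ a t`. -/
def powerNorm (k : ℂ) (a : ℕ →₀ ℕ) : ℂ :=
  a.prod fun t e => (e.factorial : ℂ) * (-((t : ℂ) + 1) / k) ^ e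

theorem powerNorm_add_single (k : ℂ) (a : ℕ →₀ ℕ) (t : ℕ) :
    powerNorm k (a + Finsupp.single t 1) = -((t : ℂ) + 1) / k * (a t + 1) * powerNorm k a := by
  have h0 : ∀ t : ℕ, ((0 : ℕ).factorial : ℂ) * (-((t : ℂ) + 1) / k) ^ 0 = 1 := by simp
  rw [powerNorm, powerNorm, ← Finsupp.mul_prod_erase' a t _ h0,
    ← Finsupp.mul_prod_erase' (a + Finsupp.single t 1) t _ h0, Finsupp.erase_add,
    Finsupp.erase_single, add_zero, Finsupp.add_apply, Finsupp.single_eq_same, Nat.factorial_succ,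
    pow_succ]
  push_cast
  ring

theorem powerNorm_ne_zero {k : ℂ} (hk : k ≠ 0) (a : ℕ →₀ ℕ) : powerNorm k a ≠ 0 := by
  refine Finset.prod_ne_zero_iff.2 fun t _ => mul_ne_zero ?_ (pow_ne_zero _ (div_ne_zero ?_ hk))
  · exact_mod_cast Nat.factorial_ne_zero _
  · exact neg_ne_zero.2 (Nat.cast_add_one_ne_zero t)

/-- The bilinear form for which the monomials in the power sums are orthogonal, and for which
multiplication by `X t` is adjoint to `-(t + 1) / k * ∂ / ∂ X t`. -/
def powerForm (k : ℂ) : MvPolynomial ℕ ℂ →ₗ[ℂ] MvPolynomial ℕ ℂ →ₗ[ℂ] ℂ :=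
  (basisMonomials ℕ ℂ).constr ℂ fun a => powerNorm k a • lcoeff ℂ a

theorem powerForm_monomial (k : ℂ) (a : ℕ →₀ ℕ) (c : ℂ) (G : MvPolynomial ℕ ℂ) :
    powerForm k (monomial a c) G = c * (powerNorm k a * coeff a G) := by
  have h : (monomial a c : MvPolynomial ℕ ℂ) = c • basisMonomials ℕ ℂ a := by
    rw [coe_basisMonomials, smul_monomial, smul_eq_mul, mul_one]
  rw [h, powerForm, map_smul, Module.Basis.constr_basis]
  rfl

theorem powerForm_comm (k : ℂ) (F G : MvPolynomial ℕ ℂ) : powerForm k F G = powerForm k G F := by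
  induction F using MvPolynomial.induction_on' with
  | add p q hp hq => rw [map_add, map_add, LinearMap.add_apply, hp, hq]
  | monomial a c =>
    induction G using MvPolynomial.induction_on' with
    | add p q hp hq => rw [map_add, map_add, LinearMap.add_apply, hp, hq]
    | monomial b e =>
      rw [powerForm_monomial, powerForm_monomial, coeff_monomial, coeff_monomial]
      by_cases h : a = b
      · subst h
        simp
        ring
      · simp [h, Ne.symm h]

theorem powerForm_X_mul (k : ℂ) (t : ℕ) (F G : MvPolynomial ℕ ℂ) :
    powerForm k (X t * F) G = -((t : ℂ) + 1) / k * powerForm k F (pderiv t G) := by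
  induction F using MvPolynomial.induction_on' with
  | add p q hp hq => rw [mul_add, map_add, map_add, LinearMap.add_apply, LinearMap.add_apply, hp,
      hq, mul_add]
  | monomial a c =>
    rw [X, monomial_mul, one_mul, add_comm, powerForm_monomial, powerForm_monomial, coeff_pderiv,
      powerNorm_add_single]
    ring

theorem powerForm_nondegenerate {k : ℂ} (hk : k ≠ 0) {d : ℕ} {F : MvPolynomial ℕ ℂ}
    (hF : F ∈ PowerPart d) (h : ∀ G ∈ PowerPart d, powerForm k F G = 0) : F = 0 := by
  ext a
  rw [coeff_zero]
  by_contra ha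
  have h1 := h (monomial a 1) (isWeightedHomogeneous_monomial _ _ _ (hF ha))
  rw [powerForm_comm, powerForm_monomial, one_mul] at h1
  exact mul_ne_zero (powerNorm_ne_zero hk a) ha h1

theorem powerForm_universalEntry {k : ℂ} (hk : k ≠ 0) (q : ℂ) (j s : ℕ) (F G : MvPolynomial ℕ ℂ) :
    powerForm k (universalEntry k q j s F) G = powerForm k F (universalEntry k q s j G) := by
  have key : ∀ (j s : ℕ) (F G : MvPolynomial ℕ ℂ), s < j →
      powerForm k (universalEntry k q j s F) G = powerForm k F (universalEntry k q s j G) := by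
    intro j s F G h
    have e : ((j - s : ℕ) : ℂ) = ((j - s - 1 : ℕ) : ℂ) + 1 := by
      rw [← Nat.cast_add_one, Nat.sub_add_cancel (by omega)]
    rw [universalEntry, universalEntry, if_pos h, if_neg h.not_gt, if_pos h]
    simp only [LinearMap.smul_apply, map_smul, smul_eq_mul, LinearMap.mulLeft_apply,
      Derivation.coeFn_coe]
    rw [powerForm_comm k F, powerForm_X_mul, powerForm_comm k G, e]
    field_simp
  rcases lt_trichotomy s j with h | h | h
  · exact key j s F G h
  · subst h
    simp [universalEntry]
  · rw [powerForm_comm, ← key s j G F h, powerForm_comm]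

/-- Up to the factor `-k⁻¹`, the contraction and the gradient are adjoint. -/
theorem powerForm_powerContract {k : ℂ} (hk : k ≠ 0) {M : ℕ} (G : Fin M → MvPolynomial ℕ ℂ)
    (F : MvPolynomial ℕ ℂ) :
    powerForm k (powerContract M G) F =
      -k⁻¹ * ∑ s, powerForm k (G s) (powerGrad M F s) := by
  rw [powerContract_apply, map_sum, LinearMap.sum_apply, Finset.mul_sum]
  refine Finset.sum_congr rfl fun s _ => ?_
  rw [powerForm_X_mul, powerGrad_apply, map_smul, smul_eq_mul]
  field_simp

/-- The matrix of operators `universalEntry` is self-adjoint. -/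
theorem powerForm_universalMoser_pow {k : ℂ} (hk : k ≠ 0) (q : ℂ) {M : ℕ} (r : ℕ)
    (G H : Fin M → MvPolynomial ℕ ℂ) :
    ∑ s, powerForm k ((universalMoser k q M ^ r) G s) (H s) =
      ∑ s, powerForm k (G s) ((universalMoser k q M ^ r) H s) := by
  induction r generalizing G H with
  | zero => rfl
  | succ r ih =>
    rw [pow_succ, Module.End.mul_apply, ih, ← pow_succ, pow_succ', Module.End.mul_apply]
    simp only [universalMoser_apply, map_sum, LinearMap.sum_apply]
    rw [Finset.sum_comm]
    refine Finset.sum_congr rfl fun s _ => Finset.sum_congr rfl fun j _ => ?_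
    exact powerForm_universalEntry hk q _ _ _ _

theorem powerForm_universalIntegral {k : ℂ} (hk : k ≠ 0) (q : ℂ) (M r : ℕ)
    (F G : MvPolynomial ℕ ℂ) :
    powerForm k (universalIntegral k q M r F) G = powerForm k F (universalIntegral k q M r G) := by
  rw [powerForm_comm k F]
  simp only [universalIntegral, LinearMap.comp_apply]
  rw [powerForm_powerContract hk, powerForm_powerContract hk, powerForm_universalMoser_pow hk]
  congr 1
  exact Finset.sum_congr rfl fun s _ => powerForm_comm _ _ _

/-! ### The integrals on deformed power sums -/

/-- The value at the deformed power sums `∑ i, k ^ (-p(i)) * x_i ^ (t + 1)`. -/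
def powerEval (n m : ℕ) (k : ℂ) : MvPolynomial ℕ ℂ →ₐ[ℂ] MvPolynomial (Fin (n + m)) ℂ :=
  powerSumMap fun i => (k ^ parity n m i)⁻¹

/-- The function `∑ s, G s * x_i ^ (s + 1)`, where `G s` is evaluated at the deformed power sums. -/
def vectorEval (n m : ℕ) (k : ℂ) {M : ℕ} (G : Fin M → MvPolynomial ℕ ℂ) (i : Fin (n + m)) :
    MvPolynomial (Fin (n + m)) ℂ :=
  ∑ s : Fin M, powerEval n m k (G s) * X i ^ (s + 1 : ℕ)

/-- The quantum Moser matrix on a vector of polynomials `g`: the poles cancel if `x_i - x_l` divides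
`g_i - g_l`. -/
theorem moser_apply (n m : ℕ) (k : ℂ) (i : Fin (n + m))
    (g h : Fin (n + m) → MvPolynomial (Fin (n + m)) ℂ)
    (hgh : ∀ l, g i - g l = (X i - X l) * h l) :
    ∑ j, moser n m k i j (algebraMap _ (RatFun n m) (g j)) = algebraMap _ (RatFun n m)
      (C (k ^ parity n m i) * X i * pderiv i (g i) -
        ∑ l ∈ Finset.univ.erase i, C (k ^ (1 - parity n m l)) * X i * h l) := by
  have hC : ∀ (c : ℂ) (f : RatFun n m),
      algebraMap (MvPolynomial (Fin (n + m)) ℂ) (RatFun n m) (C c) * f = c • f := fun c f => by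
    rw [← MvPolynomial.algebraMap_eq, ← IsScalarTower.algebraMap_apply, Algebra.smul_def]
  rw [← Finset.add_sum_erase _ _ (Finset.mem_univ i), moser, Matrix.of_apply, if_pos rfl,
    LinearMap.sub_apply, LinearMap.sum_apply, sub_add, ← Finset.sum_sub_distrib, map_sub, map_sum]
  congr 1
  · rw [map_mul, map_mul, mul_assoc, hC, del, LinearMap.smul_apply, Module.End.mul_apply,
      LinearMap.mulLeft_apply, Derivation.coeFn_coe, partialDer_algebraMap, x]
  · refine Finset.sum_congr rfl fun l hl => ?_
    have hl' := (Finset.ne_of_mem_erase hl).symm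
    have h1 := x_sub_ne_zero n m hl'
    have h2 := congrArg (algebraMap (MvPolynomial (Fin (n + m)) ℂ) (RatFun n m)) (hgh l)
    rw [map_mul, map_sub, map_sub] at h2
    rw [Matrix.of_apply, if_neg hl', LinearMap.smul_apply, LinearMap.smul_apply, ← smul_sub,
      map_mul, map_mul, mul_assoc, hC, mulOp, LinearMap.mulLeft_apply, LinearMap.mulLeft_apply,
      ← mul_sub, h2]
    congr 1
    change _ / (x n m i - x n m l) * ((x n m i - x n m l) * _) = x n m i * _
    field_simp

theorem pow_one_sub_parity (n m : ℕ) {k : ℂ} (hk : k ≠ 0) (i : Fin (n + m)) :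
    k ^ (1 - parity n m i) = k * (k ^ parity n m i)⁻¹ := by
  rcases parity_eq_zero_or_one n m i with h | h <;> simp [h, hk]

theorem pow_parity_add (n m : ℕ) (k : ℂ) (i : Fin (n + m)) :
    k ^ parity n m i + k ^ (1 - parity n m i) = 1 + k := by
  rcases parity_eq_zero_or_one n m i with h | h <;> simp [h, add_comm]

/-- The deformed power sum of degree zero, `∑ i, k ^ (-p(i)) = n + m / k`. -/
def powerZero (n m : ℕ) (k : ℂ) : ℂ := ∑ i : Fin (n + m), (k ^ parity n m i)⁻¹

/-- The quantum Moser matrix acts on one term of `vectorEval` by a column of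
`universalEntry`. -/
theorem vectorEval_term (n m : ℕ) {k : ℂ} (hk : k ≠ 0) {M d s : ℕ} (hM : d ≤ M) (hs : s < M)
    {H : MvPolynomial ℕ ℂ} (hH : H ∈ weightPart d (s + 1)) (i : Fin (n + m)) :
    C (k ^ parity n m i) * X i * pderiv i (powerEval n m k H * X i ^ (s + 1)) -
      ∑ l ∈ Finset.univ.erase i, C (k ^ (1 - parity n m l)) * X i *
        (powerEval n m k H * ∑ a ∈ Finset.range (s + 1), X i ^ a * X l ^ (s - a)) =
    ∑ j ∈ Finset.range M, powerEval n m k (universalEntry k (powerZero n m k) j s H) *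
      X i ^ (j + 1) := by
  obtain ⟨K, rfl⟩ : ∃ K, M = s + 1 + K := ⟨M - (s + 1), by omega⟩
  have hH' : H ∈ PowerPart (d - (s + 1)) := fun a ha => by
    have := hH a ha
    omega
  set e := powerEval n m k with he
  have hε : (C (k ^ parity n m i) * C (k ^ parity n m i)⁻¹ : MvPolynomial (Fin (n + m)) ℂ) = 1 := by
    rw [← C_mul, mul_inv_cancel₀ (pow_parity_ne_zero n m hk i), C_1]
  -- the terms of the sum over `l` are regrouped into power sums
  have h1 : ∑ l, C (k ^ (1 - parity n m l)) * X i *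
        (e H * ∑ a ∈ Finset.range (s + 1), X i ^ a * X l ^ (s - a)) =
      ∑ a ∈ Finset.range (s + 1), C k * e H *
        (∑ l, C (k ^ parity n m l)⁻¹ * X l ^ (s - a)) * X i ^ (a + 1) := by
    simp only [Finset.mul_sum, Finset.sum_mul]
    rw [Finset.sum_comm]
    refine Finset.sum_congr rfl fun a _ => Finset.sum_congr rfl fun l _ => ?_
    rw [pow_one_sub_parity n m hk, C_mul]
    ring
  have h2 : C (k ^ (1 - parity n m i)) * X i *
        (e H * ∑ a ∈ Finset.range (s + 1), X i ^ a * X i ^ (s - a)) =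
      C (k ^ (1 - parity n m i)) * C ((s : ℂ) + 1) * e H * X i ^ (s + 1) := by
    rw [Finset.sum_congr rfl (g := fun _ => (X i : MvPolynomial (Fin (n + m)) ℂ) ^ s) fun a ha => by
      rw [← pow_add, Nat.add_sub_cancel' (Nat.lt_succ_iff.1 (Finset.mem_range.1 ha))],
      Finset.sum_const, Finset.card_range, nsmul_eq_mul]
    simp only [Nat.cast_add, Nat.cast_one, C_add, C_1, map_natCast]
    ring
  have h3 : pderiv i (e H) = ∑ t ∈ Finset.range K,
      e (pderiv t H) * (C ((k ^ parity n m i)⁻¹ * (t + 1)) * X i ^ t) :=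
    pderiv_powerSumMap _ i hH' (by omega)
  have h4 : ∀ t, e (universalEntry k (powerZero n m k) (s + 1 + t) s H) * X i ^ (s + 1 + t + 1) =
      C (k ^ parity n m i) * X i * (e (pderiv t H) *
        (C ((k ^ parity n m i)⁻¹ * (t + 1)) * X i ^ t) * X i ^ (s + 1)) := by
    intro t
    rw [universalEntry, if_pos (by omega), show s + 1 + t - s = t + 1 by omega,
      Nat.add_sub_cancel, LinearMap.smul_apply, map_smul, smul_eq_C_mul, Derivation.coeFn_coe,
      C_mul]
    push_cast
    linear_combination (-(C ((t : ℂ) + 1) * e (pderiv t H) * X i ^ (s + 1 + t + 1))) * hε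
  have h5 : ∀ a ∈ Finset.range s, e (universalEntry k (powerZero n m k) a s H) * X i ^ (a + 1) =
      -(C k * e H * (∑ l, C (k ^ parity n m l)⁻¹ * X l ^ (s - a)) * X i ^ (a + 1)) := by
    intro a ha
    have ha' := Finset.mem_range.1 ha
    rw [universalEntry, if_neg ha'.not_gt, if_pos ha', LinearMap.smul_apply, map_smul,
      smul_eq_C_mul, LinearMap.mulLeft_apply, map_mul, he, powerEval, powerSumMap_X, ← powerEval,
      ← he, show s - a - 1 + 1 = s - a by omega, C_neg]
    ring
  have h6 : e (universalEntry k (powerZero n m k) s s H) =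
      (C (k ^ parity n m i) + C (k ^ (1 - parity n m i))) * C ((s : ℂ) + 1) * e H -
        C k * e H * ∑ l, C (k ^ parity n m l)⁻¹ * X l ^ (s - s) := by
    rw [universalEntry, if_neg (lt_irrefl s), if_neg (lt_irrefl s), LinearMap.smul_apply, map_smul,
      smul_eq_C_mul, Module.End.one_apply, ← C_add, pow_parity_add, C_sub, C_mul, C_mul (a := k),
      powerZero, map_sum]
    simp only [Nat.sub_self, pow_zero, mul_one]
    ring
  rw [Finset.sum_erase_eq_sub (Finset.mem_univ i), h1, h2, Finset.sum_range_add _ (s + 1) K,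
    Finset.sum_congr rfl fun t _ => h4 t, Finset.sum_range_succ, Finset.sum_range_succ,
    Finset.sum_congr rfl h5, Finset.sum_neg_distrib, h6, pderiv_mul, h3, ← Finset.mul_sum,
    ← Finset.sum_mul, pderiv_pow, pderiv_X_self, Nat.add_sub_cancel]
  simp only [Nat.cast_add, Nat.cast_one, C_add, C_1, map_natCast]
  ring

theorem sum_moser_vectorEval (n m : ℕ) {k : ℂ} (hk : k ≠ 0) {M d : ℕ} (hM : d ≤ M)
    {G : Fin M → MvPolynomial ℕ ℂ} (hG : ∀ s : Fin M, G s ∈ weightPart d (s + 1))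
    (i : Fin (n + m)) :
    ∑ j, moser n m k i j (algebraMap _ (RatFun n m) (vectorEval n m k G j)) =
      algebraMap _ (RatFun n m) (vectorEval n m k (universalMoser k (powerZero n m k) M G) i) := by
  rw [moser_apply n m k i (vectorEval n m k G) (fun l => ∑ s : Fin M, powerEval n m k (G s) *
    ∑ a ∈ Finset.range (s + 1 : ℕ), X i ^ a * X l ^ (s - a : ℕ))]
  · congr 1
    have h1 : vectorEval n m k (universalMoser k (powerZero n m k) M G) i =
        ∑ s : Fin M, ∑ j ∈ Finset.range M,
          powerEval n m k (universalEntry k (powerZero n m k) j s (G s)) * X i ^ (j + 1) := by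
      simp only [vectorEval, universalMoser_apply, map_sum, Finset.sum_mul]
      rw [Finset.sum_comm]
      refine Finset.sum_congr rfl fun s _ => ?_
      rw [Finset.sum_range]
    rw [h1, vectorEval, map_sum, Finset.mul_sum]
    simp only [Finset.mul_sum]
    rw [Finset.sum_comm, ← Finset.sum_sub_distrib]
    refine Finset.sum_congr rfl fun s _ => ?_
    rw [← vectorEval_term n m hk hM s.2 (hG s) i]
    simp only [Finset.mul_sum]
  · intro l
    rw [vectorEval, vectorEval, ← Finset.sum_sub_distrib, Finset.mul_sum]
    refine Finset.sum_congr rfl fun s _ => ?_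
    rw [← mul_sub, ← geom_sum₂_mul]
    simp only [Nat.add_sub_cancel]
    ring

/-- The first application of the Moser matrix, to a constant vector, produces the gradient in the
power sums. -/
theorem sum_moser_powerEval (n m : ℕ) {k : ℂ} (hk : k ≠ 0) {M d : ℕ} (hM : d ≤ M)
    {F : MvPolynomial ℕ ℂ} (hF : F ∈ PowerPart d) (i : Fin (n + m)) :
    ∑ j, moser n m k i j (algebraMap _ (RatFun n m) (powerEval n m k F)) =
      algebraMap _ (RatFun n m) (vectorEval n m k (powerGrad M F) i) := by
  rw [moser_apply n m k i (fun _ => powerEval n m k F) (fun _ => 0) (by simp)]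
  congr 1
  simp only [mul_zero, Finset.sum_const_zero, sub_zero]
  rw [powerEval, pderiv_powerSumMap _ i hF hM, Finset.mul_sum, Finset.sum_range, vectorEval]
  refine Finset.sum_congr rfl fun s _ => ?_
  have h : (C (k ^ parity n m i) * C (k ^ parity n m i)⁻¹ : MvPolynomial (Fin (n + m)) ℂ) = 1 := by
    rw [← C_mul, mul_inv_cancel₀ (pow_parity_ne_zero n m hk i), C_1]
  rw [powerGrad_apply, map_smul, smul_eq_C_mul, C_mul, powerEval]
  linear_combination X i * powerSumMap (fun i => (k ^ parity n m i)⁻¹) (pderiv (s : ℕ) F) *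
    C ((s : ℂ) + 1) * X i ^ (s : ℕ) * h

theorem sum_moser_pow_powerEval (n m : ℕ) {k : ℂ} (hk : k ≠ 0) {M d : ℕ} (hM : d ≤ M)
    {F : MvPolynomial ℕ ℂ} (hF : F ∈ PowerPart d) (r : ℕ) (i : Fin (n + m)) :
    ∑ j, (moser n m k ^ (r + 1)) i j (algebraMap _ (RatFun n m) (powerEval n m k F)) =
      algebraMap _ (RatFun n m)
        (vectorEval n m k ((universalMoser k (powerZero n m k) M ^ r) (powerGrad M F)) i) := by
  induction r generalizing i with
  | zero =>
    rw [zero_add, pow_one]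
    exact sum_moser_powerEval n m hk hM hF i
  | succ r ih =>
    rw [pow_succ' _ r, Module.End.mul_apply,
      ← sum_moser_vectorEval n m hk hM fun s => universalMoser_pow_mem (powerGrad_mem hF) r s]
    simp only [← ih, map_sum]
    rw [Finset.sum_comm]
    refine Finset.sum_congr rfl fun j _ => ?_
    rw [pow_succ' _ (r + 1), Matrix.mul_apply, LinearMap.sum_apply]
    rfl

theorem sum_vectorEval (n m : ℕ) (k : ℂ) {M : ℕ} (G : Fin M → MvPolynomial ℕ ℂ) :
    ∑ i, C (k ^ parity n m i)⁻¹ * vectorEval n m k G i = powerEval n m k (powerContract M G) := by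
  simp only [vectorEval, powerContract_apply, map_sum, map_mul, Finset.mul_sum]
  rw [Finset.sum_comm]
  refine Finset.sum_congr rfl fun s _ => ?_
  conv_rhs => rw [powerEval, powerSumMap_X, ← powerEval, Finset.sum_mul]
  exact Finset.sum_congr rfl fun i _ => by ring

/-- On deformed power sums, the integral `ℒ_{r+1}` is induced by `universalIntegral`. -/
theorem cmsIntegral_powerEval (n m : ℕ) {k : ℂ} (hk : k ≠ 0) {M d : ℕ} (hM : d ≤ M)
    {F : MvPolynomial ℕ ℂ} (hF : F ∈ PowerPart d) (r : ℕ) :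
    cmsIntegral n m k (r + 1) (algebraMap _ (RatFun n m) (powerEval n m k F)) =
      algebraMap _ (RatFun n m)
        (powerEval n m k (universalIntegral k (powerZero n m k) M r F)) := by
  simp only [cmsIntegral, LinearMap.sum_apply, LinearMap.smul_apply, ← Finset.smul_sum]
  simp only [sum_moser_pow_powerEval n m hk hM hF]
  rw [universalIntegral, LinearMap.comp_apply, LinearMap.comp_apply, ← sum_vectorEval, map_sum]
  refine Finset.sum_congr rfl fun i _ => ?_
  rw [map_mul, ← MvPolynomial.algebraMap_eq, ← IsScalarTower.algebraMap_apply, Algebra.smul_def]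

/-! ### Triangular self-adjoint operators -/

section Triangular

variable {E Γ : Type*} [AddCommGroup E] [Module ℂ E] [LinearOrder Γ] [OrderBot Γ]

/-- The function `val` behaves like the degree of the leading term of a polynomial. -/
structure IsLeadingDegree (val : E → Γ) : Prop where
  eq_bot_iff : ∀ v, val v = ⊥ ↔ v = 0
  add_le : ∀ v w, val (v + w) ≤ max (val v) (val w)
  smul_le : ∀ (c : ℂ) (v), val (c • v) ≤ val v

/-- The operator `A` multiplies the leading term of degree `γ` by `ε γ`. -/
def IsTriangular (val : E → Γ) (A : Module.End ℂ E) (ε : Γ → ℂ) : Prop :=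
  ∀ v, v ≠ 0 → val (A v - ε (val v) • v) < val v

/-- The `v` on which `A` acts by the scalar prescribed by the leading term. -/
def IsLeadingEigenvector (val : E → Γ) (A : Module.End ℂ E) (ε : Γ → ℂ) (v : E) : Prop :=
  A v = ε (val v) • v

theorem IsLeadingDegree.bot_lt {val : E → Γ} (hval : IsLeadingDegree val) {v : E} (hv : v ≠ 0) :
    ⊥ < val v :=
  bot_lt_iff_ne_bot.2 fun h => hv ((hval.eq_bot_iff v).1 h)

theorem IsLeadingDegree.lt_of_mem_span {val : E → Γ} (hval : IsLeadingDegree val) {s : Set E}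
    {γ : Γ} (hγ : ⊥ < γ) (h : ∀ v ∈ s, val v < γ)
    {v : E} (hv : v ∈ Submodule.span ℂ s) : val v < γ := by
  induction hv using Submodule.span_induction with
  | mem v hv => exact h v hv
  | zero => rwa [(hval.eq_bot_iff 0).2 rfl]
  | add v w _ _ hv hw => exact (hval.add_le v w).trans_lt (max_lt hv hw)
  | smul c v _ hv => exact (hval.smul_le c v).trans_lt hv

theorem IsTriangular.sum_smul {val : E → Γ} (hval : IsLeadingDegree val) {ι : Type*}
    (s : Finset ι) (c : ι → ℂ) {A : ι → Module.End ℂ E} {ε : ι → Γ → ℂ}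
    (hA : ∀ i, IsTriangular val (A i) (ε i)) :
    IsTriangular val (∑ i ∈ s, c i • A i) fun γ => ∑ i ∈ s, c i * ε i γ := by
  intro v hv
  refine hval.lt_of_mem_span (s := Set.range fun i => A i v - ε i (val v) • v) (hval.bot_lt hv) ?_
    ?_
  · rintro _ ⟨i, rfl⟩
    exact hA i v hv
  · rw [LinearMap.sum_apply, Finset.sum_smul, ← Finset.sum_sub_distrib]
    refine Submodule.sum_mem _ fun i _ => ?_
    rw [LinearMap.smul_apply, mul_smul, ← smul_sub]
    exact Submodule.smul_mem _ _ (Submodule.subset_span ⟨i, rfl⟩)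

/-- If the eigenvalues of a triangular operator separate the degrees, its eigenvectors span. -/
theorem mem_span_leadingEigenvector [WellFoundedLT Γ] {val : E → Γ} (hval : IsLeadingDegree val)
    {A : Module.End ℂ E} {ε : Γ → ℂ}
    (hA : IsTriangular val A ε)
    (hε : ∀ v w, v ≠ 0 → w ≠ 0 → ε (val v) = ε (val w) → val v = val w) (v : E) :
    v ∈ Submodule.span ℂ {u | IsLeadingEigenvector val A ε u ∧ val u ≤ val v} := by
  induction h : val v using WellFoundedLT.induction generalizing v with
  | _ γ ih =>
    subst h
    rcases eq_or_ne v 0 with rfl | hv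
    · exact zero_mem _
    have hw := hA v hv
    -- the lower terms are in the image of `A - ε (val v)` restricted to lower eigenvectors
    have h1 : ∃ z ∈ Submodule.span ℂ {u | IsLeadingEigenvector val A ε u ∧ val u < val v},
        A z - ε (val v) • z = A v - ε (val v) • v := by
      have h2 := Submodule.span_mono (t := {u | IsLeadingEigenvector val A ε u ∧ val u < val v})
        (fun u hu => ⟨hu.1, hu.2.trans_lt hw⟩) (ih _ hw _ rfl)
      generalize A v - ε (val v) • v = w at h2
      clear hw
      induction h2 using Submodule.span_induction with
      | mem u hu =>
        rcases eq_or_ne u 0 with rfl | hu0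
        · exact ⟨0, zero_mem _, by simp⟩
        have hlt := hu.2
        have hne : ε (val u) - ε (val v) ≠ 0 := fun h =>
          hlt.ne (hε u v hu0 hv (sub_eq_zero.1 h))
        refine ⟨(ε (val u) - ε (val v))⁻¹ • u,
          Submodule.smul_mem _ _ (Submodule.subset_span ⟨hu.1, hlt⟩), ?_⟩
        rw [map_smul, hu.1, smul_comm (ε (val v)), ← smul_sub, ← sub_smul, smul_smul,
          inv_mul_cancel₀ hne, one_smul]
      | zero => exact ⟨0, zero_mem _, by simp⟩
      | add x y _ _ hx hy =>
        obtain ⟨a, ha, ha'⟩ := hx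
        obtain ⟨b, hb, hb'⟩ := hy
        exact ⟨a + b, add_mem ha hb, by rw [map_add, smul_add, add_sub_add_comm, ha', hb']⟩
      | smul c x _ hx =>
        obtain ⟨a, ha, ha'⟩ := hx
        exact ⟨c • a, Submodule.smul_mem _ _ ha, by
          rw [map_smul, smul_comm (ε (val v)), ← smul_sub, ha']⟩
    obtain ⟨z, hz, hz'⟩ := h1
    have hzlt : val z < val v := hval.lt_of_mem_span (hval.bot_lt hv) (fun u hu => hu.2) hz
    have hle : val (v - z) ≤ val v := by
      rw [sub_eq_add_neg, ← neg_one_smul ℂ z]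
      exact (hval.add_le _ _).trans (max_le le_rfl ((hval.smul_le _ _).trans hzlt.le))
    have heq : val (v - z) = val v := by
      refine le_antisymm hle (not_lt.1 fun hlt => ?_)
      have := (hval.add_le (v - z) z).trans_lt (max_lt hlt hzlt)
      rw [sub_add_cancel] at this
      exact lt_irrefl _ this
    rw [← sub_add_cancel v z]
    refine add_mem (Submodule.subset_span ⟨?_, ?_⟩)
      (Submodule.span_mono (fun u hu => ?_) hz)
    · rw [IsLeadingEigenvector, heq, map_sub, smul_sub, sub_eq_sub_iff_sub_eq_sub, ← hz']
    · rw [sub_add_cancel]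
      exact hle
    · rw [sub_add_cancel]
      exact ⟨hu.1, hu.2.le⟩

/-- A triangular self-adjoint operator preserves the eigenvectors of another one whose eigenvalues
separate the degrees. -/
theorem IsLeadingEigenvector.of_selfAdjoint [WellFoundedLT Γ] {val : E → Γ}
    (hval : IsLeadingDegree val) {A Y : Module.End ℂ E} {ε η : Γ → ℂ}
    {B : E →ₗ[ℂ] E →ₗ[ℂ] ℂ} (hB : ∀ v, (∀ w, B v w = 0) → v = 0)
    (hAB : ∀ v w, B (A v) w = B v (A w)) (hYB : ∀ v w, B (Y v) w = B v (Y w))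
    (hA : IsTriangular val A ε) (hY : IsTriangular val Y η)
    (hε : ∀ v w, v ≠ 0 → w ≠ 0 → ε (val v) = ε (val w) → val v = val w)
    {u : E} (hu : IsLeadingEigenvector val A ε u) : IsLeadingEigenvector val Y η u := by
  rcases eq_or_ne u 0 with rfl | hu0
  · simp [IsLeadingEigenvector]
  -- eigenvectors for distinct eigenvalues are orthogonal
  have orth : ∀ v w, IsLeadingEigenvector val A ε v → IsLeadingEigenvector val A ε w →
      val v ≠ val w → B v w = 0 := by
    intro v w hv hw hvw
    rcases eq_or_ne v 0 with rfl | hv0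
    · rw [map_zero, LinearMap.zero_apply]
    rcases eq_or_ne w 0 with rfl | hw0
    · rw [map_zero]
    have h := hAB v w
    rw [hv, hw, map_smul, map_smul, LinearMap.smul_apply, smul_eq_mul, smul_eq_mul, ← sub_eq_zero,
      ← sub_mul] at h
    exact (mul_eq_zero.1 h).resolve_left fun h' => hvw (hε v w hv0 hw0 (sub_eq_zero.1 h'))
  have hspan := mem_span_leadingEigenvector hval hA hε
  -- `Y u - η (val u) • u` consists of terms lower than `u`; it is orthogonal to the lower
  -- eigenvectors since `Y` is self-adjoint, and to the others since these are orthogonal to lower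
  -- terms
  refine sub_eq_zero.1 (hB _ fun w => ?_)
  have hw := Submodule.span_mono (t := {u | IsLeadingEigenvector val A ε u}) (fun _ h => h.1)
    (hspan w)
  induction hw using Submodule.span_induction with
  | zero => rw [map_zero]
  | add x y _ _ hx hy => rw [map_add, hx, hy, add_zero]
  | smul c x _ hx => rw [map_smul, hx, smul_zero]
  | mem u' hu' =>
    have hu' : IsLeadingEigenvector val A ε u' := hu'
    rcases lt_or_ge (val u') (val u) with hlt | hge
    · have h1 : ∀ y ∈ Submodule.span ℂ {x | IsLeadingEigenvector val A ε x ∧ val x < val u},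
          B u y = 0 := by
        intro y hy
        induction hy using Submodule.span_induction with
        | zero => rw [map_zero]
        | add x y _ _ hx hy => rw [map_add, hx, hy, add_zero]
        | smul c x _ hx => rw [map_smul, hx, smul_zero]
        | mem x hx => exact orth _ _ hu hx.1 hx.2.ne'
      have h2 : val (Y u') < val u := by
        rcases eq_or_ne u' 0 with rfl | hu'0
        · rwa [map_zero]
        rw [← sub_add_cancel (Y u') (η (val u') • u')]
        exact (hval.add_le _ _).trans_lt
          (max_lt ((hY u' hu'0).trans hlt) ((hval.smul_le _ _).trans_lt hlt))
      rw [map_sub, LinearMap.sub_apply, map_smul, LinearMap.smul_apply, hYB,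
        orth u u' hu hu' hlt.ne', smul_zero, sub_zero]
      exact h1 _ (Submodule.span_mono (fun x hx => And.intro hx.1 (hx.2.trans_lt h2))
        (hspan (Y u')))
    · have h1 := Submodule.span_mono (t := {x | IsLeadingEigenvector val A ε x ∧ val x < val u})
        (fun x hx => ⟨hx.1, hx.2.trans_lt (hY u hu0)⟩) (hspan (Y u - η (val u) • u))
      generalize Y u - η (val u) • u = w at h1
      induction h1 using Submodule.span_induction with
      | zero => rw [map_zero, LinearMap.zero_apply]
      | add x y _ _ hx hy => rw [map_add, LinearMap.add_apply, hx, hy, add_zero]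
      | smul c x _ hx => rw [map_smul, LinearMap.smul_apply, hx, smul_zero]
      | mem x hx => exact orth _ _ hx.1 hu' (hx.2.trans_le hge).ne

end Triangular

/-! ### Leading terms and symbols -/

theorem lexDeg_eq (n m : ℕ) {f : MvPolynomial (Fin (n + m)) ℂ} (hf : f ≠ 0) :
    lexDeg n m f = ((MonomialOrder.lex.toSyn (MonomialOrder.lex.degree f) :
      (MonomialOrder.lex (σ := Fin (n + m))).syn) : WithBot _) := by
  rw [lexDeg, (MonomialOrder.withBotDegree_eq_coe_degree_iff f).2 hf,
    MonomialOrder.toWithBotSyn_apply_coe]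

theorem lexDeg_smul (n m : ℕ) (c : ℂ) (f : MvPolynomial (Fin (n + m)) ℂ) :
    lexDeg n m (c • f) ≤ lexDeg n m f :=
  MonomialOrder.withBotDegree_le_withBotDegree_of_support_subset support_smul

theorem lexDeg_eq_bot_iff (n m : ℕ) (f : MvPolynomial (Fin (n + m)) ℂ) :
    lexDeg n m f = ⊥ ↔ f = 0 := by
  refine ⟨fun h => ?_, fun h => h ▸ lexDeg_zero n m⟩
  by_contra hf
  exact lexDeg_ne_bot n m hf h

/-- The exponent of which `γ` is the lexicographic degree. -/
def lexExponent (n m : ℕ) (γ : WithBot (MonomialOrder.lex (σ := Fin (n + m))).syn) :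
    Fin (n + m) →₀ ℕ :=
  MonomialOrder.lex.toSyn.symm (γ.unbotD 0)

theorem lexExponent_lexDeg (n m : ℕ) {f : MvPolynomial (Fin (n + m)) ℂ} (hf : f ≠ 0) :
    lexExponent n m (lexDeg n m f) = MonomialOrder.lex.degree f := by
  rw [lexExponent, lexDeg_eq n m hf, WithBot.unbotD_coe, AddEquiv.symm_apply_apply]

theorem lexDeg_sub_leading (n m : ℕ) {f : MvPolynomial (Fin (n + m)) ℂ} (hf : f ≠ 0) :
    lexDeg n m (f - monomial (MonomialOrder.lex.degree f)
      (coeff (MonomialOrder.lex.degree f) f)) < lexDeg n m f := by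
  classical
  set χ := MonomialOrder.lex.degree f with hχ
  have hc : coeff χ f ≠ 0 := MonomialOrder.lex.coeff_degree_ne_zero_iff.2 hf
  have h1 : lexDeg n m (monomial χ (coeff χ f)) = lexDeg n m f := by
    rw [lexDeg_eq n m (by rwa [Ne, monomial_eq_zero]), lexDeg_eq n m hf,
      MonomialOrder.degree_monomial, if_neg hc]
  refine lt_of_le_of_ne ((lexDeg_sub n m _ _).trans (max_le le_rfl h1.le)) fun h => ?_
  have h0 : f - monomial χ (coeff χ f) ≠ 0 := fun h0 => by
    rw [h0, lexDeg_zero] at h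
    exact lexDeg_ne_bot n m hf h.symm
  have h2 := congrArg (lexExponent n m) h
  rw [lexExponent_lexDeg n m h0, lexExponent_lexDeg n m hf] at h2
  have h3 := MonomialOrder.lex.coeff_degree_ne_zero_iff.2 h0
  rw [h2, ← hχ, coeff_sub, coeff_monomial, if_pos rfl, sub_self] at h3
  exact h3 rfl

/-- An operator with symbol `P` multiplies the leading term of a polynomial by the value of `P` at
the leading exponent. -/
theorem HasSymbol.lexDeg_sub_lt {n m : ℕ} {D : Module.End ℂ (RatFun n m)} {P : SVdual n m}
    (hD : HasSymbol n m D P) {f f' : MvPolynomial (Fin (n + m)) ℂ} (hf : f ≠ 0)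
    (h : D (algebraMap _ (RatFun n m) f) = algebraMap _ (RatFun n m) f') :
    lexDeg n m (f' - eval (fun i => (MonomialOrder.lex.degree f i : ℂ)) P • f) <
      lexDeg n m f := by
  classical
  set χ := MonomialOrder.lex.degree f with hχ
  set c := coeff χ f with hc
  set g := f - monomial χ c with hg
  set ε := eval (fun i => (χ i : ℂ)) P with hε
  have hm : lexDeg n m (monomial χ 1) = lexDeg n m f := by
    rw [lexDeg_eq n m (by rw [Ne, monomial_eq_zero]; exact one_ne_zero), lexDeg_eq n m hf,
      MonomialOrder.degree_monomial, if_neg one_ne_zero]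
  have hsmall : Small n m (algebraMap _ (RatFun n m) g / xPow n m χ) :=
    ⟨g, monomial χ 1, by rw [hm]; exact lexDeg_sub_leading n m hf,
      div_mul_cancel₀ _ (xPow_ne_zero n m χ)⟩
  set s := algebraMap _ (RatFun n m) g / xPow n m χ with hs
  have hsmul : ∀ (c : ℂ) (p : MvPolynomial (Fin (n + m)) ℂ),
      algebraMap _ (RatFun n m) (c • p) = c • algebraMap _ (RatFun n m) p := fun c p => by
    rw [Algebra.smul_def, Algebra.smul_def, map_mul, ← IsScalarTower.algebraMap_apply]
  have hfe : algebraMap _ (RatFun n m) f = c • xPow n m χ + xPow n m χ * s := by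
    rw [hs, mul_div_cancel₀ _ (xPow_ne_zero n m χ), xPow, ← hsmul, ← map_add, smul_monomial,
      smul_eq_mul, mul_one, hg, add_sub_cancel]
  obtain ⟨g1, hg1, e1⟩ := (hD χ).2
  obtain ⟨g2, hg2, e2⟩ := (hD χ).1 s hsmall
  obtain ⟨p, q, hpq, e⟩ := ((hg1.smul c).add hg2).add (hsmall.smul (-ε))
  have h1 : algebraMap _ (RatFun n m) (f' - ε • f) =
      xPow n m χ * (c • g1 + g2 + (-ε) • s) := by
    rw [map_sub, hsmul, ← h, hfe, map_add, map_smul, e1, e2, ← hε, smul_add, smul_add, mul_add,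
      mul_add, mul_smul_comm, mul_smul_comm, smul_comm ε c, neg_smul]
    abel
  have h2 : (f' - ε • f) * q = monomial χ 1 * p := by
    refine IsFractionRing.injective _ (RatFun n m) ?_
    rw [map_mul, map_mul, h1, ← e, xPow]
    ring
  have h3 := congrArg (lexDeg n m) h2
  rw [lexDeg_mul, lexDeg_mul, hm] at h3
  by_contra! hle
  have h4 : lexDeg n m f + lexDeg n m q ≤ lexDeg n m f + lexDeg n m p := by
    rw [← h3]
    exact add_le_add_left hle _
  exact absurd h4 (not_le.2 (WithBot.add_lt_add_left (lexDeg_ne_bot n m hf) hpq))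

/-! ### The symbols separate the exponents -/

/-- The polynomial with the roots `v_i + ρ_i` is invariant under the affine symmetric group. -/
theorem prod_sub_mem (n : ℕ) {k : ℂ} (hk : k ≠ 0) (z : ℂ) :
    (∏ i : Fin (n + 0), (C (z - rho n 0 k i) - X i) : SVdual n 0) ∈
      shiftedQuasiInvariants n 0 k := by
  have hev : ∀ v : V n 0, eval v (∏ i : Fin (n + 0), (C (z - rho n 0 k i) - X i) : SVdual n 0) =
      ∏ i, (z - (v + rho n 0 k) i) := by
    intro v
    rw [map_prod]
    refine Finset.prod_congr rfl fun i _ => ?_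
    rw [map_sub, eval_C, eval_X, Pi.add_apply]
    ring
  refine ⟨?_, ?_⟩
  · rintro _ ⟨i, j, h, hp, rfl⟩
    refine MvPolynomial.funext fun v => ?_
    rw [eval_affinePullback, hev, hev, affineReflection_add_rho, reflection_even n 0 hk h hp]
    exact Equiv.prod_comp (Equiv.swap i j) fun l => z - (v + rho n 0 k) l
  · rintro _ ⟨i, j, h, hp, rfl⟩
    refine absurd ?_ hp
    simp [parity]

/-- For irrational `k`, the joint eigenvalues attached to distinct exponents are distinct. -/
theorem eq_of_eval_cmsSymbol_eq (n : ℕ) {k : ℂ} (hk : ∀ q : ℚ, k ≠ q) {χ χ' : Fin (n + 0) →₀ ℕ}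
    (h : ∀ r, eval (fun i => (χ i : ℂ)) (cmsSymbol n 0 k (r + 1)) =
      eval (fun i => (χ' i : ℂ)) (cmsSymbol n 0 k (r + 1))) : χ = χ' := by
  have hk0 : k ≠ 0 := by simpa using hk 0
  have h1 : ∀ f ∈ shiftedQuasiInvariants n 0 k,
      eval (fun i => (χ i : ℂ)) f = eval (fun i => (χ' i : ℂ)) f := by
    intro f hf
    rw [← adjoin_cmsSymbol n 0 hk] at hf
    induction hf using Algebra.adjoin_induction with
    | mem x hx =>
      obtain ⟨r, hr, rfl⟩ := hx
      obtain ⟨s, rfl⟩ := Nat.exists_eq_add_of_le' hr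
      exact h s
    | algebraMap c => rw [MvPolynomial.algebraMap_eq, eval_C, eval_C]
    | add x y _ _ hx hy => rw [map_add, map_add, hx, hy]
    | mul x y _ _ hx hy => rw [map_mul, map_mul, hx, hy]
  ext i
  have h2 := h1 _ (prod_sub_mem n hk0 (χ i + rho n 0 k i))
  rw [map_prod, map_prod, Finset.prod_eq_zero (Finset.mem_univ i) (by simp), eq_comm,
    Finset.prod_eq_zero_iff] at h2
  obtain ⟨j, -, hj⟩ := h2
  have hi' : (i : ℕ) < n := i.2
  have hj' : (j : ℕ) < n := j.2
  simp only [map_sub, eval_C, eval_X, rho, hi', hj', if_true] at hj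
  have h3 : k * ((j : ℤ) - (i : ℤ) : ℤ) = ((χ i : ℤ) - (χ' j : ℤ) : ℤ) := by
    push_cast
    linear_combination -hj
  by_cases hij : i = j
  · subst hij
    rw [sub_self, Int.cast_zero, mul_zero, eq_comm, Int.cast_eq_zero] at h3
    omega
  · exfalso
    have h4 : ((j : ℤ) - (i : ℤ)) ≠ 0 := fun h => hij (Fin.ext (by omega))
    refine hk (((χ i : ℤ) - (χ' j : ℤ) : ℤ) / ((j : ℤ) - (i : ℤ) : ℤ)) ?_
    rw [Rat.cast_div, Rat.cast_intCast, Rat.cast_intCast, eq_div_iff (by exact_mod_cast h4), h3]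

/-- A generic linear combination of functions that separate the points of a finite set separates
them on its own. -/
theorem exists_separating_combination {ι : Type*} (S : Finset ι) (ψ : ℕ → ι → ℂ)
    (h : ∀ a b, (∀ r, ψ r a = ψ r b) → a = b) :
    ∃ (R : ℕ) (c : ℕ → ℂ), ∀ a ∈ S, ∀ b ∈ S,
      ∑ r ∈ Finset.range R, c r * ψ r a = ∑ r ∈ Finset.range R, c r * ψ r b → a = b := by
  classical
  have h1 : ∀ p : ι × ι, ∃ r, p.1 ≠ p.2 → ψ r p.1 ≠ ψ r p.2 := by
    intro p
    by_contra! hp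
    exact (hp 0).1 (h _ _ fun r => (hp r).2)
  choose ρ hρ using h1
  set R := (S ×ˢ S).sup ρ + 1 with hR
  -- the combinations with coefficients `t ^ r` separate `a` from `b` unless `t` is a root of `F`
  set F : ι × ι → Polynomial ℂ := fun p =>
    ∑ r ∈ Finset.range R, Polynomial.C (ψ r p.1 - ψ r p.2) * Polynomial.X ^ r with hF
  have h2 : ∀ p ∈ S.offDiag, F p ≠ 0 := by
    intro p hp h0
    rw [Finset.mem_offDiag] at hp
    have h3 := congrArg (Polynomial.coeff · (ρ p)) h0
    simp only [hF, Polynomial.finsetSum_coeff, Polynomial.coeff_C_mul_X_pow,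
      Polynomial.coeff_zero, Finset.sum_ite_eq, Finset.mem_range] at h3
    have h4 : ρ p ≤ (S ×ˢ S).sup ρ := Finset.le_sup (Finset.mem_product.2 ⟨hp.1, hp.2.1⟩)
    rw [if_pos (by omega), sub_eq_zero] at h3
    exact hρ p hp.2.2 h3
  obtain ⟨t, ht⟩ : ∃ t, (∏ p ∈ S.offDiag, F p).eval t ≠ 0 := by
    by_contra! h0
    exact Finset.prod_ne_zero_iff.2 h2 (Polynomial.funext fun t => by rw [h0, Polynomial.eval_zero])
  refine ⟨R, fun r => t ^ r, fun a ha b hb hab => ?_⟩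
  by_contra hne
  rw [Polynomial.eval_prod, Finset.prod_ne_zero_iff] at ht
  refine ht (a, b) (Finset.mem_offDiag.2 ⟨ha, hb, hne⟩) ?_
  rw [hF, Polynomial.eval_finsetSum, ← sub_eq_zero.2 hab, ← Finset.sum_sub_distrib]
  refine Finset.sum_congr rfl fun r _ => ?_
  simp
  ring

/-! ### Joint eigenvectors on abstract power sums -/

/-- In `d` variables the power sums are independent in weight `d`, so that the degree of the leading
term detects zero. -/
theorem isLeadingDegree_powerEval (d : ℕ) (k : ℂ) :
    IsLeadingDegree fun F : PowerPart d => lexDeg d 0 (powerEval d 0 k F) where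
  eq_bot_iff F := by
    rw [lexDeg_eq_bot_iff]
    refine ⟨fun h => Subtype.ext ?_, fun h => by rw [h, ZeroMemClass.coe_zero, map_zero]⟩
    exact eq_zero_of_powerSumMap_eq_zero _ (fun i => by simp [parity]) (by simp) F.2 h
  add_le F G := by
    rw [Submodule.coe_add, map_add]
    exact lexDeg_add d 0 _ _
  smul_le c F := by
    rw [Submodule.coe_smul, map_smul]
    exact lexDeg_smul d 0 _ _

/-- The operator `universalIntegral` on polynomials of weight `d`. -/
def restrictedIntegral (k q : ℂ) (M d r : ℕ) : Module.End ℂ (PowerPart d) :=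
  (universalIntegral k q M r).restrict fun _ hF => universalIntegral_mem hF r

/-- In `d` variables of the same parity the operators act on leading terms by the symbols of the
integrals. -/
theorem isTriangular_restrictedIntegral (d : ℕ) {k : ℂ} (hk : k ≠ 0) (r : ℕ) :
    IsTriangular (fun F : PowerPart d => lexDeg d 0 (powerEval d 0 k F))
      (restrictedIntegral k (powerZero d 0 k) d d r)
      fun γ => eval (fun i => (lexExponent d 0 γ i : ℂ)) (cmsSymbol d 0 k (r + 1)) := by
  intro F hF
  have hF0 : powerEval d 0 k F ≠ 0 := fun h =>
    hF (((isLeadingDegree_powerEval d k).eq_bot_iff F).1 ((lexDeg_eq_bot_iff d 0 _).2 h))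
  have h := (hasSymbol_cmsIntegral d 0 k (r + 1)).lexDeg_sub_lt hF0
    (cmsIntegral_powerEval d 0 hk le_rfl F.2 r)
  rw [← lexExponent_lexDeg d 0 hF0, ← map_smul, ← map_sub] at h
  exact h

/-- The operators `universalIntegral` are diagonalizable simultaneously: in `d` variables of the
same parity, they are triangular with joint eigenvalues that separate the leading exponents, and
they are self-adjoint. -/
theorem exists_joint_eigenvectors (d : ℕ) {k : ℂ} (hk : ∀ q : ℚ, k ≠ q) (F : PowerPart d) :
    F ∈ Submodule.span ℂ {u : PowerPart d | ∀ r, ∃ c : ℂ,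
      restrictedIntegral k (powerZero d 0 k) d d r u = c • u} := by
  classical
  have hk0 : k ≠ 0 := by simpa using hk 0
  set val := fun F : PowerPart d => lexDeg d 0 (powerEval d 0 k F) with hval
  have hl : IsLeadingDegree val := isLeadingDegree_powerEval d k
  set ψ : ℕ → (Fin (d + 0) →₀ ℕ) → ℂ := fun r χ =>
    eval (fun i => (χ i : ℂ)) (cmsSymbol d 0 k (r + 1)) with hψ
  obtain ⟨R, c, hc⟩ := exists_separating_combination
    (Finset.finsuppAntidiag (Finset.univ : Finset (Fin (d + 0))) d) ψ
    fun _ _ h => eq_of_eval_cmsSymbol_eq d hk h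
  set A := fun r => restrictedIntegral k (powerZero d 0 k) d d r with hA
  have hAt : ∀ r, IsTriangular val (A r) fun γ => ψ r (lexExponent d 0 γ) := fun r =>
    isTriangular_restrictedIntegral d hk0 r
  set B : PowerPart d →ₗ[ℂ] PowerPart d →ₗ[ℂ] ℂ :=
    (powerForm k).domRestrict₁₂ (PowerPart d) (PowerPart d) with hB
  have hAB : ∀ r v w, B (A r v) w = B v (A r w) := fun r v w =>
    powerForm_universalIntegral hk0 _ d r (v : MvPolynomial ℕ ℂ) w
  have hBn : ∀ v, (∀ w, B v w = 0) → v = 0 := fun v h =>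
    Subtype.ext (powerForm_nondegenerate hk0 v.2 fun G hG => h ⟨G, hG⟩)
  set Y := ∑ r ∈ Finset.range R, c r • A r with hY
  have hYB : ∀ v w, B (Y v) w = B v (Y w) := by
    intro v w
    simp only [hY, LinearMap.sum_apply, map_sum, LinearMap.smul_apply, map_smul, hAB]
  have hYt := IsTriangular.sum_smul hl (Finset.range R) c hAt
  have hdeg : ∀ v : PowerPart d, v ≠ 0 → lexExponent d 0 (val v) ∈
      Finset.finsuppAntidiag (Finset.univ : Finset (Fin (d + 0))) d := by
    intro v hv
    have hv0 : powerEval d 0 k v ≠ 0 := fun h =>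
      hv ((hl.eq_bot_iff v).1 ((lexDeg_eq_bot_iff d 0 _).2 h))
    have h1 := isHomogeneous_powerSumMap (fun i => (k ^ parity d 0 i)⁻¹) v.2
      (MonomialOrder.lex.coeff_degree_ne_zero_iff.2 hv0)
    rw [hval, lexExponent_lexDeg d 0 hv0, Finset.mem_finsuppAntidiag]
    refine ⟨?_, Finset.subset_univ _⟩
    rw [← Finsupp.degree_eq_sum, Finsupp.degree_eq_weight_one]
    exact h1
  have hsep : ∀ v w : PowerPart d, v ≠ 0 → w ≠ 0 →
      ∑ r ∈ Finset.range R, c r * ψ r (lexExponent d 0 (val v)) =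
        ∑ r ∈ Finset.range R, c r * ψ r (lexExponent d 0 (val w)) → val v = val w := by
    intro v w hv hw h
    have h1 := hc _ (hdeg v hv) _ (hdeg w hw) h
    have hv0 : powerEval d 0 k v ≠ 0 := fun h =>
      hv ((hl.eq_bot_iff v).1 ((lexDeg_eq_bot_iff d 0 _).2 h))
    have hw0 : powerEval d 0 k w ≠ 0 := fun h =>
      hw ((hl.eq_bot_iff w).1 ((lexDeg_eq_bot_iff d 0 _).2 h))
    simp only [hval] at h1 ⊢
    rw [lexExponent_lexDeg d 0 hv0, lexExponent_lexDeg d 0 hw0] at h1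
    rw [lexDeg_eq d 0 hv0, lexDeg_eq d 0 hw0, h1]
  refine Submodule.span_mono (fun u hu r => ?_) (mem_span_leadingEigenvector hl hYt hsep F)
  exact ⟨_, IsLeadingEigenvector.of_selfAdjoint hl hBn hYB (hAB r) hYt (hAt r) hsep hu.1⟩

/-- The joint eigenvectors do not depend on the parameter `q`, which enters the matrix of operators
as the addition of a scalar. -/
theorem exists_eigenvalue_of_shift {k q q' : ℂ} {M : ℕ} {u : MvPolynomial ℕ ℂ}
    (h : ∀ r, ∃ c : ℂ, universalIntegral k q M r u = c • u) (r : ℕ) :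
    ∃ c : ℂ, universalIntegral k q' M r u = c • u := by
  have key : ∀ r i, ∃ c : ℂ, powerContract M ((universalMoser k q M ^ i)
      ((universalMoser k q' M ^ r) (powerGrad M u))) = c • u := by
    intro r
    induction r with
    | zero => exact fun i => h i
    | succ r ih =>
      intro i
      obtain ⟨a, ha⟩ := ih (i + 1)
      obtain ⟨b, hb⟩ := ih i
      refine ⟨a + k * (q - q') * b, ?_⟩
      rw [pow_succ' _ r, Module.End.mul_apply]
      conv_lhs => rw [universalMoser_eq_add k q' q]
      rw [LinearMap.add_apply, LinearMap.smul_apply, Module.End.one_apply, map_add, map_add,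
        ← Module.End.mul_apply, ← pow_succ, ← universalMoser_eq_add k q' q, ha, map_smul, map_smul,
        hb, smul_smul, add_smul]
  exact key r 0

/-- An element of `𝒟_{n,m}` with symbol zero annihilates the deformed power sums. -/
theorem apply_powerEval_eq_zero {n m : ℕ} {k : ℂ} (hk : ∀ q : ℚ, k ≠ q)
    {D : Module.End ℂ (RatFun n m)} (hD : D ∈ integralAlgebra n m k) (hs : HasSymbol n m D 0)
    (F : MvPolynomial ℕ ℂ) : D (algebraMap _ (RatFun n m) (powerEval n m k F)) = 0 := by
  have hk0 : k ≠ 0 := by simpa using hk 0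
  have hsmul : ∀ (c : ℂ) (p : MvPolynomial (Fin (n + m)) ℂ),
      algebraMap _ (RatFun n m) (c • p) = c • algebraMap _ (RatFun n m) p := fun c p => by
    rw [Algebra.smul_def, Algebra.smul_def, map_mul, ← IsScalarTower.algebraMap_apply]
  have hpart : ∀ d, ∀ F : PowerPart d,
      D (algebraMap _ (RatFun n m) (powerEval n m k F)) = 0 := by
    intro d F
    have hF := exists_joint_eigenvectors d hk F
    induction hF using Submodule.span_induction with
    | zero => rw [ZeroMemClass.coe_zero, map_zero, map_zero, map_zero]
    | add x y _ _ hx hy => rw [Submodule.coe_add, map_add, map_add, map_add, hx, hy, add_zero]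
    | smul c x _ hx => rw [Submodule.coe_smul, map_smul, hsmul, map_smul, hx, smul_zero]
    | mem u hu =>
      have hu' : ∀ r, ∃ c : ℂ, universalIntegral k (powerZero n m k) d r u = c • u :=
        exists_eigenvalue_of_shift (q := powerZero d 0 k) fun r => by
          obtain ⟨c, hc⟩ := hu r
          exact ⟨c, congrArg Subtype.val hc⟩
      set f := powerEval n m k u with hf
      have heig : ∀ E ∈ integralAlgebra n m k, ∃ c : ℂ,
          E (algebraMap _ (RatFun n m) f) = c • algebraMap _ (RatFun n m) f := by
        intro E hE
        induction hE using Algebra.adjoin_induction with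
        | mem E hE =>
          obtain ⟨r, hr, rfl⟩ := hE
          obtain ⟨s, rfl⟩ := Nat.exists_eq_add_of_le' hr
          obtain ⟨c, hc⟩ := hu' s
          refine ⟨c, ?_⟩
          rw [hf, cmsIntegral_powerEval n m hk0 le_rfl u.2 s, hc, map_smul, hsmul]
        | algebraMap c => exact ⟨c, by rw [Module.algebraMap_end_apply]⟩
        | add x y _ _ hx hy =>
          obtain ⟨a, ha⟩ := hx
          obtain ⟨b, hb⟩ := hy
          exact ⟨a + b, by rw [LinearMap.add_apply, ha, hb, add_smul]⟩
        | mul x y _ _ hx hy =>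
          obtain ⟨a, ha⟩ := hx
          obtain ⟨b, hb⟩ := hy
          exact ⟨b * a, by rw [Module.End.mul_apply, hb, map_smul, ha, smul_smul]⟩
      obtain ⟨c, hc⟩ := heig D hD
      rcases eq_or_ne f 0 with h0 | h0
      · rw [h0, map_zero, map_zero]
      · have h1 := hs.lexDeg_sub_lt h0 (hc.trans (hsmul c f).symm)
        rw [map_zero, zero_smul, sub_zero] at h1
        have hc0 : c = 0 := by
          by_contra hne
          refine absurd h1 (not_lt.2 ?_)
          have := lexDeg_smul n m c⁻¹ (c • f)
          rwa [smul_smul, inv_mul_cancel₀ hne, one_smul] at this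
        rw [hc, hc0, zero_smul]
  rw [F.as_sum, map_sum, map_sum, map_sum]
  refine Finset.sum_eq_zero fun a _ => ?_
  exact hpart (Finsupp.weight powerWeight a)
    ⟨monomial a (coeff a F), isWeightedHomogeneous_monomial _ _ _ rfl⟩

/-! ### Differential operators that annihilate the deformed power sums -/

/-- The differential operators of order less than `r` on a commutative algebra `K`, in the sense
that the iterated commutators with `r` multiplications vanish. -/
def IsDiffOp {K : Type*} [CommRing K] [Algebra ℂ K] : ℕ → Module.End ℂ K → Prop
  | 0, D => D = 0
  | r + 1, D => ∀ g : K, IsDiffOp r (D * LinearMap.mulLeft ℂ g - LinearMap.mulLeft ℂ g * D)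

section IsDiffOp

variable {K : Type*} [CommRing K] [Algebra ℂ K]

theorem IsDiffOp.zero (r : ℕ) : IsDiffOp r (0 : Module.End ℂ K) := by
  induction r with
  | zero => rfl
  | succ r ih => exact fun g => by rwa [zero_mul, mul_zero, sub_zero]

theorem IsDiffOp.succ {r : ℕ} {D : Module.End ℂ K} (h : IsDiffOp r D) : IsDiffOp (r + 1) D := by
  induction r generalizing D with
  | zero => exact (show D = 0 from h) ▸ IsDiffOp.zero 1
  | succ r ih => exact fun g => ih (h g)

theorem IsDiffOp.mono {r s : ℕ} {D : Module.End ℂ K} (h : IsDiffOp r D) (hrs : r ≤ s) :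
    IsDiffOp s D := by
  induction hrs with
  | refl => exact h
  | step _ ih => exact ih.succ

theorem IsDiffOp.add {r : ℕ} {D E : Module.End ℂ K} (hD : IsDiffOp r D) (hE : IsDiffOp r E) :
    IsDiffOp r (D + E) := by
  induction r generalizing D E with
  | zero => rw [show D = 0 from hD, show E = 0 from hE, add_zero]; exact IsDiffOp.zero 0
  | succ r ih =>
    intro g
    rw [add_mul, mul_add, add_sub_add_comm]
    exact ih (hD g) (hE g)

theorem IsDiffOp.mul {r s : ℕ} {D E : Module.End ℂ K} (hD : IsDiffOp r D) (hE : IsDiffOp s E) :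
    IsDiffOp (r + s) (D * E) := by
  induction hN : r + s using Nat.strong_induction_on generalizing r s D E with
  | _ N ih =>
    subst hN
    rcases r with _ | r
    · rw [show D = 0 from hD, zero_mul]
      exact IsDiffOp.zero _
    rcases s with _ | s
    · rw [show E = 0 from hE, mul_zero]
      exact IsDiffOp.zero _
    intro g
    have e : D * E * LinearMap.mulLeft ℂ g - LinearMap.mulLeft ℂ g * (D * E) =
        D * (E * LinearMap.mulLeft ℂ g - LinearMap.mulLeft ℂ g * E) +
          (D * LinearMap.mulLeft ℂ g - LinearMap.mulLeft ℂ g * D) * E := by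
      simp only [mul_sub, sub_mul, mul_assoc]
      abel
    rw [e]
    refine IsDiffOp.add (ih (r + 1 + s) (by omega) hD (hE g) rfl) ?_
    have := ih (r + (s + 1)) (by omega) (hD g) hE rfl
    rwa [show r + (s + 1) = r + 1 + s by omega] at this

theorem isDiffOp_mulLeft (f : K) : IsDiffOp 1 (LinearMap.mulLeft ℂ f) := by
  intro g
  refine LinearMap.ext fun h => ?_
  simp only [LinearMap.sub_apply, Module.End.mul_apply, LinearMap.mulLeft_apply,
    LinearMap.zero_apply]
  ring

theorem isDiffOp_derivation (δ : Derivation ℂ K K) : IsDiffOp 2 (δ : K →ₗ[ℂ] K) := by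
  intro g
  have e : (δ : K →ₗ[ℂ] K) * LinearMap.mulLeft ℂ g - LinearMap.mulLeft ℂ g * (δ : K →ₗ[ℂ] K) =
      LinearMap.mulLeft ℂ (δ g) := by
    refine LinearMap.ext fun h => ?_
    simp only [LinearMap.sub_apply, Module.End.mul_apply, LinearMap.mulLeft_apply,
      Derivation.coeFn_coe, Derivation.leibniz, smul_eq_mul]
    ring
  rw [e]
  exact isDiffOp_mulLeft _

/-- If every derivation that annihilates the subalgebra `S` is zero, then a differential operator
that commutes with `S` is a multiplication. -/
theorem IsDiffOp.commute_mulLeft {S : Subalgebra ℂ K}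
    (hS : ∀ δ : Derivation ℂ K K, (∀ g ∈ S, δ g = 0) → δ = 0) {r : ℕ} {D : Module.End ℂ K}
    (hD : IsDiffOp r D) (h : ∀ g ∈ S, Commute D (LinearMap.mulLeft ℂ g)) (g : K) :
    Commute D (LinearMap.mulLeft ℂ g) := by
  have hcomm : ∀ f g : K, Commute (LinearMap.mulLeft ℂ f) (LinearMap.mulLeft ℂ g) := fun f g => by
    refine LinearMap.ext fun x => ?_
    simp only [Module.End.mul_apply, LinearMap.mulLeft_apply]
    ring
  induction r generalizing D g with
  | zero =>
    rw [show D = 0 from hD]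
    exact Commute.zero_left _
  | succ r ih =>
    have h1 : ∀ f g : K, Commute (D * LinearMap.mulLeft ℂ f - LinearMap.mulLeft ℂ f * D)
        (LinearMap.mulLeft ℂ g) := fun f g =>
      ih (hD f) (fun g hg => ((h g hg).mul_left (hcomm f g)).sub_left
        ((hcomm f g).mul_left (h g hg))) g
    -- the commutators are multiplications, so that `f ↦ [D, f] 1` is a derivation
    have h2 : ∀ f g : K, D (f * g) - f * D g = (D f - f * D 1) * g := by
      intro f g
      have := LinearMap.congr_fun (h1 f g) 1
      simp only [Module.End.mul_apply, LinearMap.sub_apply, LinearMap.mulLeft_apply,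
        mul_one] at this
      rw [this]
      ring
    let δ : Derivation ℂ K K := Derivation.mk'
      (D - LinearMap.mulRight ℂ (D 1)) fun f g => by
        simp only [LinearMap.sub_apply, LinearMap.mulRight_apply, smul_eq_mul]
        linear_combination h2 f g
    have hδ : δ = 0 := hS δ fun g hg => by
      have := LinearMap.congr_fun (h g hg) 1
      simp only [Module.End.mul_apply, LinearMap.mulLeft_apply, mul_one] at this
      change D g - g * D 1 = 0
      rw [this, sub_self]
    have h3 : ∀ f, D f = f * D 1 := fun f => by
      have := congrArg (fun δ : Derivation ℂ K K => δ f) hδ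
      exact sub_eq_zero.1 this
    refine LinearMap.ext fun f => ?_
    simp only [Module.End.mul_apply, LinearMap.mulLeft_apply]
    rw [h3 (g * f), h3 f, mul_assoc]

/-- If every derivation that annihilates the subalgebra `S` is zero, then so is every differential
operator that annihilates `S`. -/
theorem IsDiffOp.eq_zero {S : Subalgebra ℂ K}
    (hS : ∀ δ : Derivation ℂ K K, (∀ g ∈ S, δ g = 0) → δ = 0) {r : ℕ} {D : Module.End ℂ K}
    (hD : IsDiffOp r D) (h : ∀ g ∈ S, D g = 0) : D = 0 := by
  induction r generalizing D with
  | zero => exact hD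
  | succ r ih =>
    have h1 : ∀ g ∈ S, Commute D (LinearMap.mulLeft ℂ g) := fun g hg => by
      refine sub_eq_zero.1 (ih (hD g) fun f hf => ?_)
      simp only [LinearMap.sub_apply, Module.End.mul_apply, LinearMap.mulLeft_apply]
      rw [h _ (mul_mem hg hf), h f hf, mul_zero, sub_zero]
    refine LinearMap.ext fun f => ?_
    have h2 := LinearMap.congr_fun (hD.commute_mulLeft hS h1 f) 1
    simpa [h 1 (one_mem S)] using h2

end IsDiffOp

theorem exists_isDiffOp (n m : ℕ) (k : ℂ) {D : Module.End ℂ (RatFun n m)}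
    (hD : D ∈ operatorAlgebra n m k) : ∃ r, IsDiffOp r D := by
  have hsmul : ∀ (c : ℂ) (E : Module.End ℂ (RatFun n m)),
      c • E = LinearMap.mulLeft ℂ (algebraMap ℂ (RatFun n m) c) * E := fun c E => by
    refine LinearMap.ext fun f => ?_
    rw [LinearMap.smul_apply, Module.End.mul_apply, LinearMap.mulLeft_apply, Algebra.smul_def]
  induction hD using Algebra.adjoin_induction with
  | mem D h =>
    rcases h with ⟨i, rfl⟩ | ⟨i, j, h, rfl⟩
    · rw [del, hsmul]
      exact ⟨_, (isDiffOp_mulLeft _).mul ((isDiffOp_mulLeft _).mul (isDiffOp_derivation _))⟩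
    · exact ⟨1, isDiffOp_mulLeft _⟩
  | algebraMap c =>
    rw [Algebra.algebraMap_eq_smul_one, hsmul, mul_one]
    exact ⟨1, isDiffOp_mulLeft _⟩
  | add D E _ _ hD hE =>
    obtain ⟨r, hr⟩ := hD
    obtain ⟨s, hs⟩ := hE
    exact ⟨max r s, (hr.mono (le_max_left _ _)).add (hs.mono (le_max_right _ _))⟩
  | mul D E _ _ hD hE =>
    obtain ⟨r, hr⟩ := hD
    obtain ⟨s, hs⟩ := hE
    exact ⟨_, hr.mul hs⟩

/-- The rational functions that are polynomials in the deformed power sums. -/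
def powerSubalgebra (n m : ℕ) (k : ℂ) : Subalgebra ℂ (RatFun n m) :=
  ((Algebra.algHom ℂ (MvPolynomial (Fin (n + m)) ℂ) (RatFun n m)).comp (powerEval n m k)).range

/-- A derivation that annihilates the deformed power sums annihilates the coordinates, since the
differentials of the first `n + m` power sums are independent by Vandermonde's determinant. -/
theorem derivation_eq_zero (n m : ℕ) {k : ℂ} (hk : k ≠ 0)
    (δ : Derivation ℂ (RatFun n m) (RatFun n m)) (h : ∀ g ∈ powerSubalgebra n m k, δ g = 0) :
    δ = 0 := by
  have hx : ∀ i, δ (x n m i) = 0 := by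
    have h1 : (fun i => (k ^ parity n m i)⁻¹ • δ (x n m i)) = 0 := by
      refine Matrix.eq_zero_of_forall_pow_sum_mul_pow_eq_zero (f := x n m) (fun i j hij => ?_)
        fun t => ?_
      · by_contra hne
        exact x_sub_ne_zero n m hne (sub_eq_zero.2 hij)
      · have h2 := h _ ⟨X (t : ℕ), rfl⟩
        have h3 : (algebraMap _ (RatFun n m) (powerEval n m k (X (t : ℕ)))) =
            ∑ i, (k ^ parity n m i)⁻¹ • x n m i ^ ((t : ℕ) + 1) := by
          rw [powerEval, powerSumMap_X, map_sum]
          refine Finset.sum_congr rfl fun i _ => ?_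
          rw [map_mul, map_pow, ← MvPolynomial.algebraMap_eq, ← IsScalarTower.algebraMap_apply,
            Algebra.smul_def, x]
        have h4 : ((t : ℕ) + 1 : RatFun n m) ≠ 0 := Nat.cast_add_one_ne_zero _
        refine (mul_eq_zero.1 ?_).resolve_left h4
        rw [← h2]
        change _ = δ (algebraMap _ (RatFun n m) (powerEval n m k (X (t : ℕ))))
        rw [h3, map_sum, Finset.mul_sum]
        refine Finset.sum_congr rfl fun i _ => ?_
        rw [Derivation.map_smul, Derivation.leibniz_pow, Nat.add_sub_cancel, nsmul_eq_mul,
          smul_eq_mul, smul_mul_assoc, mul_smul_comm]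
        push_cast
        congr 1
        ring
    intro i
    exact (smul_eq_zero.1 (congrFun h1 i)).resolve_left
      (inv_ne_zero (pow_parity_ne_zero n m hk i))
  have hp : ∀ p : MvPolynomial (Fin (n + m)) ℂ, δ (algebraMap _ (RatFun n m) p) = 0 := by
    intro p
    induction p using MvPolynomial.induction_on with
    | C a =>
      rw [← MvPolynomial.algebraMap_eq, ← IsScalarTower.algebraMap_apply, Derivation.map_algebraMap]
    | add p q hp hq => rw [map_add, map_add, hp, hq, add_zero]
    | mul_X p i hp =>
      have := hx i
      rw [x] at this
      rw [map_mul, Derivation.leibniz, hp, this, smul_zero, smul_zero, add_zero]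
  refine Derivation.ext fun f => ?_
  obtain ⟨p, q, hq, rfl⟩ := IsFractionRing.div_surjective (A := MvPolynomial (Fin (n + m)) ℂ) f
  rw [Derivation.leibniz_div, hp, hp]
  simp

/-- An operator with symbol zero annihilates the deformed power sums, and so is zero. -/
theorem harishChandra_injective (n m : ℕ) {k : ℂ} (hk : ∀ q : ℚ, k ≠ q) :
    Function.Injective (harishChandra n m k) := by
  refine (injective_iff_map_eq_zero _).2 fun D hD => Subtype.ext ?_
  obtain ⟨r, hr⟩ := exists_isDiffOp n m k (integralAlgebra_le n m k D.2)
  refine hr.eq_zero (derivation_eq_zero n m (by simpa using hk 0)) ?_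
  rintro _ ⟨F, rfl⟩
  refine apply_powerEval_eq_zero hk D.2 ?_ F
  rw [← hD]
  exact hasSymbol_harishChandra n m k D

end DeformedCMS

end

theorem mainTheorem5 (n m : ℕ) (k : ℂ) (hk : ∀ q : ℚ, k ≠ (q : ℂ)) :
    Function.Injective (DeformedCMS.harishChandra n m k) ∧
      (DeformedCMS.harishChandra n m k).range = DeformedCMS.shiftedQuasiInvariants n m k :=
  ⟨DeformedCMS.harishChandra_injective n m hk, by
    rw [DeformedCMS.range_harishChandra, DeformedCMS.adjoin_cmsSymbol n m hk]⟩
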